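/- **Setting.** Let $\Omega\subset\mathbb{R}^3$ be an open set that is the interior of its closure, where $\overline\Omega$ is a finite union of tetrahedra (e.g. any bounded Lipschitz polyhedron), and write $a(\mathbf u,\mathbf v)=(\operatorname{curl}\mathbf u,\operatorname{curl}\mathbf v)_{L^2(\Omega)}+(\mathbf u,\mathbf v)_{L^2(\Omega)}$, $\|\mathbf u\|_A=a(\mathbf u,\mathbf u)^{1/2}$, with the distributional curl. A *mesh* is a finite set of closed non-degenerate tetrahedra with pairwise disjoint interiors and union $\overline\Omega$; hanging nodes are allowed. It is *conforming* if any two elements meet in a common face, edge, vertex, or not at all. $\mathcal M\prec\mathcal T$ means that each element of $\mathcal M$ is a union of elements of $\mathcal T$. Put $h_K=\operatorname{diam}K$, and let $\rho_K$ be the ratio of $h_K$ to the radius of the largest ball contained in $K$. Let $\mathcal M_0\prec\mathcal M_1\prec\dots\prec\mathcal M_L$ be meshes, and let $\Gamma_D\subset\partial\Omega$ be a union of faces of elements of $\mathcal M_0$. The level $\ell(K)$ is the number of subdivisions that generate $K$ from an element of $\mathcal M_0$, and $\mathcal M_{l+1}$ arises from $\mathcal M_l$ by subdividing some or all $K\in\mathcal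 M_l$ with $\ell(K)=l$. Let $\mathcal M_0=\widehat{\mathcal M}_0\prec\widehat{\mathcal M}_1\prec\dots\prec\widehat{\mathcal M}_L$ be conforming meshes with $\mathcal M_l\prec\widehat{\mathcal M}_l$ and $\{K\in\mathcal M_l:\ell(K)=l\}\subset\widehat{\mathcal M}_l$, and let $0<\theta<1$, $\kappa>0$ be such that $$\kappa^{-1}\theta^l\le h_K\le\kappa\,\theta^l\qquad\forall K\in\widehat{\mathcal M}_l,\ 0\le l\le L.\tag{1}$$ Let $\omega_l$ be the interior of $\bigcup\{K\in\mathcal M_L:\ell(K)\ge l\}$. A vertex of $\mathcal M_l$ is *active* if it is neither on $\Gamma_D$ nor in the relative interior of an edge or a face of $\mathcal M_l$. An edge of an element of $\mathcal M_l$ is *active* if it is not contained in $\Gamma_D$ and each of its end points is active or on $\Gamma_D$. Let $b_{\boldsymbol p}$ be the tent function on $\widehat{\mathcal M}_l$ of a vertex $\boldsymbol p$, and let $\mathbf b_E$ be the lowest order edge element basis function on $\widehat{\mathcal M}_l$ of an edge $E=[\boldsymbol p,\boldsymbol q]$, that is, $\mathbf b_E|_K=\lambda_{\boldsymbol p}\nabla\lambda_{\boldsymbol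 q}-\lambda_{\boldsymbol q}\nabla\lambda_{\boldsymbol p}$ with barycentric coordinates $\lambda$ on each $K\in\widehat{\mathcal M}_l$ containing $E$, and $\mathbf b_E=0$ elsewhere. For each $l$, let the set of active vertices $\boldsymbol p$ of $\mathcal M_l$ with $\operatorname{supp}b_{\boldsymbol p}\subset\overline\omega_l$ be partitioned into $\mathcal N_l^1,\dots,\mathcal N_l^{P_{\mathcal N}}$. Likewise let the set of active edges $E$ of $\mathcal M_l$ that are also active edges of $\widehat{\mathcal M}_l$ and satisfy $\operatorname{supp}\mathbf b_E\subset\overline\omega_l$ be partitioned into $\mathcal E_l^1,\dots,\mathcal E_l^{P_{\mathcal E}}$. Both partitions are such that for every $K\in\mathcal M_l$ with interior in $\omega_l$ no class contains two different vertices (edges, respectively) of $K$. Put $$V_l^i=\operatorname{span}\{b_{\boldsymbol p}:\boldsymbol p\in\mathcal N_l^i\},\qquad \mathbf U_l^i=\operatorname{span}\{\mathbf b_E:E\in\mathcal E_l^i\}.$$ **Theorem (strengthened Cauchy–Schwarz inequality).** For every $\rho$ there is a constant $C=C(\rho)>0$, depending on nothing else, such that in every such setting with $\rho_K\le\rho$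 for all $K\in\mathcal M_l$, $0\le l\le L$, the following holds. For all $0\le l,m\le L$, every $\mathbf u$ that belongs to some $\mathbf U_l^i$ or to some $\nabla V_l^i$, and every $\mathbf v$ that belongs to some $\mathbf U_m^j$ or to some $\nabla V_m^j$, $$a(\mathbf u,\mathbf v)\;\le\;C\,\kappa\,\theta^{|l-m|/2}\,\|\mathbf u\|_A\,\|\mathbf v\|_A ,$$ where $\theta$ and $\kappa$ are the rate and the constant in (1). -/

import Mathlib

open MeasureTheory
open scoped ContDiff

namespace LocalMG

/-- Euclidean three-space. -/
abbrev E3 : Type := EuclideanSpace ℝ (Fin 3)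

/-! ### The energy inner product on `H(curl)` -/

section Energy

/-- Classical curl of a (differentiable) vector field. -/
noncomputable def curl (φ : E3 → E3) (x : E3) : E3 :=
  let d : Fin 3 → Fin 3 → ℝ := fun i j => fderiv ℝ φ x (EuclideanSpace.single i 1) j
  !₂[d 1 2 - d 2 1, d 2 0 - d 0 2, d 0 1 - d 1 0]

/-- Classical divergence of a (differentiable) vector field. -/
noncomputable def divergence (φ : E3 → E3) (x : E3) : ℝ :=
  ∑ i : Fin 3, fderiv ℝ φ x (EuclideanSpace.single i 1) i

/-- Smooth vector fields with compact support in `Ω`. -/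
def IsTestField (Ω : Set E3) (φ : E3 → E3) : Prop :=
  ContDiff ℝ ∞ φ ∧ HasCompactSupport φ ∧ tsupport φ ⊆ Ω

/-- `w` is square integrable on `Ω` and is the distributional curl of `u` on `Ω`. -/
def IsWeakCurl (Ω : Set E3) (u w : E3 → E3) : Prop :=
  MemLp w 2 (volume.restrict Ω) ∧
    ∀ φ, IsTestField Ω φ →
      ∫ x in Ω, inner ℝ (u x) (curl φ x) = ∫ x in Ω, inner ℝ (w x) (φ x)

/-- `w` is square integrable on `Ω` and is the distributional gradient of `f` on `Ω`. -/
def IsWeakGradient (Ω : Set E3) (f : E3 → ℝ) (w : E3 → E3) : Prop :=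
  MemLp w 2 (volume.restrict Ω) ∧
    ∀ φ, IsTestField Ω φ →
      ∫ x in Ω, f x * divergence φ x = - ∫ x in Ω, inner ℝ (w x) (φ x)

open Classical in
/-- The square integrable distributional curl of `u ∈ H(curl; Ω)`; it is unique almost everywhere.
(The value is `0` if `u` has none.) -/
noncomputable def weakCurl (Ω : Set E3) (u : E3 → E3) : E3 → E3 :=
  if h : ∃ w, IsWeakCurl Ω u w then h.choose else 0

/-- The energy inner product `a(u, v) = (curl u, curl v) + (u, v)`. -/
noncomputable def energyForm (Ω : Set E3) (u v : E3 → E3) : ℝ :=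
  (∫ x in Ω, inner ℝ (weakCurl Ω u x) (weakCurl Ω v x)) + ∫ x in Ω, inner ℝ (u x) (v x)

/-- The energy norm. -/
noncomputable def energyNorm (Ω : Set E3) (u : E3 → E3) : ℝ :=
  Real.sqrt (energyForm Ω u u)

end Energy

/-! ### Tetrahedra and meshes -/

section Meshes

/-- A nondegenerate tetrahedron, given by its set of vertices. -/
@[ext]
structure Tetrahedron where
  vertices : Finset E3
  card_vertices : vertices.card = 4
  indep : AffineIndependent ℝ ((↑) : vertices → E3)

namespace Tetrahedron

/-- The closed tetrahedron. -/
def carrier (K : Tetrahedron) : Set E3 := convexHull ℝ (K.vertices : Set E3)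

/-- The vertices as an affine basis of the space. -/
noncomputable def basis (K : Tetrahedron) : AffineBasis K.vertices ℝ E3 where
  toFun := (↑)
  ind' := K.indep
  tot' := by
    rw [K.indep.affineSpan_eq_top_iff_card_eq_finrank_add_one]
    simp [K.card_vertices]

open Classical in
/-- The barycentric coordinate function of the vertex `p` of `K` (zero if `p` is no vertex). -/
noncomputable def bary (K : Tetrahedron) (p : E3) : E3 → ℝ :=
  if h : p ∈ K.vertices then fun x => K.basis.coord ⟨p, h⟩ x else 0

/-- The diameter `h_K`. -/
noncomputable def diam (K : Tetrahedron) : ℝ := Metric.diam K.carrier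

/-- The radius of the largest ball contained in `K`. -/
noncomputable def inradius (K : Tetrahedron) : ℝ :=
  sSup {r : ℝ | ∃ c : E3, Metric.ball c r ⊆ K.carrier}

/-- The shape regularity measure `ρ_K`. -/
noncomputable def shapeRegularity (K : Tetrahedron) : ℝ := K.diam / K.inradius

/-- The edges, as unordered pairs of distinct vertices. -/
def edges (K : Tetrahedron) : Set (Sym2 E3) :=
  {E | ∃ p ∈ K.vertices, ∃ q ∈ K.vertices, p ≠ q ∧ E = s(p, q)}

end Tetrahedron

/-- A tetrahedral mesh of `Ω`; hanging nodes are allowed. -/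
structure IsMesh (Ω : Set E3) (M : Set Tetrahedron) : Prop where
  finite : M.Finite
  cover : ⋃ K ∈ M, K.carrier = closure Ω
  disjoint : ∀ K ∈ M, ∀ K' ∈ M, K ≠ K' → Disjoint (interior K.carrier) (interior K'.carrier)

/-- No hanging nodes: two elements meet in a common face, edge, vertex, or not at all. -/
def Conforming (M : Set Tetrahedron) : Prop :=
  ∀ K ∈ M, ∀ K' ∈ M, K.carrier ∩ K'.carrier ⊆
    convexHull ℝ ((K.vertices : Set E3) ∩ (K'.vertices : Set E3))

/-- `M ≺ T`: every element of `M` is a union of elements of `T`. -/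
def Nested (M T : Set Tetrahedron) : Prop :=
  ∀ K ∈ M, ∃ S ⊆ T, K.carrier = ⋃ K' ∈ S, K'.carrier

/-- `Γ` is a part of the boundary of `Ω` that is a union of faces of elements of `M`. -/
def ResolvesBoundaryPart (Ω Γ : Set E3) (M : Set Tetrahedron) : Prop :=
  Γ ⊆ frontier Ω ∧ ∃ 𝓕 : Set (Finset E3),
    (∀ F ∈ 𝓕, F.card = 3 ∧ ∃ K ∈ M, F ⊆ K.vertices) ∧
    Γ = ⋃ F ∈ 𝓕, convexHull ℝ (F : Set E3)

/-- Active vertices: vertices of `M` that lie neither on `Γ` nor in the (relative) interior of an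
edge or face of `M`. -/
def activeVertices (Γ : Set E3) (M : Set Tetrahedron) : Set E3 :=
  {p | (∃ K ∈ M, p ∈ K.vertices) ∧ p ∉ Γ ∧
    ∀ K ∈ M, ∀ F ⊆ K.vertices, F.card = 2 ∨ F.card = 3 →
      p ∉ intrinsicInterior ℝ (convexHull ℝ (F : Set E3))}

/-- Active edges: edges of elements of `M` that are not contained in `Γ` and whose end points are
either active or on `Γ`. -/
def activeEdges (Γ : Set E3) (M : Set Tetrahedron) : Set (Sym2 E3) :=
  {E | (∃ K ∈ M, E ∈ K.edges) ∧
    (∀ p q, E = s(p, q) → ¬ segment ℝ p q ⊆ Γ) ∧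
    ∀ p ∈ E, p ∈ activeVertices Γ M ∨ p ∈ Γ}

end Meshes

/-! ### Nodal basis functions on a conforming mesh -/

section BasisFunctions

open Classical in
/-- The nodal basis function (tent function) of continuous piecewise linear finite elements on the
conforming mesh `M`, attached to the vertex `p`; extended by zero. -/
noncomputable def tent (M : Set Tetrahedron) (p : E3) (x : E3) : ℝ :=
  if h : ∃ K ∈ M, x ∈ K.carrier then h.choose.bary p x else 0

open Classical in
/-- The nodal basis function of lowest order edge elements on the conforming mesh `M` for the edge
with end points `p`, `q`, oriented from `p` to `q`: in the element `K` it is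
`λ_p ∇λ_q - λ_q ∇λ_p`; extended by zero. The value on the (negligible) set of points that belong to
several elements is that of one of them. -/
noncomputable def edgeBasis (M : Set Tetrahedron) (p q : E3) (x : E3) : E3 :=
  if h : ∃ K ∈ M, x ∈ K.carrier then
    h.choose.bary p x • gradient (h.choose.bary q) x
      - h.choose.bary q x • gradient (h.choose.bary p) x
  else 0

end BasisFunctions

/-! ### Refinement hierarchies -/

section Hierarchy

/-- `HasLevel M L K n`: it took `n` subdivisions to generate `K` from an element of `M 0` within the
nested sequence `M 0, …, M L`. -/
inductive HasLevel (M : ℕ → Set Tetrahedron) (L : ℕ) : Tetrahedron → ℕ → Prop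
  | initial (K : Tetrahedron) (hK : K ∈ M 0) : HasLevel M L K 0
  | child (l n : ℕ) (K K' : Tetrahedron) (hl : l < L) (hK : K ∈ M l) (hn : HasLevel M L K n)
      (hK' : K' ∈ M (l + 1)) (hnew : K' ∉ M l) (hsub : K'.carrier ⊆ K.carrier) :
      HasLevel M L K' (n + 1)

/-- A virtual refinement hierarchy `M 0 ≺ ⋯ ≺ M L` of meshes of `Ω`, hanging nodes being allowed,
accompanied by a nested sequence `Mhat 0 ≺ ⋯ ≺ Mhat L` of conforming quasi-uniform meshes whose
meshwidths decrease geometrically with rate `θ`. -/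
structure IsRefinementHierarchy (Ω Γ : Set E3) (L : ℕ) (θ κ : ℝ)
    (M Mhat : ℕ → Set Tetrahedron) : Prop where
  isOpen : IsOpen Ω
  regular : interior (closure Ω) = Ω
  mesh : ∀ l ≤ L, IsMesh Ω (M l)
  boundary : ResolvesBoundaryPart Ω Γ (M 0)
  nested : ∀ l < L, Nested (M l) (M (l + 1))
  /-- `M (l + 1)` arises by subdividing some or all elements of level `l` of `M l`. -/
  refine : ∀ l < L, ∀ K' ∈ M (l + 1), K' ∉ M l →
    ∃ K ∈ M l, HasLevel M L K l ∧ K'.carrier ⊆ K.carrier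
  hat_mesh : ∀ l ≤ L, IsMesh Ω (Mhat l)
  hat_conforming : ∀ l ≤ L, Conforming (Mhat l)
  hat_zero : Mhat 0 = M 0
  hat_nested : ∀ l < L, Nested (Mhat l) (Mhat (l + 1))
  nested_hat : ∀ l ≤ L, Nested (M l) (Mhat l)
  level_subset_hat : ∀ l ≤ L, ∀ K ∈ M l, HasLevel M L K l → K ∈ Mhat l
  θ_pos : 0 < θ
  θ_lt_one : θ < 1
  κ_pos : 0 < κ
  quasiUniform : ∀ l ≤ L, ∀ K ∈ Mhat l, κ⁻¹ * θ ^ l ≤ K.diam ∧ K.diam ≤ κ * θ ^ l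

/-- The refinement zone `ω_l`: interior of the union of the elements of the finest mesh `M L` with
level at least `l`. -/
def refinementZone (M : ℕ → Set Tetrahedron) (L l : ℕ) : Set E3 :=
  interior (⋃ K ∈ {K | K ∈ M L ∧ ∃ n ≥ l, HasLevel M L K n}, K.carrier)

/-- The active vertices of `M l` whose nodal basis function on `Mhat l` is supported in the closed
refinement zone. -/
def zoneVertices (Γ : Set E3) (L : ℕ) (M Mhat : ℕ → Set Tetrahedron) (l : ℕ) : Set E3 :=
  {p | p ∈ activeVertices Γ (M l) ∧
    tsupport (tent (Mhat l) p) ⊆ closure (refinementZone M L l)}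

/-- The active edges of `M l` that carry a nodal basis function on `Mhat l`, the latter being
supported in the closed refinement zone. -/
def zoneEdges (Γ : Set E3) (L : ℕ) (M Mhat : ℕ → Set Tetrahedron) (l : ℕ) : Set (Sym2 E3) :=
  {E | E ∈ activeEdges Γ (M l) ∧ E ∈ activeEdges Γ (Mhat l) ∧
    ∀ p q, E = s(p, q) →
      tsupport (edgeBasis (Mhat l) p q) ⊆ closure (refinementZone M L l)}

/-- On each level the vertices in the refinement zone are partitioned into the classes
`𝒩 l 0, …, 𝒩 l (P - 1)`, and different vertices of an element in the zone are in different
classes. -/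
structure IsVertexColoring (Γ : Set E3) (L : ℕ) (M Mhat : ℕ → Set Tetrahedron) {P : ℕ}
    (𝒩 : ℕ → Fin P → Set E3) : Prop where
  iUnion_eq : ∀ l ≤ L, ⋃ i, 𝒩 l i = zoneVertices Γ L M Mhat l
  disjoint : ∀ l ≤ L, ∀ i j, i ≠ j → Disjoint (𝒩 l i) (𝒩 l j)
  separates : ∀ l ≤ L, ∀ K ∈ M l, interior K.carrier ⊆ refinementZone M L l →
    ∀ p ∈ K.vertices, ∀ q ∈ K.vertices, p ≠ q → ∀ i, ¬ (p ∈ 𝒩 l i ∧ q ∈ 𝒩 l i)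

/-- On each level the edges in the refinement zone are partitioned into the classes
`ℰ l 0, …, ℰ l (P - 1)`, and different edges of an element in the zone are in different classes. -/
structure IsEdgeColoring (Γ : Set E3) (L : ℕ) (M Mhat : ℕ → Set Tetrahedron) {P : ℕ}
    (ℰ : ℕ → Fin P → Set (Sym2 E3)) : Prop where
  iUnion_eq : ∀ l ≤ L, ⋃ i, ℰ l i = zoneEdges Γ L M Mhat l
  disjoint : ∀ l ≤ L, ∀ i j, i ≠ j → Disjoint (ℰ l i) (ℰ l j)
  separates : ∀ l ≤ L, ∀ K ∈ M l, interior K.carrier ⊆ refinementZone M L l →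
    ∀ E ∈ K.edges, ∀ E' ∈ K.edges, E ≠ E' → ∀ i, ¬ (E ∈ ℰ l i ∧ E' ∈ ℰ l i)

/-- `V_l^i`: the span of the tent functions (on the mesh `T`) of a class of vertices. -/
noncomputable def vertexSpace (T : Set Tetrahedron) (N : Set E3) : Submodule ℝ (E3 → ℝ) :=
  Submodule.span ℝ (tent T '' N)

/-- `U_l^i`: the span of the edge basis functions (on the mesh `T`) of a class of edges. -/
noncomputable def edgeSpace (T : Set Tetrahedron) (E : Set (Sym2 E3)) : Submodule ℝ (E3 → E3) :=
  Submodule.span ℝ {b | ∃ p q, s(p, q) ∈ E ∧ b = edgeBasis T p q}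

/-- `u` belongs to one of the spaces `U_l^i` or `∇V_l^i` of level `l`. -/
def IsComponent (Ω : Set E3) (Mhat : ℕ → Set Tetrahedron) {PN PE : ℕ}
    (𝒩 : ℕ → Fin PN → Set E3) (ℰ : ℕ → Fin PE → Set (Sym2 E3)) (l : ℕ) (u : E3 → E3) : Prop :=
  (∃ i, u ∈ edgeSpace (Mhat l) (ℰ l i)) ∨
    ∃ i, ∃ f ∈ vertexSpace (Mhat l) (𝒩 l i), IsWeakGradient Ω f u

end Hierarchy

end LocalMG

/-! Both sides are symmetric, so let `l ≤ m`, and look at one element K of the coarse conforming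
mesh `Mhat l`, with diameter h. The colouring leaves at most one basis function of the class on K,
so there u is a smooth divergence free field and curl u is constant. The fine function v is small
compared with its own derivative: with δ = κθ^m, scaling on the elements of `Mhat m` gives |v| ≤
Rδ|curl v| for an edge function, and |f| ≤ δ|∇f| if v = ∇f. Here R bounds the shape regularity.

Take a smooth cutoff η that is 1 where all barycentric coordinates of K are at least 2t and 0 where
one of them is at most t, with t = δ/h. For constant c, ∫_K c·curl v = ∫_K (1-η) c·curl v + ∫_K (∇η
× c)·v. Both integrands live in a strip along the boundary of K. Since |∇η| is at most a multiple of
R/δ, the smallness of v cancels the δ, and everything is bounded by |c| ∫ |curl v| over the strip.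
The strip has volume at most 24t|K|, so Cauchy–Schwarz yields a factor √t, while |c||K|^{1/2} is the
L² norm of curl u on K. For v = ∇f and a divergence free field a, the same computation runs with
∇η·a in place of ∇η × c, and an inverse estimate turns the maximum of |a| into its mean square. Both
cases are instances of `abs_integral_le_of_cutoff`. No traces on faces are needed.

Quasi-uniformity (1) gives t ≤ κ²θ^{m-l} (`mesh_ratio_le`), hence the factor κθ^{(m-l)/2}, and
Cauchy–Schwarz over the elements K finishes the leading terms. If v is an edge function, there
remains (u, v), for which ‖v‖ ≤ Rδ‖curl v‖ suffices, as θ^m ≤ θ^{(m-l)/2}. If v is a gradient, curl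
v = 0 and (u, v) is all there is.

Two preparations are needed. Combinatorially, an element of `Mhat l` that meets the refinement zone
belongs to `M l` (`mem_of_inter_zone`), so that shape regularity and colouring, which are assumed
for `M l` only, apply to it. Analytically, the elementwise gradients and curls of tent and edge
functions are the distributional ones (`hasGradient_tent`, `hasCurl_edgeBasis`). -/

namespace LocalMG

/-! ### Barycentric coordinates, their gradients, and volumes of boundary strips -/

namespace Tetrahedron

variable (K : Tetrahedron)

theorem range_basis : Set.range K.basis = (K.vertices : Set E3) := by
  ext x
  constructor
  · rintro ⟨y, rfl⟩
    exact y.2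
  · intro hx
    exact ⟨⟨x, hx⟩, rfl⟩

theorem bary_of_mem {p : E3} (h : p ∈ K.vertices) (x : E3) :
    K.bary p x = K.basis.coord ⟨p, h⟩ x := by
  simp [bary, h]

theorem bary_of_notMem {p : E3} (h : p ∉ K.vertices) (x : E3) : K.bary p x = 0 := by
  simp [bary, h]

theorem mem_carrier_iff {x : E3} : x ∈ K.carrier ↔ ∀ p ∈ K.vertices, 0 ≤ K.bary p x := by
  rw [carrier, ← range_basis, K.basis.convexHull_eq_nonneg_coord]
  constructor
  · intro h p hp
    rw [K.bary_of_mem hp]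
    exact h _
  · intro h p
    have := h p p.2
    rwa [K.bary_of_mem p.2] at this

theorem mem_interior_iff {x : E3} :
    x ∈ interior K.carrier ↔ ∀ p ∈ K.vertices, 0 < K.bary p x := by
  rw [carrier, ← range_basis, K.basis.interior_convexHull]
  constructor
  · intro h p hp
    rw [K.bary_of_mem hp]
    exact h _
  · intro h p
    have := h p p.2
    rwa [K.bary_of_mem p.2] at this

theorem sum_bary (x : E3) : ∑ p ∈ K.vertices, K.bary p x = 1 := by
  rw [← K.basis.sum_coord_apply_eq_one x, ← Finset.sum_coe_sort K.vertices]
  exact Finset.sum_congr rfl fun p _ => K.bary_of_mem p.2 x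

theorem sum_bary_smul (x : E3) : ∑ p ∈ K.vertices, K.bary p x • p = x := by
  rw [← Finset.sum_coe_sort K.vertices (fun p => K.bary p x • p)]
  conv_rhs => rw [← K.basis.linear_combination_coord_eq_self x]
  exact Finset.sum_congr rfl fun p _ => by rw [K.bary_of_mem p.2 x]; rfl

theorem bary_self {p : E3} (h : p ∈ K.vertices) : K.bary p p = 1 := by
  rw [K.bary_of_mem h]
  exact K.basis.coord_apply_eq ⟨p, h⟩

theorem bary_ne {p q : E3} (hq : q ∈ K.vertices) (hne : p ≠ q) : K.bary p q = 0 := by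
  by_cases h : p ∈ K.vertices
  · rw [K.bary_of_mem h]
    exact K.basis.coord_apply_ne (i := ⟨p, h⟩) (j := ⟨q, hq⟩) (by simpa using hne)
  · exact K.bary_of_notMem h q

theorem bary_nonneg {x : E3} (hx : x ∈ K.carrier) (p : E3) : 0 ≤ K.bary p x := by
  by_cases h : p ∈ K.vertices
  · exact K.mem_carrier_iff.1 hx p h
  · rw [K.bary_of_notMem h]

theorem bary_le_one {x : E3} (hx : x ∈ K.carrier) (p : E3) : K.bary p x ≤ 1 := by
  by_cases h : p ∈ K.vertices
  · rw [← K.sum_bary x]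
    exact Finset.single_le_sum (f := fun p => K.bary p x) (fun q _ => K.bary_nonneg hx q) h
  · rw [K.bary_of_notMem h]; exact zero_le_one

/-- The constant gradient of a barycentric coordinate. -/
noncomputable def baryGrad (p : E3) : E3 := gradient (K.bary p) 0

theorem exists_affine_bary (p : E3) :
    ∃ g : E3, ∀ x y, K.bary p y = K.bary p x + inner ℝ g (y - x) := by
  by_cases h : p ∈ K.vertices
  · refine ⟨(InnerProductSpace.toDual ℝ E3).symm
      (LinearMap.toContinuousLinearMap (K.basis.coord ⟨p, h⟩).linear), fun x y => ?_⟩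
    rw [InnerProductSpace.toDual_symm_apply, K.bary_of_mem h, K.bary_of_mem h]
    simp only [LinearMap.coe_toContinuousLinearMap']
    have := (K.basis.coord ⟨p, h⟩).linearMap_vsub y x
    simp only [vsub_eq_sub] at this
    rw [this]; ring
  · exact ⟨0, fun x y => by simp [K.bary_of_notMem h]⟩

theorem hasGradientAt_bary_aux {p g : E3}
    (hg : ∀ x y, K.bary p y = K.bary p x + inner ℝ g (y - x)) (x : E3) :
    HasGradientAt (K.bary p) g x := by
  rw [hasGradientAt_iff_hasFDerivAt]
  have : K.bary p = fun y => K.bary p x + (InnerProductSpace.toDual ℝ E3 g) (y - x) := by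
    ext y
    rw [hg x y, InnerProductSpace.toDual_apply_apply]
  rw [this]
  have h1 : HasFDerivAt (fun y : E3 => y - x) (ContinuousLinearMap.id ℝ E3) x :=
    (hasFDerivAt_id x).sub_const x
  exact ((InnerProductSpace.toDual ℝ E3 g).hasFDerivAt.comp x h1).const_add _

theorem hasGradientAt_bary (p x : E3) : HasGradientAt (K.bary p) (K.baryGrad p) x := by
  obtain ⟨g, hg⟩ := K.exists_affine_bary p
  rw [baryGrad, (K.hasGradientAt_bary_aux hg 0).gradient]
  exact K.hasGradientAt_bary_aux hg x

theorem gradient_bary (p x : E3) : gradient (K.bary p) x = K.baryGrad p :=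
  (K.hasGradientAt_bary p x).gradient

theorem bary_eq_add (p x y : E3) : K.bary p y = K.bary p x + inner ℝ (K.baryGrad p) (y - x) := by
  obtain ⟨g, hg⟩ := K.exists_affine_bary p
  rw [baryGrad, (K.hasGradientAt_bary_aux hg 0).gradient]
  exact hg x y

theorem contDiff_bary (p : E3) : ContDiff ℝ ∞ (K.bary p) := by
  have : K.bary p = fun y => K.bary p 0 + inner ℝ (K.baryGrad p) (y - 0) := by
    ext y
    exact K.bary_eq_add p 0 y
  rw [this]
  exact contDiff_const.add (contDiff_const.inner ℝ (contDiff_id.sub contDiff_const))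

theorem continuous_bary (p : E3) : Continuous (K.bary p) := (K.contDiff_bary p).continuous

theorem lipschitzWith_bary (p : E3) : LipschitzWith ‖K.baryGrad p‖₊ (K.bary p) := by
  refine LipschitzWith.of_dist_le_mul fun x y => ?_
  rw [K.bary_eq_add p y x, Real.dist_eq, add_sub_cancel_left, dist_eq_norm]
  simpa using abs_real_inner_le_norm (K.baryGrad p) (x - y)

theorem inner_baryGrad (p x y : E3) :
    inner ℝ (K.baryGrad p) (y - x) = K.bary p y - K.bary p x := by
  rw [K.bary_eq_add p x y]; ring

theorem convex_carrier : Convex ℝ K.carrier := convex_convexHull ℝ _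

theorem isCompact_carrier : IsCompact K.carrier :=
  K.vertices.finite_toSet.isCompact_convexHull ℝ

theorem isClosed_carrier : IsClosed K.carrier := K.isCompact_carrier.isClosed

theorem nonempty_interior : (interior K.carrier).Nonempty :=
  ⟨_, by
    rw [carrier, ← range_basis]
    exact K.basis.centroid_mem_interior_convexHull⟩

theorem closure_interior : closure (interior K.carrier) = K.carrier := by
  rw [K.convex_carrier.closure_interior_eq_closure_of_nonempty_interior K.nonempty_interior,
    K.isClosed_carrier.closure_eq]

theorem vertex_mem {p : E3} (hp : p ∈ K.vertices) : p ∈ K.carrier := subset_convexHull ℝ _ hp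

theorem eq_of_bary_eq_one {p x : E3} (hp : p ∈ K.vertices) (hx : x ∈ K.carrier)
    (h : K.bary p x = 1) : x = p := by
  have h0 : ∀ q ∈ K.vertices, q ≠ p → K.bary q x = 0 := by
    have hs := K.sum_bary x
    rw [← Finset.add_sum_erase _ _ hp, h, add_eq_left,
      Finset.sum_eq_zero_iff_of_nonneg fun q _ => K.bary_nonneg hx q] at hs
    exact fun q hq hne => hs q (Finset.mem_erase.2 ⟨hne, hq⟩)
  rw [← K.sum_bary_smul x, Finset.sum_eq_single_of_mem p hp, h, one_smul]
  intro q hq hne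
  rw [h0 q hq hne, zero_smul]

theorem bary_combo (p x y : E3) {a b : ℝ} (hab : a + b = 1) :
    K.bary p (a • x + b • y) = a * K.bary p x + b * K.bary p y := by
  rw [K.bary_eq_add p 0 (a • x + b • y), K.bary_eq_add p 0 x, K.bary_eq_add p 0 y]
  simp only [sub_zero, inner_add_right, inner_smul_right]
  linear_combination (-K.bary p 0) * hab

/-- At p the coordinate of p attains its maximum 1 over the tetrahedron, and only there. Hence the
vertex set can be recovered from the carrier, which turns equality of point sets into equality of
mesh elements. -/
theorem extreme_vertex {p : E3} (hp : p ∈ K.vertices) :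
    p ∈ Set.extremePoints ℝ K.carrier := by
  refine ⟨K.vertex_mem hp, ?_⟩
  rintro x hx y hy ⟨a, b, ha, hb, hab, hxy⟩
  apply K.eq_of_bary_eq_one hp hx
  have h1 := K.bary_combo p x y hab
  rw [hxy, K.bary_self hp] at h1
  have hx1 := K.bary_le_one hx p
  have hy1 := K.bary_le_one hy p
  nlinarith

theorem eq_of_carrier_eq {K K' : Tetrahedron} (h : K.carrier = K'.carrier) : K = K' := by
  apply Tetrahedron.ext
  apply Finset.Subset.antisymm
  · intro p hp
    have := K.extreme_vertex hp
    rw [h] at this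
    exact extremePoints_convexHull_subset this
  · intro p hp
    have := K'.extreme_vertex hp
    rw [← h] at this
    exact extremePoints_convexHull_subset this

theorem volume_frontier : volume (frontier K.carrier) = 0 :=
  K.convex_carrier.addHaar_frontier volume

theorem dist_le_diam {x y : E3} (hx : x ∈ K.carrier) (hy : y ∈ K.carrier) :
    ‖x - y‖ ≤ K.diam := by
  rw [← dist_eq_norm]
  exact Metric.dist_le_diam_of_mem K.isCompact_carrier.isBounded hx hy

theorem exists_ne_vertex (s : Finset E3) (hs : s.card < 4) : ∃ p ∈ K.vertices, p ∉ s := by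
  by_contra! h
  have := Finset.card_le_card (show K.vertices ⊆ s from h)
  rw [K.card_vertices] at this
  omega

theorem diam_pos : 0 < K.diam := by
  obtain ⟨p, hp, -⟩ := K.exists_ne_vertex ∅ (by simp)
  obtain ⟨q, hq, hqp⟩ := K.exists_ne_vertex {p} (by simp)
  refine lt_of_lt_of_le ?_ (K.dist_le_diam (K.vertex_mem hp) (K.vertex_mem hq))
  rw [norm_pos_iff, sub_ne_zero]
  simpa [eq_comm] using hqp

/-- The coordinate drops from 1 to 0 between p and another vertex, over a distance of at most the
diameter. -/
theorem baryGrad_lower {p : E3} (hp : p ∈ K.vertices) : 1 ≤ K.diam * ‖K.baryGrad p‖ := by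
  obtain ⟨q, hq, hqp⟩ := K.exists_ne_vertex {p} (by simp)
  have hne : p ≠ q := by simpa [eq_comm] using hqp
  have h := K.inner_baryGrad p q p
  rw [K.bary_self hp, K.bary_ne hq hne] at h
  have h2 := real_inner_le_norm (K.baryGrad p) (p - q)
  have h3 := K.dist_le_diam (K.vertex_mem hp) (K.vertex_mem hq)
  nlinarith [norm_nonneg (K.baryGrad p)]

/-- Moving from the centre by r in the direction of the gradient stays in the tetrahedron and raises
the coordinate by r times the gradient norm, but coordinates range in [0, 1]. -/
theorem ball_mul_baryGrad_le {r : ℝ} {c : E3} (h : Metric.ball c r ⊆ K.carrier) (p : E3) :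
    r * ‖K.baryGrad p‖ ≤ 1 := by
  rcases le_or_gt r 0 with hr | hr
  · nlinarith [norm_nonneg (K.baryGrad p)]
  have hcl : Metric.closedBall c r ⊆ K.carrier := by
    rw [← closure_ball c hr.ne', ← K.isClosed_carrier.closure_eq]
    exact closure_mono h
  rcases eq_or_ne (K.baryGrad p) 0 with h0 | h0
  · simp [h0]
  have hn : 0 < ‖K.baryGrad p‖ := norm_pos_iff.2 h0
  have hc : c ∈ K.carrier := hcl (Metric.mem_closedBall_self hr.le)
  have hy : c + (r / ‖K.baryGrad p‖) • K.baryGrad p ∈ K.carrier := by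
    apply hcl
    rw [Metric.mem_closedBall, dist_eq_norm, add_sub_cancel_left, norm_smul, Real.norm_eq_abs,
      abs_of_pos (by positivity), div_mul_cancel₀ _ hn.ne']
  have h1 := K.inner_baryGrad p c (c + (r / ‖K.baryGrad p‖) • K.baryGrad p)
  rw [add_sub_cancel_left, inner_smul_right, real_inner_self_eq_norm_sq] at h1
  have h2 : r / ‖K.baryGrad p‖ * ‖K.baryGrad p‖ ^ 2 = r * ‖K.baryGrad p‖ := by
    field_simp
  rw [← h2, h1]
  linarith [K.bary_nonneg hc p, K.bary_le_one hy p]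

theorem inradius_mul_baryGrad_le (p : E3) : K.inradius * ‖K.baryGrad p‖ ≤ 1 := by
  rcases eq_or_ne (K.baryGrad p) 0 with h0 | h0
  · simp [h0]
  have hn : 0 < ‖K.baryGrad p‖ := norm_pos_iff.2 h0
  rw [← le_div_iff₀ hn]
  rw [inradius]
  -- The radius 0 is admissible because the open ball is then empty, so the supremum is over a
  -- nonempty set.
  refine csSup_le ⟨0, 0, by simp⟩ ?_
  rintro r ⟨c, hc⟩
  rw [le_div_iff₀ hn]
  exact K.ball_mul_baryGrad_le hc p

theorem inradius_pos : 0 < K.inradius := by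
  obtain ⟨p, hp, -⟩ := K.exists_ne_vertex ∅ (by simp)
  obtain ⟨c, hc⟩ := K.nonempty_interior
  obtain ⟨r, hr, hb⟩ := Metric.isOpen_iff.1 isOpen_interior c hc
  have hn : 0 < ‖K.baryGrad p‖ := by
    have := K.baryGrad_lower hp
    by_contra! h
    nlinarith [K.diam_pos]
  have hbdd : BddAbove {r : ℝ | ∃ c : E3, Metric.ball c r ⊆ K.carrier} := by
    refine ⟨1 / ‖K.baryGrad p‖, ?_⟩
    rintro r ⟨c, hc⟩
    rw [le_div_iff₀ hn]
    exact K.ball_mul_baryGrad_le hc p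
  exact lt_of_lt_of_le hr (le_csSup hbdd ⟨c, hb.trans interior_subset⟩)

theorem shapeRegularity_pos : 0 < K.shapeRegularity := div_pos K.diam_pos K.inradius_pos

theorem diam_mul_baryGrad_le (p : E3) : K.diam * ‖K.baryGrad p‖ ≤ K.shapeRegularity := by
  have h := K.inradius_mul_baryGrad_le p
  have hr := K.inradius_pos
  rw [shapeRegularity, le_div_iff₀ hr]
  calc K.diam * ‖K.baryGrad p‖ * K.inradius = K.diam * (K.inradius * ‖K.baryGrad p‖) := by ring
    _ ≤ K.diam * 1 := mul_le_mul_of_nonneg_left h K.diam_pos.le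
    _ = K.diam := mul_one _

/-- Shrinking towards p by 1 - s multiplies the other coordinates by 1 - s and sends λ_p to (1 -
s)λ_p + s. The volume of the superlevel set is then read off from the scaling of Lebesgue measure.
-/
theorem bary_ge_eq_image {p : E3} (hp : p ∈ K.vertices) {s : ℝ} (hs : s < 1) (hs0 : 0 ≤ s) :
    {x ∈ K.carrier | s ≤ K.bary p x} = AffineMap.homothety p (1 - s) '' K.carrier := by
  have key : ∀ q ∈ K.vertices, ∀ y, K.bary q (AffineMap.homothety p (1 - s) y)
      = (1 - s) * K.bary q y + s * K.bary q p := by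
    intro q hq y
    have : AffineMap.homothety p (1 - s) y = (1 - s) • y + s • p := by
      rw [AffineMap.homothety_apply, vsub_eq_sub, vadd_eq_add]; module
    rw [this]
    exact K.bary_combo q y p (by ring)
  ext x
  constructor
  · rintro ⟨hx, hsx⟩
    have h1 : (0 : ℝ) < 1 - s := by linarith
    refine ⟨AffineMap.homothety p (1 - s)⁻¹ x, ?_, ?_⟩
    · rw [mem_carrier_iff] at hx ⊢
      intro q hq
      have h2 := key q hq (AffineMap.homothety p (1 - s)⁻¹ x)
      rw [← AffineMap.comp_apply, ← AffineMap.homothety_mul, mul_inv_cancel₀ h1.ne',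
        AffineMap.homothety_one, AffineMap.id_apply] at h2
      have h3 := hx q hq
      by_contra! hneg
      rcases eq_or_ne q p with rfl | hne
      · rw [K.bary_self hp] at h2
        nlinarith
      · rw [K.bary_ne hp hne] at h2
        nlinarith
    · rw [← AffineMap.comp_apply, ← AffineMap.homothety_mul, mul_inv_cancel₀ h1.ne',
        AffineMap.homothety_one, AffineMap.id_apply]
  · rintro ⟨y, hy, rfl⟩
    refine ⟨?_, ?_⟩
    · rw [mem_carrier_iff]
      intro q hq
      rw [key q hq]
      have := K.bary_nonneg hy q
      have := K.bary_nonneg (K.vertex_mem hp) q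
      have : 0 ≤ 1 - s := by linarith
      positivity
    · rw [key p hp, K.bary_self hp]
      have := K.bary_nonneg hy p
      nlinarith

theorem volume_carrier_lt_top : volume K.carrier < ⊤ := K.isCompact_carrier.measure_lt_top

theorem volume_real_carrier_pos : 0 < volume.real K.carrier := by
  rw [measureReal_def, ENNReal.toReal_pos_iff]
  refine ⟨lt_of_lt_of_le ?_ (measure_mono interior_subset), K.volume_carrier_lt_top⟩
  exact isOpen_interior.measure_pos volume K.nonempty_interior

theorem volume_real_bary_ge {p : E3} (hp : p ∈ K.vertices) {s : ℝ} (hs : s < 1) (hs0 : 0 ≤ s) :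
    volume.real {x ∈ K.carrier | s ≤ K.bary p x} = (1 - s) ^ 3 * volume.real K.carrier := by
  rw [K.bary_ge_eq_image hp hs hs0, measureReal_def, Measure.addHaar_image_homothety]
  have : (0 : ℝ) ≤ 1 - s := by linarith
  rw [ENNReal.toReal_mul, ENNReal.toReal_ofReal (abs_nonneg _), abs_of_nonneg (by positivity)]
  simp [measureReal_def]

theorem measurableSet_carrier : MeasurableSet K.carrier := K.isClosed_carrier.measurableSet

theorem volume_real_bary_lt {p : E3} (hp : p ∈ K.vertices) {s : ℝ} (hs0 : 0 ≤ s) :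
    volume.real {x ∈ K.carrier | K.bary p x < s} ≤ 3 * s * volume.real K.carrier := by
  have hV := K.volume_real_carrier_pos
  have hfin : volume K.carrier ≠ ⊤ := K.volume_carrier_lt_top.ne
  rcases lt_or_ge s 1 with hs | hs
  · have h1 := K.volume_real_bary_ge hp hs hs0
    have hm : MeasurableSet {x ∈ K.carrier | s ≤ K.bary p x} :=
      K.measurableSet_carrier.inter ((K.continuous_bary p).measurable measurableSet_Ici)
    have h2 : {x ∈ K.carrier | K.bary p x < s} = K.carrier \ {x ∈ K.carrier | s ≤ K.bary p x} := by
      ext x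
      simp only [Set.mem_sdiff, Set.mem_ofPred_eq, not_and, not_le]
      tauto
    rw [h2, measureReal_sdiff (Set.sep_subset _ _) hm, h1]
    -- This is 1 - (1 - s)³ ≤ 3s, that is, s²(3 - s) ≥ 0.
    nlinarith [mul_nonneg (mul_nonneg hs0 hs0) hV.le,
      mul_nonneg (mul_nonneg (mul_nonneg hs0 hs0) (by linarith : 0 ≤ 3 - s)) hV.le]
  · calc volume.real {x ∈ K.carrier | K.bary p x < s} ≤ volume.real K.carrier :=
          measureReal_mono (Set.sep_subset _ _) hfin
      _ ≤ 3 * s * volume.real K.carrier := by nlinarith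

/-- The part of the tetrahedron close to its boundary. -/
def strip (s : ℝ) : Set E3 := {x ∈ K.carrier | ∃ p ∈ K.vertices, K.bary p x < s}

theorem strip_eq (s : ℝ) : K.strip s = ⋃ p ∈ K.vertices, {x ∈ K.carrier | K.bary p x < s} := by
  ext x
  simp only [strip, Set.mem_ofPred_eq, Set.mem_iUnion]
  tauto

theorem measurableSet_strip (s : ℝ) : MeasurableSet (K.strip s) := by
  rw [strip_eq]
  exact Finset.measurableSet_biUnion _ fun p _ =>
    K.measurableSet_carrier.inter ((K.continuous_bary p).measurable measurableSet_Iio)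

theorem volume_real_strip {s : ℝ} (hs0 : 0 ≤ s) :
    volume.real (K.strip s) ≤ 12 * s * volume.real K.carrier := by
  rw [strip_eq]
  refine (measureReal_biUnion_finset_le _ _).trans ?_
  refine (Finset.sum_le_sum fun p hp => K.volume_real_bary_lt hp hs0).trans ?_
  rw [Finset.sum_const, K.card_vertices]
  simp only [nsmul_eq_mul]
  push_cast
  linarith

end Tetrahedron

/-! ### Elements of nested meshes -/

namespace Tetrahedron

theorem inter_interior_nonempty {K : Tetrahedron} {U : Set E3} (hU : IsOpen U)
    {x : E3} (hxU : x ∈ U) (hx : x ∈ K.carrier) : (U ∩ interior K.carrier).Nonempty := by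
  rw [← K.closure_interior] at hx
  exact mem_closure_iff.1 hx U hU hxU

end Tetrahedron

namespace IsMesh

variable {Ω : Set E3} {M : Set Tetrahedron}

theorem eq_of_mem_interior (h : IsMesh Ω M) {K K' : Tetrahedron} (hK : K ∈ M) (hK' : K' ∈ M)
    {x : E3} (hx : x ∈ interior K.carrier) (hx' : x ∈ K'.carrier) : K = K' := by
  by_contra hne
  obtain ⟨y, hy, hy'⟩ := Tetrahedron.inter_interior_nonempty isOpen_interior hx hx'
  exact Set.disjoint_left.1 (h.disjoint K hK K' hK' hne) hy hy'

theorem eq_of_carrier_subset (h : IsMesh Ω M) {K K' T : Tetrahedron} (hK : K ∈ M) (hK' : K' ∈ M)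
    (h1 : T.carrier ⊆ K.carrier) (h2 : T.carrier ⊆ K'.carrier) : K = K' := by
  obtain ⟨x, hx⟩ := T.nonempty_interior
  exact h.eq_of_mem_interior hK hK' (interior_mono h1 hx) (h2 (interior_subset hx))

theorem interior_subset_domain (h : IsMesh Ω M) (hreg : interior (closure Ω) = Ω)
    {K : Tetrahedron} (hK : K ∈ M) : interior K.carrier ⊆ Ω := by
  rw [← hreg, ← h.cover]
  exact interior_mono (Set.subset_biUnion_of_mem hK)

theorem exists_mem (h : IsMesh Ω M) {x : E3} (hx : x ∈ closure Ω) : ∃ K ∈ M, x ∈ K.carrier := by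
  rw [← h.cover] at hx
  simpa using hx

end IsMesh

theorem Nested.exists_of_mem {M T : Set Tetrahedron} (h : Nested M T) {K : Tetrahedron}
    (hK : K ∈ M) {x : E3} (hx : x ∈ K.carrier) :
    ∃ K' ∈ T, K'.carrier ⊆ K.carrier ∧ x ∈ K'.carrier := by
  obtain ⟨S, hS, hKS⟩ := h K hK
  rw [hKS] at hx
  obtain ⟨K', hK', hxK'⟩ := Set.mem_iUnion₂.1 hx
  refine ⟨K', hS hK', ?_, hxK'⟩
  rw [hKS]
  exact Set.subset_biUnion_of_mem hK'

theorem Nested.trans {M T R : Set Tetrahedron} (h : Nested M T) (h' : Nested T R) :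
    Nested M R := by
  intro K hK
  refine ⟨{K' ∈ R | K'.carrier ⊆ K.carrier}, fun _ h => h.1, ?_⟩
  apply Set.Subset.antisymm
  · intro x hx
    obtain ⟨K', hK', hsub, hx'⟩ := h.exists_of_mem hK hx
    obtain ⟨K'', hK'', hsub', hx''⟩ := h'.exists_of_mem hK' hx'
    exact Set.mem_biUnion (show K'' ∈ {K' ∈ R | K'.carrier ⊆ K.carrier} from
      ⟨hK'', hsub'.trans hsub⟩) hx''
  · exact Set.iUnion₂_subset fun K' hK' => hK'.2

theorem Nested.refl (M : Set Tetrahedron) : Nested M M :=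
  fun K hK => ⟨{K}, by simpa using hK, by simp⟩

/-- An element of the coarsest and of the finest of three nested meshes belongs to the
intermediate one. -/
theorem mem_of_nested {Ω : Set E3} {M₁ M₂ M₃ : Set Tetrahedron} (h₃ : IsMesh Ω M₃)
    (h₁₂ : Nested M₁ M₂) (h₂₃ : Nested M₂ M₃) {K : Tetrahedron} (hK₁ : K ∈ M₁) (hK₃ : K ∈ M₃) :
    K ∈ M₂ := by
  obtain ⟨x, hx⟩ := K.nonempty_interior
  obtain ⟨T, hT, hTK, hxT⟩ := h₁₂.exists_of_mem hK₁ (interior_subset hx)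
  obtain ⟨R, hR, hRT, hxR⟩ := h₂₃.exists_of_mem hT hxT
  have hRK : K = R := h₃.eq_of_mem_interior hK₃ hR hx hxR
  subst hRK
  rwa [Tetrahedron.eq_of_carrier_eq (hRT.antisymm hTK)]

/-! ### Levels and the refinement zone -/

theorem HasLevel.exists_ancestor {M : ℕ → Set Tetrahedron} {L : ℕ} {K : Tetrahedron} {n l : ℕ}
    (h : HasLevel M L K n) (hl : l ≤ n) :
    ∃ A, HasLevel M L A l ∧ K.carrier ⊆ A.carrier := by
  induction h with
  | initial K hK =>
    obtain rfl : l = 0 := by omega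
    exact ⟨K, .initial K hK, subset_rfl⟩
  | child k n K K' hk hK hn hK' hnew hsub ih =>
    rcases Nat.lt_or_ge n l with hnl | hnl
    · obtain rfl : l = n + 1 := by omega
      exact ⟨K', .child k n K K' hk hK hn hK' hnew hsub, subset_rfl⟩
    · obtain ⟨A, hA, hKA⟩ := ih hnl
      exact ⟨A, hA, hsub.trans hKA⟩

namespace IsRefinementHierarchy

variable {Ω Γ : Set E3} {L : ℕ} {θ κ : ℝ} {M Mhat : ℕ → Set Tetrahedron}

theorem nested_of_le (H : IsRefinementHierarchy Ω Γ L θ κ M Mhat) {a b : ℕ} (hab : a ≤ b)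
    (hb : b ≤ L) : Nested (M a) (M b) := by
  induction b, hab using Nat.le_induction with
  | base => exact Nested.refl _
  | succ b hab ih => exact (ih (by omega)).trans (H.nested b (by omega))

theorem mem_of_mem_of_mem (H : IsRefinementHierarchy Ω Γ L θ κ M Mhat) {a b c : ℕ} (hab : a ≤ b)
    (hbc : b ≤ c) (hc : c ≤ L) {K : Tetrahedron} (ha : K ∈ M a) (hKc : K ∈ M c) : K ∈ M b :=
  mem_of_nested (H.mesh c hc) (H.nested_of_le hab (hbc.trans hc)) (H.nested_of_le hbc hc) ha hKc

theorem level_le (H : IsRefinementHierarchy Ω Γ L θ κ M Mhat) {K : Tetrahedron} {n : ℕ}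
    (h : HasLevel M L K n) : ∀ k ≤ L, K ∈ M k → n ≤ k := by
  induction h with
  | initial K hK => exact fun k _ _ => Nat.zero_le k
  | child l n K K' hl hK hn hK' hnew hsub ih =>
    intro k hk hKk
    have h1 := ih l hl.le hK
    by_contra! hlt
    -- An element lying in `M k` and in `M (l + 1)` with `k ≤ l` would survive in `M l` too,
    -- contradicting that it is new in `M (l + 1)`.
    exact hnew (H.mem_of_mem_of_mem (by omega : k ≤ l) (Nat.le_succ l) hl hKk hK')

/-- Only elements of level l are subdivided in passing to `M (l + 1)`. The parent is determined by
containment, and `level_le`, used in both directions, identifies its level with the index of the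
mesh in which it is subdivided. -/
theorem mem_of_hasLevel (H : IsRefinementHierarchy Ω Γ L θ κ M Mhat) {K : Tetrahedron} {n : ℕ}
    (h : HasLevel M L K n) : n ≤ L ∧ K ∈ M n := by
  induction h with
  | initial K hK => exact ⟨Nat.zero_le L, hK⟩
  | child l n K K' hl hK hn hK' hnew hsub ih =>
    obtain ⟨P, hP, hPl, hPsub⟩ := H.refine l hl K' hK' hnew
    have hKP : K = P := (H.mesh l hl.le).eq_of_carrier_subset hK hP hsub hPsub
    subst hKP
    have h1 := H.level_le hPl n ih.1 ih.2
    have h2 := H.level_le hn l hl.le hK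
    obtain rfl : n = l := le_antisymm h2 h1
    exact ⟨hl, hK'⟩

/-- An element inside T is either kept from the previous mesh, where induction applies, or new in `M
(k + 1)` and therefore of level k + 1. -/
theorem exists_level_ge (H : IsRefinementHierarchy Ω Γ L θ κ M Mhat) {T : Tetrahedron} {l : ℕ}
    (hT : T ∈ M l) (hTl : HasLevel M L T l) {k : ℕ} (hlk : l ≤ k) (hk : k ≤ L) :
    ∀ K ∈ M k, K.carrier ⊆ T.carrier → ∃ n ≥ l, HasLevel M L K n := by
  induction k, hlk using Nat.le_induction with
  | base =>
    intro K hK hKT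
    have : K = T := (H.mesh l hk).eq_of_carrier_subset hK hT subset_rfl hKT
    exact ⟨l, le_rfl, this ▸ hTl⟩
  | succ k hlk ih =>
    intro K hK hKT
    by_cases hold : K ∈ M k
    · exact ih (by omega) K hold hKT
    · obtain ⟨P, hP, hPk, hKP⟩ := H.refine k (by omega) K hK hold
      exact ⟨k + 1, by omega, .child k k P K (by omega) hP hPk hK hold hKP⟩

/-- The elements of the conforming mesh that meet the refinement zone belong to the
hierarchy and lie in the zone. -/
theorem mem_of_inter_zone (H : IsRefinementHierarchy Ω Γ L θ κ M Mhat) {l : ℕ} (hl : l ≤ L)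
    {T : Tetrahedron} (hT : T ∈ Mhat l)
    (hne : (interior T.carrier ∩ refinementZone M L l).Nonempty) :
    T ∈ M l ∧ interior T.carrier ⊆ refinementZone M L l := by
  obtain ⟨x, hxT, hxz⟩ := hne
  obtain ⟨K, ⟨hK, n, hn, hKn⟩, hxK⟩ := Set.mem_iUnion₂.1 (interior_subset hxz)
  obtain ⟨A, hA, hKA⟩ := hKn.exists_ancestor hn
  have hAM := (H.mem_of_hasLevel hA).2
  -- The ancestor A of level l belongs to the conforming mesh. It shares with T a point interior to
  -- T, so the two coincide.
  have hAh := H.level_subset_hat l hl A hAM hA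
  obtain rfl : T = A := (H.hat_mesh l hl).eq_of_mem_interior hT hAh hxT (hKA hxK)
  refine ⟨hAM, interior_mono fun y hy => ?_⟩
  obtain ⟨K', hK', hsub, hy'⟩ := (H.nested_of_le hl le_rfl).exists_of_mem hAM hy
  exact Set.mem_iUnion₂.2 ⟨K', ⟨hK', H.exists_level_ge hAM hA hl le_rfl K' hK' hsub⟩, hy'⟩

theorem mem_of_interior_subset_closure (H : IsRefinementHierarchy Ω Γ L θ κ M Mhat) {l : ℕ}
    (hl : l ≤ L) {T : Tetrahedron} (hT : T ∈ Mhat l)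
    (hsub : interior T.carrier ⊆ closure (refinementZone M L l)) :
    T ∈ M l ∧ interior T.carrier ⊆ refinementZone M L l := by
  apply H.mem_of_inter_zone hl hT
  obtain ⟨x, hx⟩ := T.nonempty_interior
  exact mem_closure_iff.1 (hsub hx) _ isOpen_interior hx

end IsRefinementHierarchy

/-! ### Nodal functions on the elements -/

/-- Both coordinates are affine and agree at the common vertices. This makes a tent function on a
conforming mesh independent of the element chosen at a shared point. -/
theorem Tetrahedron.bary_eq_of_mem_convexHull_inter (K K' : Tetrahedron) {x : E3}
    (hx : x ∈ convexHull ℝ ((K.vertices : Set E3) ∩ (K'.vertices : Set E3))) (p : E3) :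
    K.bary p x = K'.bary p x := by
  have hconv : Convex ℝ {x | K.bary p x = K'.bary p x} := by
    intro y hy z hz a b _ _ hab
    simp only [Set.mem_ofPred_eq] at hy hz ⊢
    rw [K.bary_combo p y z hab, K'.bary_combo p y z hab, hy, hz]
  refine convexHull_min ?_ hconv hx
  rintro q ⟨hq, hq'⟩
  simp only [Set.mem_ofPred_eq]
  rcases eq_or_ne p q with rfl | hne
  · rw [K.bary_self hq, K'.bary_self hq']
  · rw [K.bary_ne hq hne, K'.bary_ne hq' hne]

variable {Ω : Set E3} {T : Set Tetrahedron}

theorem tent_eq (hc : Conforming T) {K : Tetrahedron} (hK : K ∈ T) {x : E3} (hx : x ∈ K.carrier)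
    (p : E3) : tent T p x = K.bary p x := by
  have h : ∃ K ∈ T, x ∈ K.carrier := ⟨K, hK, hx⟩
  rw [tent, dif_pos h]
  exact h.choose.bary_eq_of_mem_convexHull_inter K
    (hc _ h.choose_spec.1 K hK ⟨h.choose_spec.2, hx⟩) p

theorem edgeBasis_eq (hm : IsMesh Ω T) {K : Tetrahedron} (hK : K ∈ T) {x : E3}
    (hx : x ∈ interior K.carrier) (p q : E3) :
    edgeBasis T p q x = K.bary p x • K.baryGrad q - K.bary q x • K.baryGrad p := by
  have h : ∃ K ∈ T, x ∈ K.carrier := ⟨K, hK, interior_subset hx⟩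
  have hch : h.choose = K :=
    (hm.eq_of_mem_interior hK h.choose_spec.1 hx h.choose_spec.2).symm
  rw [edgeBasis, dif_pos h, hch, K.gradient_bary, K.gradient_bary]

/-- Along s - p the coordinate of q is constant and that of p falls by 1. Testing in this direction
isolates λ_q, which bounds the edge field from below. -/
theorem Tetrahedron.edge_field_inner (K : Tetrahedron) {p q s : E3} (hp : p ∈ K.vertices)
    (hs : s ∈ K.vertices) (hpq : p ≠ q) (hps : p ≠ s) (hqs : q ≠ s) (x : E3) :
    inner ℝ (K.bary p x • K.baryGrad q - K.bary q x • K.baryGrad p) (s - p) = K.bary q x := by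
  rw [inner_sub_left, real_inner_smul_left, real_inner_smul_left, K.inner_baryGrad,
    K.inner_baryGrad, K.bary_ne hs hqs, K.bary_ne hp hpq.symm, K.bary_ne hs hps, K.bary_self hp]
  ring

theorem interior_subset_tsupport_tent (hc : Conforming T) {K : Tetrahedron} (hK : K ∈ T) {p : E3}
    (hp : p ∈ K.vertices) : interior K.carrier ⊆ tsupport (tent T p) := by
  intro x hx
  apply subset_tsupport
  rw [Function.mem_support, tent_eq hc hK (interior_subset hx)]
  exact (K.mem_interior_iff.1 hx p hp).ne'

/-- An edge field has no zero inside an element containing the edge. So the condition that its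
support lies in the closed zone forces all those elements into the zone. -/
theorem interior_subset_tsupport_edgeBasis (hm : IsMesh Ω T) {K : Tetrahedron} (hK : K ∈ T)
    {p q : E3} (hp : p ∈ K.vertices) (hq : q ∈ K.vertices) (hpq : p ≠ q) :
    interior K.carrier ⊆ tsupport (edgeBasis T p q) := by
  intro x hx
  apply subset_tsupport
  rw [Function.mem_support, edgeBasis_eq hm hK hx]
  intro h0
  classical
  obtain ⟨s, hs, hs'⟩ := K.exists_ne_vertex {p, q} (by rw [Finset.card_pair hpq]; norm_num)
  simp only [Finset.mem_insert, Finset.mem_singleton, not_or] at hs'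
  have := K.edge_field_inner hp hs hpq (Ne.symm hs'.1) (Ne.symm hs'.2) x
  rw [h0, inner_zero_left] at this
  exact (K.mem_interior_iff.1 hx q hq).ne this

/-! ### Lipschitz functions with compact support -/

section Lipschitz

open Filter Topology
open scoped ENNReal NNReal

/-- A function that is Lipschitz on each member of a finite closed cover is Lipschitz. -/
theorem lipschitzWith_of_finite_closed_cover {E : Type*} [NormedAddCommGroup E] [NormedSpace ℝ E]
    {ι : Type*} [Finite ι] {s : ι → Set E} (hcl : ∀ i, IsClosed (s i))
    (hcov : ⋃ i, s i = Set.univ) {f : E → ℝ} {C : ℝ≥0} (hf : ∀ i, LipschitzOnWith C f (s i)) :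
    LipschitzWith C f := by
  have hcont : Continuous f :=
    (locallyFinite_of_finite s).continuous hcov hcl fun i => (hf i).continuousOn
  have key : ∀ x y : E, f y ≤ f x + C * ‖y - x‖ := by
    intro x y
    let γ : ℝ → E := fun t => x + t • (y - x)
    have hγ : Continuous γ := by fun_prop
    -- Along the segment from x to y it suffices to bound the lower right slope of f at every time.
    have main := image_le_of_liminf_slope_right_le_deriv_boundary (f := f ∘ γ) (a := 0) (b := 1)
      (B := fun t => f x + C * ‖y - x‖ * t) (B' := fun _ => C * ‖y - x‖)
      (hcont.comp hγ).continuousOn (by simp [γ]) (by fun_prop)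
      (fun t _ => by
        simpa using (((hasDerivAt_id t).const_mul (C * ‖y - x‖)).const_add (f x)).hasDerivWithinAt)
      ?_ (Set.right_mem_Icc.2 zero_le_one)
    · simpa [γ] using main
    · intro t _ r hr
      -- As there are finitely many pieces, one of them is visited at times arbitrarily close to t
      -- from the right. Being closed it contains γ t as well, so its Lipschitz bound controls these
      -- slopes.
      obtain ⟨i, hi⟩ : ∃ i, ∃ᶠ z in 𝓝[>] t, γ z ∈ s i := by
        by_contra! h
        obtain ⟨z, hz⟩ := (eventually_all.2 h).exists
        have : γ z ∈ ⋃ i, s i := hcov ▸ Set.mem_univ _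
        obtain ⟨i, hi⟩ := Set.mem_iUnion.1 this
        exact hz i hi
      have hti : γ t ∈ s i := by
        by_contra hnot
        have h1 : ∀ᶠ z in 𝓝[>] t, γ z ∈ (s i)ᶜ :=
          (hγ.tendsto t).mono_left nhdsWithin_le_nhds |>.eventually
            ((hcl i).isOpen_compl.mem_nhds hnot)
        exact hi h1
      refine (hi.and_eventually self_mem_nhdsWithin).mono ?_
      rintro z ⟨hz, htz⟩
      have htz' : 0 < z - t := sub_pos.2 htz
      have h1 := (hf i).dist_le_mul _ hz _ hti
      have h2 : dist (γ z) (γ t) = (z - t) * ‖y - x‖ := by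
        simp only [γ, dist_eq_norm]
        rw [show x + z • (y - x) - (x + t • (y - x)) = (z - t) • (y - x) by module, norm_smul,
          Real.norm_eq_abs, abs_of_pos htz']
      rw [h2, Real.dist_eq] at h1
      rw [slope_def_field, div_lt_iff₀ htz']
      have h3 := le_abs_self (f (γ z) - f (γ t))
      have h4 : (C : ℝ) * ((z - t) * ‖y - x‖) = (C * ‖y - x‖) * (z - t) := by ring
      calc (f ∘ γ) z - (f ∘ γ) t ≤ (C * ‖y - x‖) * (z - t) := by
            simp only [Function.comp]; linarith
        _ < r * (z - t) := mul_lt_mul_of_pos_right hr htz'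
  refine LipschitzWith.of_dist_le_mul fun x y => ?_
  rw [Real.dist_eq, dist_eq_norm, abs_le]
  have h1 := key x y
  have h2 := key y x
  rw [norm_sub_rev] at h1
  constructor <;> linarith

theorem LipschitzOnWith.mul_of_bound {E : Type*} [PseudoMetricSpace E] {f g : E → ℝ} {s : Set E}
    {C D : ℝ≥0} {A B : ℝ≥0} (hf : LipschitzOnWith C f s) (hg : LipschitzOnWith D g s)
    (hA : ∀ x ∈ s, |f x| ≤ A) (hB : ∀ x ∈ s, |g x| ≤ B) :
    LipschitzOnWith (A * D + B * C) (fun x => f x * g x) s := by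
  refine LipschitzOnWith.of_dist_le_mul fun x hx y hy => ?_
  have h1 := hf.dist_le_mul x hx y hy
  have h2 := hg.dist_le_mul x hx y hy
  rw [Real.dist_eq] at *
  have h3 : f x * g x - f y * g y = f x * (g x - g y) + g y * (f x - f y) := by ring
  rw [h3]
  refine (abs_add_le _ _).trans ?_
  rw [abs_mul, abs_mul]
  push_cast
  have h4 := mul_le_mul (hA x hx) h2 (abs_nonneg _) A.2
  have h5 := mul_le_mul (hB y hy) h1 (abs_nonneg _) B.2
  calc _ ≤ (A : ℝ) * (D * dist x y) + B * (C * dist x y) := add_le_add h4 h5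
    _ = _ := by ring

/-- Lipschitz functions with compact support. -/
structure IsCompactLipschitz (f : E3 → ℝ) : Prop where
  lipschitz : ∃ C, LipschitzWith C f
  hasCompactSupport : HasCompactSupport f

namespace IsCompactLipschitz

variable {f g h : E3 → ℝ}

theorem continuous (hf : IsCompactLipschitz f) : Continuous f :=
  hf.lipschitz.choose_spec.continuous

theorem integrable (hf : IsCompactLipschitz f) : Integrable f :=
  hf.continuous.integrable_of_hasCompactSupport hf.hasCompactSupport

theorem exists_bound (hf : IsCompactLipschitz f) : ∃ A : ℝ≥0, ∀ x, |f x| ≤ A := by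
  obtain ⟨A, hA⟩ := hf.hasCompactSupport.exists_bound_of_continuous hf.continuous
  exact ⟨A.toNNReal, fun x => (hA x).trans (Real.le_coe_toNNReal A)⟩

theorem memLp_top (hf : IsCompactLipschitz f) : MemLp f ∞ := by
  obtain ⟨A, hA⟩ := hf.exists_bound
  exact memLp_top_of_bound hf.continuous.aestronglyMeasurable A (.of_forall hA)

theorem memLp_lineDeriv (hf : IsCompactLipschitz f) (v : E3) :
    MemLp (fun x => lineDeriv ℝ f x v) ∞ :=
  hf.lipschitz.choose_spec.memLp_lineDeriv v

theorem lineDeriv_eq_zero {x : E3} (hx : x ∉ tsupport f) (v : E3) : lineDeriv ℝ f x v = 0 := by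
  have h0 : f =ᶠ[𝓝 x] fun _ => 0 := notMem_tsupport_iff_eventuallyEq.1 hx
  rw [h0.lineDeriv_eq]
  simp [lineDeriv]

theorem integrable_lineDeriv (hf : IsCompactLipschitz f) (v : E3) :
    Integrable (fun x => lineDeriv ℝ f x v) := by
  obtain ⟨C, hC⟩ := hf.lipschitz
  rw [← integrableOn_iff_integrable_of_support_subset (s := tsupport f)]
  · exact (hC.locallyIntegrable_lineDeriv v).integrableOn_isCompact hf.hasCompactSupport
  · intro x hx
    by_contra hnot
    exact hx (lineDeriv_eq_zero hnot v)

theorem lineDifferentiable (hf : IsCompactLipschitz f) (v : E3) :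
    ∀ᵐ x, LineDifferentiableAt ℝ f x v :=
  hf.lipschitz.choose_spec.ae_lineDifferentiableAt v

theorem mul (hf : IsCompactLipschitz f) (hg : IsCompactLipschitz g) :
    IsCompactLipschitz fun x => f x * g x := by
  obtain ⟨C, hC⟩ := hf.lipschitz
  obtain ⟨D, hD⟩ := hg.lipschitz
  obtain ⟨A, hA⟩ := hf.exists_bound
  obtain ⟨B, hB⟩ := hg.exists_bound
  refine ⟨⟨A * D + B * C, ?_⟩, hf.hasCompactSupport.mul_right⟩
  rw [← lipschitzOnWith_univ] at *
  exact LipschitzOnWith.mul_of_bound hC hD (fun x _ => hA x) fun x _ => hB x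

theorem of_contDiff (hf : ContDiff ℝ ∞ f) (hs : HasCompactSupport f) : IsCompactLipschitz f :=
  ⟨ContDiff.lipschitzWith_of_hasCompactSupport hs hf (by simp), hs⟩

theorem integral_lineDeriv_mul (hf : IsCompactLipschitz f) (hg : IsCompactLipschitz g) (v : E3) :
    ∫ x, lineDeriv ℝ f x v * g x = - ∫ x, lineDeriv ℝ g x v * f x := by
  obtain ⟨C, hC⟩ := hf.lipschitz
  obtain ⟨D, hD⟩ := hg.lipschitz
  rw [hC.integral_lineDeriv_mul_eq hD hg.hasCompactSupport v, ← integral_neg]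
  simp only [lineDeriv_neg, neg_mul]

theorem translate (hf : IsCompactLipschitz f) (a : E3) : IsCompactLipschitz fun x => f (x + a) := by
  obtain ⟨C, hC⟩ := hf.lipschitz
  refine ⟨⟨C, ?_⟩, hf.hasCompactSupport.comp_homeomorph (Homeomorph.addRight a)⟩
  refine LipschitzWith.of_dist_le_mul fun x y => ?_
  simpa using hC.dist_le_mul (x + a) (y + a)

theorem lineDeriv_translate (f : E3 → ℝ) (a x v : E3) :
    lineDeriv ℝ (fun x => f (x + a)) x v = lineDeriv ℝ f (x + a) v := by
  simp only [lineDeriv]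
  congr 1
  ext t
  rw [add_right_comm]

/-- Mixed derivatives commute weakly although no second derivatives exist. Replace the derivative of
h along w by a difference quotient, integrate by parts along v, move the translation over to f, and
let the step tend to zero. -/
theorem integral_lineDeriv_mul_comm (hf : IsCompactLipschitz f) (hh : IsCompactLipschitz h)
    (v w : E3) :
    ∫ x, lineDeriv ℝ f x v * lineDeriv ℝ h x w = ∫ x, lineDeriv ℝ f x w * lineDeriv ℝ h x v := by
  obtain ⟨C, hC⟩ := hf.lipschitz
  obtain ⟨D, hD⟩ := hh.lipschitz
  have lim1 := hD.integral_inv_smul_sub_mul_tendsto_integral_lineDeriv_mul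
    (hf.integrable_lineDeriv v) w
  have lim2 := hC.integral_inv_smul_sub_mul_tendsto_integral_lineDeriv_mul
    (hh.integrable_lineDeriv v) (-w)
  have heq : ∀ t : ℝ, ∫ x, (t⁻¹ • (h (x + t • w) - h x)) * lineDeriv ℝ f x v
      = - ∫ x, (t⁻¹ • (f (x + t • (-w)) - f x)) * lineDeriv ℝ h x v := by
    intro t
    have i1 : Integrable fun x => lineDeriv ℝ f x v * h (x + t • w) :=
      (hf.integrable_lineDeriv v).mul_of_top_left (hh.translate (t • w)).memLp_top
    have i2 : Integrable fun x => lineDeriv ℝ f x v * h x :=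
      (hf.integrable_lineDeriv v).mul_of_top_left hh.memLp_top
    have i3 : Integrable fun x => lineDeriv ℝ h x v * f (x + t • (-w)) :=
      (hh.integrable_lineDeriv v).mul_of_top_left (hf.translate (t • (-w))).memLp_top
    have i4 : Integrable fun x => lineDeriv ℝ h x v * f x :=
      (hh.integrable_lineDeriv v).mul_of_top_left hf.memLp_top
    have e1 : ∫ x, (t⁻¹ • (h (x + t • w) - h x)) * lineDeriv ℝ f x v
        = t⁻¹ * ((∫ x, lineDeriv ℝ f x v * h (x + t • w)) - ∫ x, lineDeriv ℝ f x v * h x) := by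
      rw [← integral_sub i1 i2, ← integral_const_mul]
      congr 1
      ext x
      rw [smul_eq_mul]; ring
    have e2 : ∫ x, (t⁻¹ • (f (x + t • (-w)) - f x)) * lineDeriv ℝ h x v
        = t⁻¹ * ((∫ x, lineDeriv ℝ h x v * f (x + t • (-w)))
          - ∫ x, lineDeriv ℝ h x v * f x) := by
      rw [← integral_sub i3 i4, ← integral_const_mul]
      congr 1
      ext x
      rw [smul_eq_mul]; ring
    have e3 : ∫ x, lineDeriv ℝ f x v * h (x + t • w)
        = - ∫ x, lineDeriv ℝ h x v * f (x + t • (-w)) := by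
      rw [hf.integral_lineDeriv_mul (hh.translate (t • w)) v]
      simp only [lineDeriv_translate]
      rw [← integral_add_right_eq_self (fun x => lineDeriv ℝ h x v * f (x + t • (-w))) (t • w)]
      simp only [smul_neg, add_neg_cancel_right]
    rw [e1, e2, e3, hf.integral_lineDeriv_mul hh v]
    ring
  simp only [heq] at lim1
  have hlim := tendsto_nhds_unique lim1 lim2.neg
  have hcomm : ∀ a b : E3, (fun x => lineDeriv ℝ f x a * lineDeriv ℝ h x b)
      = fun x => lineDeriv ℝ h x b * lineDeriv ℝ f x a := fun a b => by ext x; ring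
  rw [hcomm, hlim, ← integral_neg]
  simp only [lineDeriv_neg, neg_mul, neg_neg]

theorem integrable_mul_mul (hf : MemLp f ∞) (hg : MemLp g ∞) (hh : Integrable h) :
    Integrable fun x => f x * g x * h x := by
  have : Integrable fun x => f x * (g x * h x) :=
    (hh.mul_of_top_right hg).mul_of_top_right hf
  simpa only [mul_assoc] using this

/-- One scalar component of the weak identity curl(f∇g) = ∇f × ∇g. It comes from commuting the
derivatives of g and fψ and expanding the product; the terms in which ψ is differentiated go to one
side. -/
theorem integral_mul_curl_aux {ψ : E3 → ℝ} (hf : IsCompactLipschitz f) (hg : IsCompactLipschitz g)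
    (hψ : IsCompactLipschitz ψ) (v w : E3) :
    ∫ x, f x * (lineDeriv ℝ g x v * lineDeriv ℝ ψ x w - lineDeriv ℝ g x w * lineDeriv ℝ ψ x v)
      = ∫ x, (lineDeriv ℝ f x v * lineDeriv ℝ g x w - lineDeriv ℝ f x w * lineDeriv ℝ g x v)
        * ψ x := by
  have hp := hf.mul hψ
  have hcomm := hg.integral_lineDeriv_mul_comm hp v w
  have prod : ∀ a : E3, ∀ᵐ x, lineDeriv ℝ (fun x => f x * ψ x) x a
      = lineDeriv ℝ f x a * ψ x + f x * lineDeriv ℝ ψ x a := by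
    intro a
    filter_upwards [hf.lineDifferentiable a, hψ.lineDifferentiable a] with x h1 h2
    have := HasDerivAt.mul h1.hasLineDerivAt h2.hasLineDerivAt
    simp only [zero_smul, add_zero] at this
    exact this.deriv
  have i : ∀ a b : E3, Integrable fun x =>
      f x * (lineDeriv ℝ g x a * lineDeriv ℝ ψ x b) := fun a b => by
    simpa only [mul_assoc] using integrable_mul_mul hf.memLp_top (hg.memLp_lineDeriv a)
      (hψ.integrable_lineDeriv b)
  have j : ∀ a b : E3, Integrable fun x =>
      lineDeriv ℝ g x a * lineDeriv ℝ f x b * ψ x := fun a b =>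
    integrable_mul_mul (hg.memLp_lineDeriv a) (hf.memLp_lineDeriv b) hψ.integrable
  have e : ∀ a b : E3, ∫ x, lineDeriv ℝ g x a * lineDeriv ℝ (fun x => f x * ψ x) x b
      = (∫ x, lineDeriv ℝ g x a * lineDeriv ℝ f x b * ψ x)
        + ∫ x, f x * (lineDeriv ℝ g x a * lineDeriv ℝ ψ x b) := by
    intro a b
    rw [← integral_add (j a b) (i a b)]
    apply integral_congr_ae
    filter_upwards [prod b] with x hx
    rw [hx]; ring
  rw [e, e] at hcomm
  have lhs : ∫ x, f x * (lineDeriv ℝ g x v * lineDeriv ℝ ψ x w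
      - lineDeriv ℝ g x w * lineDeriv ℝ ψ x v)
      = (∫ x, f x * (lineDeriv ℝ g x v * lineDeriv ℝ ψ x w))
        - ∫ x, f x * (lineDeriv ℝ g x w * lineDeriv ℝ ψ x v) := by
    rw [← integral_sub (i v w) (i w v)]
    congr 1; ext x; ring
  have rhs : ∫ x, (lineDeriv ℝ f x v * lineDeriv ℝ g x w - lineDeriv ℝ f x w * lineDeriv ℝ g x v)
        * ψ x = (∫ x, lineDeriv ℝ g x w * lineDeriv ℝ f x v * ψ x)
        - ∫ x, lineDeriv ℝ g x v * lineDeriv ℝ f x w * ψ x := by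
    rw [← integral_sub (j w v) (j v w)]
    congr 1; ext x; ring
  rw [lhs, rhs]
  linarith

theorem integrable_curl_aux {ψ : E3 → ℝ} (hf : IsCompactLipschitz f) (hg : IsCompactLipschitz g)
    (hψ : IsCompactLipschitz ψ) (v w : E3) :
    Integrable fun x =>
      f x * (lineDeriv ℝ g x v * lineDeriv ℝ ψ x w - lineDeriv ℝ g x w * lineDeriv ℝ ψ x v) := by
  have i : ∀ a b : E3, Integrable fun x =>
      f x * (lineDeriv ℝ g x a * lineDeriv ℝ ψ x b) := fun a b => by
    simpa only [mul_assoc] using integrable_mul_mul hf.memLp_top (hg.memLp_lineDeriv a)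
      (hψ.integrable_lineDeriv b)
  exact ((i v w).sub (i w v)).congr (.of_forall fun x => by simp only [Pi.sub_apply]; ring)

theorem integrable_cross_aux {ψ : E3 → ℝ} (hf : IsCompactLipschitz f) (hg : IsCompactLipschitz g)
    (hψ : IsCompactLipschitz ψ) (v w : E3) :
    Integrable fun x =>
      (lineDeriv ℝ f x v * lineDeriv ℝ g x w - lineDeriv ℝ f x w * lineDeriv ℝ g x v) * ψ x := by
  have j : ∀ a b : E3, Integrable fun x =>
      lineDeriv ℝ f x a * lineDeriv ℝ g x b * ψ x := fun a b =>
    integrable_mul_mul (hf.memLp_lineDeriv a) (hg.memLp_lineDeriv b) hψ.integrable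
  exact ((j v w).sub (j w v)).congr (.of_forall fun x => by simp only [Pi.sub_apply]; ring)

end IsCompactLipschitz

end Lipschitz

/-! ### Test fields -/

/-- The standard basis of the space. -/
noncomputable abbrev stdVec (i : Fin 3) : E3 := EuclideanSpace.single i 1

theorem inner_eq_sum (a b : E3) : inner ℝ a b = a 0 * b 0 + a 1 * b 1 + a 2 * b 2 := by
  rw [PiLp.inner_apply, Fin.sum_univ_three]
  simp [mul_comm]

theorem inner_stdVec (a : E3) (i : Fin 3) : inner ℝ a (stdVec i) = a i := by
  rw [EuclideanSpace.inner_single_right]; simp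

/-- The cross product. -/
noncomputable def cross (a b : E3) : E3 :=
  !₂[a 1 * b 2 - a 2 * b 1, a 2 * b 0 - a 0 * b 2, a 0 * b 1 - a 1 * b 0]

section TestFields

variable {φ : E3 → E3} {Ω : Set E3}

theorem fderiv_comp_apply (hφ : Differentiable ℝ φ) (x v : E3) (j : Fin 3) :
    fderiv ℝ (fun y => φ y j) x v = fderiv ℝ φ x v j := by
  have h := ((EuclideanSpace.proj (𝕜 := ℝ) j).hasFDerivAt (x := φ x)).comp x (hφ x).hasFDerivAt
  exact congrArg (fun L : E3 →L[ℝ] ℝ => L v) h.fderiv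

theorem lineDeriv_comp_apply (hφ : Differentiable ℝ φ) (x v : E3) (j : Fin 3) :
    lineDeriv ℝ (fun y => φ y j) x v = fderiv ℝ φ x v j := by
  rw [← fderiv_comp_apply hφ]
  have h := ((EuclideanSpace.proj (𝕜 := ℝ) j).hasFDerivAt (x := φ x)).comp x (hφ x).hasFDerivAt
  exact h.differentiableAt.lineDeriv_eq_fderiv

namespace IsTestField

theorem differentiable (h : IsTestField Ω φ) : Differentiable ℝ φ :=
  h.1.differentiable (by simp)

theorem continuous (h : IsTestField Ω φ) : Continuous φ := h.1.continuous

theorem isCompactLipschitz (h : IsTestField Ω φ) (j : Fin 3) :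
    IsCompactLipschitz fun x => φ x j := by
  refine .of_contDiff (contDiff_euclidean.1 h.1 j) ?_
  exact h.2.1.comp_left (g := fun y : E3 => y j) rfl

theorem eq_zero (h : IsTestField Ω φ) {x : E3} (hx : x ∉ Ω) : φ x = 0 :=
  image_eq_zero_of_notMem_tsupport fun hx' => hx (h.2.2 hx')

theorem fderiv_eq_zero {x : E3} (hx : x ∉ tsupport φ) : fderiv ℝ φ x = 0 :=
  image_eq_zero_of_notMem_tsupport fun hx' => hx (tsupport_fderiv_subset ℝ hx')

theorem curl_eq_zero {x : E3} (hx : x ∉ tsupport φ) : curl φ x = 0 := by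
  simp only [curl, fderiv_eq_zero hx]
  ext i
  fin_cases i <;> simp

theorem divergence_eq_zero {x : E3} (hx : x ∉ tsupport φ) : divergence φ x = 0 := by
  simp [divergence, fderiv_eq_zero hx]

theorem contDiff_fderiv_apply (h : IsTestField Ω φ) (v : E3) (j : Fin 3) :
    ContDiff ℝ ∞ fun x => fderiv ℝ φ x v j :=
  contDiff_euclidean.1 ((h.1.fderiv_right (m := ∞) (by simp)).clm_apply contDiff_const) j

theorem curl (h : IsTestField Ω φ) : IsTestField Ω (curl φ) := by
  have hsub : tsupport (LocalMG.curl φ) ⊆ tsupport φ :=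
    closure_minimal (fun x hx => by_contra fun hn => hx (curl_eq_zero hn)) (isClosed_tsupport φ)
  refine ⟨?_, h.2.1.of_isClosed_subset (isClosed_tsupport _) hsub, hsub.trans h.2.2⟩
  rw [contDiff_euclidean]
  intro i
  have hd := h.contDiff_fderiv_apply
  fin_cases i
  · exact (hd (stdVec 1) 2).sub (hd (stdVec 2) 1)
  · exact (hd (stdVec 2) 0).sub (hd (stdVec 0) 2)
  · exact (hd (stdVec 0) 1).sub (hd (stdVec 1) 0)

theorem divergence_curl (h : IsTestField Ω φ) (x : E3) :
    divergence (LocalMG.curl φ) x = 0 := by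
  have hsymm : ∀ v w : E3, ∀ j : Fin 3, fderiv ℝ (fun y => fderiv ℝ φ y w j) x v
      = fderiv ℝ (fderiv ℝ φ) x v w j := by
    intro v w j
    have hd : DifferentiableAt ℝ (fderiv ℝ φ) x :=
      ((h.1.fderiv_right (m := ∞) (by simp)).differentiable (by simp)) x
    have h1 : Differentiable ℝ fun y => fderiv ℝ φ y w :=
      ((h.1.fderiv_right (m := ∞) (by simp)).clm_apply contDiff_const).differentiable (by simp)
    rw [fderiv_comp_apply h1, fderiv_clm_apply hd (differentiableAt_const w)]
    simp
  have hs : IsSymmSndFDerivAt ℝ φ x := h.1.contDiffAt.isSymmSndFDerivAt (by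
    rw [minSmoothness_of_isRCLikeNormedField]
    exact WithTop.coe_le_coe.2 le_top)
  have hd := fun v j => (h.contDiff_fderiv_apply v j).differentiable (by simp) x
  have hc := h.curl.differentiable
  rw [divergence, Fin.sum_univ_three, ← fderiv_comp_apply hc, ← fderiv_comp_apply hc,
    ← fderiv_comp_apply hc]
  have e0 : (fun y => LocalMG.curl φ y 0)
      = fun y => fderiv ℝ φ y (stdVec 1) 2 - fderiv ℝ φ y (stdVec 2) 1 := rfl
  have e1 : (fun y => LocalMG.curl φ y 1)
      = fun y => fderiv ℝ φ y (stdVec 2) 0 - fderiv ℝ φ y (stdVec 0) 2 := rfl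
  have e2 : (fun y => LocalMG.curl φ y 2)
      = fun y => fderiv ℝ φ y (stdVec 0) 1 - fderiv ℝ φ y (stdVec 1) 0 := rfl
  rw [e0, e1, e2, fderiv_fun_sub (hd _ _) (hd _ _), fderiv_fun_sub (hd _ _) (hd _ _),
    fderiv_fun_sub (hd _ _) (hd _ _)]
  simp only [sub_apply, hsymm]
  rw [hs.eq (stdVec 0) (stdVec 1), hs.eq (stdVec 1) (stdVec 2), hs.eq (stdVec 2) (stdVec 0)]
  ring

theorem memLp (h : IsTestField Ω φ) (μ : Measure E3) [IsFiniteMeasureOnCompacts μ] :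
    MemLp φ 2 μ := h.continuous.memLp_of_hasCompactSupport h.2.1

end IsTestField

end TestFields

theorem integrable_inner_of_memLp {μ : Measure E3} {u v : E3 → E3} (hu : MemLp u 2 μ)
    (hv : MemLp v 2 μ) : Integrable (fun x => inner ℝ (u x) (v x)) μ := by
  refine (L2.integrable_inner (𝕜 := ℝ) hu.toLp hv.toLp).congr ?_
  filter_upwards [hu.coeFn_toLp, hv.coeFn_toLp] with x h1 h2
  rw [h1, h2]

/-! ### Uniqueness of weak derivatives -/

theorem ae_eq_of_integral_testField {Ω : Set E3} (hΩ : IsOpen Ω) {w₁ w₂ : E3 → E3}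
    (h₁ : MemLp w₁ 2 (volume.restrict Ω)) (h₂ : MemLp w₂ 2 (volume.restrict Ω))
    (h : ∀ φ, IsTestField Ω φ → ∫ x in Ω, inner ℝ (w₁ x) (φ x) = ∫ x in Ω, inner ℝ (w₂ x) (φ x)) :
    w₁ =ᵐ[volume.restrict Ω] w₂ := by
  have hd : MemLp (fun x => w₁ x - w₂ x) 2 (volume.restrict Ω) := h₁.sub h₂
  have hloc : LocallyIntegrableOn (fun x => w₁ x - w₂ x) Ω volume := by
    rw [locallyIntegrableOn_iff hΩ.isLocallyClosed]
    intro k hk hkc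
    have := hd.restrict k
    rw [Measure.restrict_restrict hkc.measurableSet, Set.inter_eq_left.2 hk] at this
    have hfin : IsFiniteMeasure (volume.restrict k) := ⟨by simpa using hkc.measure_lt_top⟩
    exact this.integrable one_le_two
  have key := hΩ.ae_eq_zero_of_integral_contDiff_smul_eq_zero hloc ?_
  · rw [Filter.EventuallyEq, ae_restrict_iff' hΩ.measurableSet]
    filter_upwards [key] with x hx hxΩ
    exact sub_eq_zero.1 (hx hxΩ)
  · intro g hg hgs hgΩ
    -- Test fields of the form scalar bump times constant vector detect every component of the
    -- difference.
    have hφ : ∀ c : E3, IsTestField Ω fun x => g x • c := fun c =>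
      ⟨hg.smul contDiff_const, hgs.smul_right,
        (closure_mono (Function.support_smul_subset_left g fun _ => c)).trans hgΩ⟩
    rw [← setIntegral_eq_integral_of_forall_compl_eq_zero (s := Ω)]
    swap
    · intro x hx
      rw [image_eq_zero_of_notMem_tsupport fun hx' => hx (hgΩ hx'), zero_smul]
    have hint : Integrable (fun x => g x • (w₁ x - w₂ x)) (volume.restrict Ω) := by
      have hb : MemLp g 2 (volume.restrict Ω) := hg.continuous.memLp_of_hasCompactSupport hgs
      exact memLp_one_iff_integrable.1 (hd.smul hb)
    refine ext_inner_left ℝ fun c => ?_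
    rw [← integral_inner hint, inner_zero_right]
    have i₁ := integrable_inner_of_memLp h₁ ((hφ c).memLp (volume.restrict Ω))
    have i₂ := integrable_inner_of_memLp h₂ ((hφ c).memLp (volume.restrict Ω))
    rw [← sub_eq_zero.2 (h _ (hφ c)), ← integral_sub i₁ i₂]
    congr 1
    ext x
    simp only [inner_smul_right, inner_sub_right, real_inner_comm c]
    ring

/-- `u` and its distributional curl `w` are square integrable. -/
structure HasCurl (Ω : Set E3) (u w : E3 → E3) : Prop where
  memLp : MemLp u 2 (volume.restrict Ω)
  isWeakCurl : IsWeakCurl Ω u w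

namespace HasCurl

variable {Ω : Set E3} {u w u' w' : E3 → E3}

/-- The curl in the energy form is an arbitrary choice. This allows any explicitly known curl to be
used in its place. -/
theorem weakCurl_ae_eq (hΩ : IsOpen Ω) (h : HasCurl Ω u w) :
    weakCurl Ω u =ᵐ[volume.restrict Ω] w := by
  have hex : ∃ w, IsWeakCurl Ω u w := ⟨w, h.isWeakCurl⟩
  have hspec : IsWeakCurl Ω u (weakCurl Ω u) := by
    rw [weakCurl, dif_pos hex]
    exact hex.choose_spec
  exact ae_eq_of_integral_testField hΩ hspec.1 h.isWeakCurl.1 fun φ hφ => by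
    rw [← hspec.2 φ hφ, h.isWeakCurl.2 φ hφ]

theorem zero (Ω : Set E3) : HasCurl Ω 0 0 :=
  ⟨MemLp.zero, MemLp.zero, fun φ _ => by simp⟩

theorem add (h : HasCurl Ω u w) (h' : HasCurl Ω u' w') : HasCurl Ω (u + u') (w + w') := by
  refine ⟨h.memLp.add h'.memLp, h.isWeakCurl.1.add h'.isWeakCurl.1, fun φ hφ => ?_⟩
  simp only [Pi.add_apply, inner_add_left]
  rw [integral_add (integrable_inner_of_memLp h.memLp (hφ.curl.memLp _))
      (integrable_inner_of_memLp h'.memLp (hφ.curl.memLp _)),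
    integral_add (integrable_inner_of_memLp h.isWeakCurl.1 (hφ.memLp _))
      (integrable_inner_of_memLp h'.isWeakCurl.1 (hφ.memLp _)),
    h.isWeakCurl.2 φ hφ, h'.isWeakCurl.2 φ hφ]

theorem smul (c : ℝ) (h : HasCurl Ω u w) : HasCurl Ω (c • u) (c • w) := by
  refine ⟨h.memLp.const_smul c, h.isWeakCurl.1.const_smul c, fun φ hφ => ?_⟩
  simp only [Pi.smul_apply, real_inner_smul_left]
  rw [integral_const_mul, integral_const_mul, h.isWeakCurl.2 φ hφ]

theorem energyForm_eq (hΩ : IsOpen Ω) (h : HasCurl Ω u w) (h' : HasCurl Ω u' w') :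
    energyForm Ω u u' = (∫ x in Ω, inner ℝ (w x) (w' x)) + ∫ x in Ω, inner ℝ (u x) (u' x) := by
  rw [energyForm]
  congr 1
  apply integral_congr_ae
  filter_upwards [h.weakCurl_ae_eq hΩ, h'.weakCurl_ae_eq hΩ] with x h1 h2
  rw [h1, h2]

end HasCurl

/-- Test the gradient identity with curl φ, which is again a test field and has zero divergence. -/
theorem IsWeakGradient.hasCurl {Ω : Set E3} {f : E3 → ℝ} {u : E3 → E3}
    (h : IsWeakGradient Ω f u) : HasCurl Ω u 0 := by
  refine ⟨h.1, MemLp.zero, fun φ hφ => ?_⟩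
  have := h.2 _ hφ.curl
  simp only [hφ.divergence_curl, mul_zero, integral_zero] at this
  simp only [Pi.zero_apply, inner_zero_left, integral_zero]
  linarith

theorem IsWeakGradient.ae_eq {Ω : Set E3} (hΩ : IsOpen Ω) {f : E3 → ℝ} {u u' : E3 → E3}
    (h : IsWeakGradient Ω f u) (h' : IsWeakGradient Ω f u') : u =ᵐ[volume.restrict Ω] u' :=
  ae_eq_of_integral_testField hΩ h.1 h'.1 fun φ hφ => by
    have h1 := h.2 φ hφ
    rw [h'.2 φ hφ] at h1
    linarith

/-- `f` and its distributional gradient `w` are square integrable. -/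
structure HasGradient (Ω : Set E3) (f : E3 → ℝ) (w : E3 → E3) : Prop where
  memLp : MemLp f 2 (volume.restrict Ω)
  isWeakGradient : IsWeakGradient Ω f w

theorem IsTestField.memLp_divergence {Ω : Set E3} {φ : E3 → E3} (hφ : IsTestField Ω φ)
    (μ : Measure E3) [IsFiniteMeasureOnCompacts μ] : MemLp (divergence φ) 2 μ := by
  apply Continuous.memLp_of_hasCompactSupport
  · exact continuous_finsetSum _ fun i _ => (hφ.contDiff_fderiv_apply _ i).continuous
  · exact hφ.2.1.mono' fun x hx => by_contra fun hn => hx (divergence_eq_zero hn)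

namespace HasGradient

variable {Ω : Set E3} {f f' : E3 → ℝ} {w w' : E3 → E3}

theorem zero (Ω : Set E3) : HasGradient Ω 0 0 :=
  ⟨MemLp.zero, MemLp.zero, fun φ _ => by simp⟩

theorem add (h : HasGradient Ω f w) (h' : HasGradient Ω f' w') :
    HasGradient Ω (f + f') (w + w') := by
  refine ⟨h.memLp.add h'.memLp, h.isWeakGradient.1.add h'.isWeakGradient.1, fun φ hφ => ?_⟩
  simp only [Pi.add_apply, inner_add_left, add_mul]
  have i₁ : Integrable (fun x => f x * divergence φ x) (volume.restrict Ω) :=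
    h.memLp.integrable_mul (hφ.memLp_divergence _)
  have i₂ : Integrable (fun x => f' x * divergence φ x) (volume.restrict Ω) :=
    h'.memLp.integrable_mul (hφ.memLp_divergence _)
  rw [integral_add i₁ i₂,
    integral_add (integrable_inner_of_memLp h.isWeakGradient.1 (hφ.memLp _))
      (integrable_inner_of_memLp h'.isWeakGradient.1 (hφ.memLp _)),
    h.isWeakGradient.2 φ hφ, h'.isWeakGradient.2 φ hφ]
  ring

theorem smul (c : ℝ) (h : HasGradient Ω f w) : HasGradient Ω (c • f) (c • w) := by
  refine ⟨h.memLp.const_smul c, h.isWeakGradient.1.const_smul c, fun φ hφ => ?_⟩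
  simp only [Pi.smul_apply, real_inner_smul_left, smul_eq_mul, mul_assoc]
  rw [integral_const_mul, integral_const_mul, h.isWeakGradient.2 φ hφ]
  ring

end HasGradient

/-! ### Weak derivatives of the nodal basis functions -/

section Nodal

open scoped Topology Manifold

variable {Ω : Set E3} {T : Set Tetrahedron}

namespace IsMesh

theorem isCompact_closure (hm : IsMesh Ω T) : IsCompact (closure Ω) := by
  rw [← hm.cover]
  exact hm.finite.isCompact_biUnion fun K _ => K.isCompact_carrier

theorem ae_mem_interior (hm : IsMesh Ω T) :
    ∀ᵐ x : E3, x ∈ Ω → ∃ K ∈ T, x ∈ interior K.carrier := by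
  have hnull : volume (⋃ K ∈ T, frontier K.carrier) = 0 :=
    (measure_biUnion_null_iff hm.finite.countable).2 fun K _ => K.volume_frontier
  filter_upwards [compl_mem_ae_iff.2 hnull] with x hx hxΩ
  obtain ⟨K, hK, hxK⟩ := hm.exists_mem (subset_closure hxΩ)
  refine ⟨K, hK, ?_⟩
  by_contra hnot
  exact hx (Set.mem_biUnion hK ⟨subset_closure hxK, hnot⟩)

theorem ae_restrict_mem_interior (hm : IsMesh Ω T) (hΩ : IsOpen Ω) :
    ∀ᵐ x ∂(volume.restrict Ω), ∃ K ∈ T, x ∈ interior K.carrier :=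
  (ae_restrict_iff' hΩ.measurableSet).2 hm.ae_mem_interior

/-- Piecewise continuous functions are square integrable. -/
theorem memLp_of_piecewise {F : Type*} [NormedAddCommGroup F] (hm : IsMesh Ω T)
    (hΩ : IsOpen Ω) {u : E3 → F}
    (h : ∀ K ∈ T, ∃ a : E3 → F, Continuous a ∧ ∀ x ∈ interior K.carrier, u x = a x) :
    MemLp u 2 (volume.restrict Ω) := by
  classical
  choose! a hac ha using h
  have hsum : MemLp (∑ K ∈ hm.finite.toFinset, (interior K.carrier).indicator (a K)) 2
      (volume.restrict Ω) := by
    refine memLp_finsetSum' _ fun K hK => ?_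
    have hK' : K ∈ T := hm.finite.mem_toFinset.1 hK
    rw [memLp_indicator_iff_restrict isOpen_interior.measurableSet]
    have h1 : MemLp (a K) 2 (volume.restrict K.carrier) := by
      obtain ⟨B, hB⟩ := K.isCompact_carrier.exists_bound_of_continuousOn (hac K hK').continuousOn
      have hfin : IsFiniteMeasure (volume.restrict K.carrier) :=
        ⟨by simpa using K.volume_carrier_lt_top⟩
      refine MemLp.of_bound ((hac K hK').continuousOn.aestronglyMeasurable_of_isCompact
        K.isCompact_carrier K.measurableSet_carrier) B ?_
      exact (ae_restrict_iff' K.measurableSet_carrier).2 (.of_forall hB)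
    refine h1.mono_measure ?_
    rw [Measure.restrict_restrict isOpen_interior.measurableSet]
    exact Measure.restrict_mono (Set.inter_subset_left.trans interior_subset) le_rfl
  refine (memLp_congr_ae ?_).2 hsum
  filter_upwards [hm.ae_restrict_mem_interior hΩ] with x hx
  obtain ⟨K, hK, hxK⟩ := hx
  rw [Finset.sum_apply, Finset.sum_eq_single_of_mem K (hm.finite.mem_toFinset.2 hK),
    Set.indicator_of_mem hxK, ha K hK x hxK]
  intro K' hK' hne
  apply Set.indicator_of_notMem
  intro hx'
  exact hne (hm.eq_of_mem_interior (hm.finite.mem_toFinset.1 hK') hK hx' (interior_subset hxK))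

end IsMesh

open Classical in
/-- The piecewise gradient of a tent function. -/
noncomputable def tentGrad (T : Set Tetrahedron) (p x : E3) : E3 :=
  if h : ∃ K ∈ T, x ∈ K.carrier then h.choose.baryGrad p else 0

theorem tentGrad_eq (hm : IsMesh Ω T) {K : Tetrahedron} (hK : K ∈ T) {x : E3}
    (hx : x ∈ interior K.carrier) (p : E3) : tentGrad T p x = K.baryGrad p := by
  have h : ∃ K ∈ T, x ∈ K.carrier := ⟨K, hK, interior_subset hx⟩
  have hch : h.choose = K :=
    (hm.eq_of_mem_interior hK h.choose_spec.1 hx h.choose_spec.2).symm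
  rw [tentGrad, dif_pos h, hch]

/-- The piecewise curl of an edge basis function. -/
noncomputable def edgeCurl (T : Set Tetrahedron) (p q x : E3) : E3 :=
  (2 : ℝ) • cross (tentGrad T p x) (tentGrad T q x)

/-- Near a compact subset of the domain a tent function agrees with a Lipschitz function with
compact support. -/
theorem exists_compactLipschitz_eq_tent (hΩ : IsOpen Ω) (hm : IsMesh Ω T) (hc : Conforming T)
    (p : E3) {Z : Set E3} (hZ : IsCompact Z) (hZΩ : Z ⊆ Ω) :
    ∃ F : E3 → ℝ, IsCompactLipschitz F ∧ (∀ x ∈ Z, F x = tent T p x) ∧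
      ∀ K ∈ T, ∀ x ∈ Z, x ∈ interior K.carrier → ∀ v, lineDeriv ℝ F x v
        = inner ℝ (K.baryGrad p) v := by
  -- Extended by zero, the tent function may jump across the boundary of Ω. Multiplying by a bump χ
  -- that is 1 near Z and vanishes off Ω removes the jump.
  obtain ⟨χ, hχ1, hχ0, hχ01⟩ := exists_contMDiffMap_one_nhds_of_subset_interior (n := ⊤)
    (𝓘(ℝ, E3)) (s := Z) (t := Ω) hZ.isClosed (by rwa [hΩ.interior_eq])
  have hsupp : HasCompactSupport χ := by
    refine HasCompactSupport.intro hm.isCompact_closure fun x hx => hχ0 x fun hx' => ?_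
    exact hx (subset_closure hx')
  have hχ : IsCompactLipschitz χ := .of_contDiff χ.contMDiff.contDiff hsupp
  obtain ⟨C, hC⟩ := hχ.lipschitz
  have hχabs : ∀ x, |χ x| ≤ (1 : NNReal) := fun x => by
    rw [abs_of_nonneg (hχ01 x).1]; simpa using (hχ01 x).2
  refine ⟨fun x => χ x * tent T p x, ⟨?_, hsupp.mul_right⟩, ?_, ?_⟩
  · have hfin : Finite T := hm.finite
    let D : NNReal := ∑ K ∈ hm.finite.toFinset, ‖K.baryGrad p‖₊
    -- The closed cover consists of the mesh elements and, as the index `none`, the complement of Ω.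
    -- The constant has to serve all pieces, so D sums the gradient norms over the mesh.
    refine ⟨1 * D + 1 * C, lipschitzWith_of_finite_closed_cover (ι := Option T)
      (s := fun i => i.elim Ωᶜ fun K => K.1.carrier) ?_ ?_ ?_⟩
    · rintro (_ | K)
      · exact hΩ.isClosed_compl
      · exact K.1.isClosed_carrier
    · rw [Set.eq_univ_iff_forall]
      intro x
      by_cases hx : x ∈ Ω
      · obtain ⟨K, hK, hxK⟩ := hm.exists_mem (subset_closure hx)
        exact Set.mem_iUnion.2 ⟨some ⟨K, hK⟩, hxK⟩
      · exact Set.mem_iUnion.2 ⟨none, hx⟩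
    · rintro (_ | ⟨K, hK⟩)
      · refine LipschitzOnWith.of_dist_le_mul fun x hx y hy => ?_
        rw [hχ0 x hx, hχ0 y hy]
        simp only [zero_mul, dist_self]
        positivity
      · have h1 : LipschitzOnWith D (K.bary p) K.carrier := by
          refine ((K.lipschitzWith_bary p).weaken ?_).lipschitzOnWith
          exact Finset.single_le_sum (f := fun K : Tetrahedron => ‖K.baryGrad p‖₊)
            (fun _ _ => zero_le) (hm.finite.mem_toFinset.2 hK)
        have h2 := LipschitzOnWith.mul_of_bound (A := 1) (B := 1)
          (hC.lipschitzOnWith (s := K.carrier)) h1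
          (fun x _ => hχabs x) fun x hx => by
            rw [abs_of_nonneg (K.bary_nonneg hx p)]
            exact K.bary_le_one hx p
        intro x hx y hy
        have hx' : tent T p x = K.bary p x := tent_eq hc hK hx p
        have hy' : tent T p y = K.bary p y := tent_eq hc hK hy p
        simp only [hx', hy']
        exact h2 hx hy
  · intro x hx
    change χ x * tent T p x = tent T p x
    rw [hχ1.self_of_nhdsSet x hx, one_mul]
  · intro K hK x hx hxK v
    have heq : (fun x => χ x * tent T p x) =ᶠ[𝓝 x] K.bary p := by
      filter_upwards [(Filter.Eventually.filter_mono (nhds_le_nhdsSet hx) hχ1),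
        isOpen_interior.mem_nhds hxK] with y hy hyK
      rw [hy, one_mul, tent_eq hc hK (interior_subset hyK)]
    rw [heq.lineDeriv_eq]
    have hd := (K.hasGradientAt_bary p x).hasFDerivAt
    rw [hd.differentiableAt.lineDeriv_eq_fderiv, hd.fderiv, InnerProductSpace.toDual_apply_apply]

theorem hasGradient_tent (hΩ : IsOpen Ω) (hm : IsMesh Ω T) (hc : Conforming T) (p : E3) :
    HasGradient Ω (tent T p) (tentGrad T p) := by
  refine ⟨hm.memLp_of_piecewise hΩ fun K hK => ⟨K.bary p, K.continuous_bary p,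
    fun x hx => tent_eq hc hK (interior_subset hx) p⟩,
    hm.memLp_of_piecewise hΩ fun K hK => ⟨fun _ => K.baryGrad p, continuous_const,
    fun x hx => tentGrad_eq hm hK hx p⟩, fun φ hφ => ?_⟩
  obtain ⟨F, hF, hFeq, hFd⟩ := exists_compactLipschitz_eq_tent hΩ hm hc p hφ.2.1 hφ.2.2
  have hline : ∀ x i, fderiv ℝ φ x (stdVec i) i = lineDeriv ℝ (fun y => φ y i) x (stdVec i) :=
    fun x i => (lineDeriv_comp_apply hφ.differentiable x _ i).symm
  have lhs : ∫ x in Ω, tent T p x * divergence φ x = ∫ x, F x * divergence φ x := by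
    rw [← setIntegral_eq_integral_of_forall_compl_eq_zero (s := Ω)
      (f := fun x => F x * divergence φ x)]
    · congr 1
      ext x
      by_cases hx : x ∈ tsupport φ
      · rw [hFeq x hx]
      · rw [IsTestField.divergence_eq_zero hx, mul_zero, mul_zero]
    · intro x hx
      rw [IsTestField.divergence_eq_zero fun hx' => hx (hφ.2.2 hx'), mul_zero]
  have rhs : ∫ x in Ω, inner ℝ (tentGrad T p x) (φ x)
      = ∫ x, ∑ i, lineDeriv ℝ F x (stdVec i) * φ x i := by
    rw [← setIntegral_eq_integral_of_forall_compl_eq_zero (s := Ω)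
      (f := fun x => ∑ i, lineDeriv ℝ F x (stdVec i) * φ x i)]
    · apply integral_congr_ae
      filter_upwards [hm.ae_restrict_mem_interior hΩ] with x ⟨K, hK, hxK⟩
      by_cases hx : x ∈ tsupport φ
      · simp only [hFd K hK x hx hxK, inner_stdVec, tentGrad_eq hm hK hxK]
        rw [inner_eq_sum, Fin.sum_univ_three]
      · rw [image_eq_zero_of_notMem_tsupport hx]
        simp
    · intro x hx
      simp [hφ.eq_zero hx]
  have i₁ : ∀ i : Fin 3, Integrable fun x => lineDeriv ℝ F x (stdVec i) * φ x i := fun i =>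
    (hF.integrable_lineDeriv _).mul_of_top_left (hφ.isCompactLipschitz i).memLp_top
  have i₂ : ∀ i : Fin 3, Integrable fun x =>
      F x * lineDeriv ℝ (fun y => φ y i) x (stdVec i) := fun i =>
    ((hφ.isCompactLipschitz i).integrable_lineDeriv _).mul_of_top_right hF.memLp_top
  rw [lhs, rhs, integral_finsetSum _ fun i _ => i₁ i]
  simp only [divergence, hline, Finset.mul_sum]
  rw [integral_finsetSum _ fun i _ => i₂ i, ← Finset.sum_neg_distrib]
  refine Finset.sum_congr rfl fun i _ => ?_
  rw [hF.integral_lineDeriv_mul (hφ.isCompactLipschitz i), neg_neg]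
  congr 1
  ext x
  ring

/-- Near the support of a test field the edge function is F∇G - G∇F with compactly supported
Lipschitz F and G, so its curl is 2∇F × ∇G. Conformity enters through the Lipschitz property of F
and G; tangential continuity is never used explicitly. -/
theorem hasCurl_edgeBasis (hΩ : IsOpen Ω) (hm : IsMesh Ω T) (hc : Conforming T) (p q : E3) :
    HasCurl Ω (edgeBasis T p q) (edgeCurl T p q) := by
  refine ⟨hm.memLp_of_piecewise hΩ fun K hK =>
    ⟨fun x => K.bary p x • K.baryGrad q - K.bary q x • K.baryGrad p,
      ((K.continuous_bary p).smul continuous_const).sub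
        ((K.continuous_bary q).smul continuous_const),
      fun x hx => edgeBasis_eq hm hK hx p q⟩,
    hm.memLp_of_piecewise hΩ fun K hK =>
      ⟨fun _ => (2 : ℝ) • cross (K.baryGrad p) (K.baryGrad q), continuous_const,
        fun x hx => by rw [edgeCurl, tentGrad_eq hm hK hx, tentGrad_eq hm hK hx]⟩, fun φ hφ => ?_⟩
  obtain ⟨F, hF, hFeq, hFd⟩ := exists_compactLipschitz_eq_tent hΩ hm hc p hφ.2.1 hφ.2.2
  obtain ⟨G, hG, hGeq, hGd⟩ := exists_compactLipschitz_eq_tent hΩ hm hc q hφ.2.1 hφ.2.2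
  have hline : ∀ x i j, fderiv ℝ φ x (stdVec i) j = lineDeriv ℝ (fun y => φ y j) x (stdVec i) :=
    fun x i j => (lineDeriv_comp_apply hφ.differentiable x _ j).symm
  -- Summed over the cyclic triples (0,1,2), (1,2,0), (2,0,1), A gives f∇g · curl φ and B gives (∇f
  -- × ∇g) · φ.
  let A : (E3 → ℝ) → (E3 → ℝ) → Fin 3 → Fin 3 → Fin 3 → E3 → ℝ := fun f g i j k x =>
    f x * (lineDeriv ℝ g x (stdVec i) * lineDeriv ℝ (fun y => φ y k) x (stdVec j)
      - lineDeriv ℝ g x (stdVec j) * lineDeriv ℝ (fun y => φ y k) x (stdVec i))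
  let B : (E3 → ℝ) → (E3 → ℝ) → Fin 3 → Fin 3 → Fin 3 → E3 → ℝ := fun f g i j k x =>
    (lineDeriv ℝ f x (stdVec i) * lineDeriv ℝ g x (stdVec j)
      - lineDeriv ℝ f x (stdVec j) * lineDeriv ℝ g x (stdVec i)) * φ x k
  have hA : ∀ f g, IsCompactLipschitz f → IsCompactLipschitz g → ∀ i j k,
      Integrable (A f g i j k) := fun f g hf hg i j k =>
    hf.integrable_curl_aux hg (hφ.isCompactLipschitz k) _ _
  have hB : ∀ f g, IsCompactLipschitz f → IsCompactLipschitz g → ∀ i j k,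
      Integrable (B f g i j k) := fun f g hf hg i j k =>
    hf.integrable_cross_aux hg (hφ.isCompactLipschitz k) _ _
  have hAB : ∀ f g, IsCompactLipschitz f → IsCompactLipschitz g → ∀ i j k,
      ∫ x, A f g i j k x = ∫ x, B f g i j k x := fun f g hf hg i j k =>
    hf.integral_mul_curl_aux hg (hφ.isCompactLipschitz k) _ _
  have lhs : ∫ x in Ω, inner ℝ (edgeBasis T p q x) (curl φ x)
      = ∫ x, ((A F G 0 1 2 x + A F G 1 2 0 x + A F G 2 0 1 x)
        - (A G F 0 1 2 x + A G F 1 2 0 x + A G F 2 0 1 x)) := by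
    refine Eq.trans (integral_congr_ae ?_)
      (setIntegral_eq_integral_of_forall_compl_eq_zero (s := Ω) ?_)
    · filter_upwards [hm.ae_restrict_mem_interior hΩ] with x ⟨K, hK, hxK⟩
      by_cases hx : x ∈ tsupport φ
      · simp only [A, hFd K hK x hx hxK, hGd K hK x hx hxK, inner_stdVec, edgeBasis_eq hm hK hxK,
          hFeq x hx, hGeq x hx, tent_eq hc hK (interior_subset hxK), ← hline]
        rw [inner_eq_sum]
        simp only [curl, PiLp.sub_apply, PiLp.smul_apply, smul_eq_mul, Matrix.cons_val_zero,
          Matrix.cons_val_one, Matrix.cons_val]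
        ring
      · rw [IsTestField.curl_eq_zero hx, inner_zero_right]
        simp only [A, ← hline, IsTestField.fderiv_eq_zero hx]
        simp
    · intro x hx
      have hx' : x ∉ tsupport φ := fun hx' => hx (hφ.2.2 hx')
      simp only [A, ← hline, IsTestField.fderiv_eq_zero hx']
      simp
  have rhs : ∫ x in Ω, inner ℝ (edgeCurl T p q x) (φ x)
      = ∫ x, ((B F G 0 1 2 x + B F G 1 2 0 x + B F G 2 0 1 x)
        - (B G F 0 1 2 x + B G F 1 2 0 x + B G F 2 0 1 x)) := by
    refine Eq.trans (integral_congr_ae ?_)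
      (setIntegral_eq_integral_of_forall_compl_eq_zero (s := Ω) ?_)
    · filter_upwards [hm.ae_restrict_mem_interior hΩ] with x ⟨K, hK, hxK⟩
      by_cases hx : x ∈ tsupport φ
      · simp only [B, hFd K hK x hx hxK, hGd K hK x hx hxK, inner_stdVec, edgeCurl,
          tentGrad_eq hm hK hxK]
        rw [inner_eq_sum]
        simp only [cross, PiLp.smul_apply, smul_eq_mul, Matrix.cons_val_zero,
          Matrix.cons_val_one, Matrix.cons_val]
        ring
      · rw [image_eq_zero_of_notMem_tsupport hx]
        simp [B, image_eq_zero_of_notMem_tsupport hx]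
    · intro x hx
      simp [B, hφ.eq_zero hx]
  have split : ∀ D : (E3 → ℝ) → (E3 → ℝ) → Fin 3 → Fin 3 → Fin 3 → E3 → ℝ,
      (∀ i j k, Integrable (D F G i j k)) → (∀ i j k, Integrable (D G F i j k)) →
      ∫ x, ((D F G 0 1 2 x + D F G 1 2 0 x + D F G 2 0 1 x)
        - (D G F 0 1 2 x + D G F 1 2 0 x + D G F 2 0 1 x))
      = ((∫ x, D F G 0 1 2 x) + (∫ x, D F G 1 2 0 x) + ∫ x, D F G 2 0 1 x)
        - ((∫ x, D G F 0 1 2 x) + (∫ x, D G F 1 2 0 x) + ∫ x, D G F 2 0 1 x) := by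
    intro D h1 h2
    rw [integral_sub, integral_add, integral_add, integral_add, integral_add]
    · exact h2 _ _ _
    · exact h2 _ _ _
    · exact (h2 _ _ _).add (h2 _ _ _)
    · exact h2 _ _ _
    · exact h1 _ _ _
    · exact h1 _ _ _
    · exact (h1 _ _ _).add (h1 _ _ _)
    · exact h1 _ _ _
    · exact ((h1 _ _ _).add (h1 _ _ _)).add (h1 _ _ _)
    · exact ((h2 _ _ _).add (h2 _ _ _)).add (h2 _ _ _)
  rw [lhs, rhs, split A (hA F G hF hG) (hA G F hG hF), split B (hB F G hF hG) (hB G F hG hF)]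
  simp only [hAB F G hF hG, hAB G F hG hF]

end Nodal

/-! ### Functions with one basis function per element -/

/-- The edge element field `λ_p ∇λ_q - λ_q ∇λ_p` of a tetrahedron. -/
noncomputable def Tetrahedron.edgeField (K : Tetrahedron) (p q x : E3) : E3 :=
  K.bary p x • K.baryGrad q - K.bary q x • K.baryGrad p

/-- The constant curl of the edge element field. -/
noncomputable def Tetrahedron.edgeFieldCurl (K : Tetrahedron) (p q : E3) : E3 :=
  (2 : ℝ) • cross (K.baryGrad p) (K.baryGrad q)

theorem cross_anticomm (a b : E3) : cross b a = - cross a b := by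
  ext i
  fin_cases i <;> simp [cross] <;> ring

theorem cross_self (a : E3) : cross a a = 0 := by
  ext i
  fin_cases i <;> simp [cross] <;> ring

theorem cross_zero_left (a : E3) : cross 0 a = 0 := by
  ext i
  fin_cases i <;> simp [cross]

theorem cross_zero_right (a : E3) : cross a 0 = 0 := by
  ext i
  fin_cases i <;> simp [cross]

theorem inner_cross_cross (a b c d : E3) :
    inner ℝ (cross a b) (cross c d)
      = inner ℝ a c * inner ℝ b d - inner ℝ a d * inner ℝ b c := by
  simp only [inner_eq_sum, cross, Matrix.cons_val_zero, Matrix.cons_val_one, Matrix.cons_val]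
  ring

theorem norm_cross_le (a b : E3) : ‖cross a b‖ ≤ ‖a‖ * ‖b‖ := by
  have h := inner_cross_cross a b a b
  rw [real_inner_self_eq_norm_sq, real_inner_self_eq_norm_sq, real_inner_self_eq_norm_sq,
    real_inner_comm a b] at h
  refine abs_le_of_sq_le_sq' ?_ (by positivity) |>.2
  nlinarith [mul_self_nonneg (inner ℝ a b : ℝ)]

/-! ### Size of an edge field and of its curl on a tetrahedron -/

namespace Tetrahedron

variable (K : Tetrahedron)

theorem baryGrad_of_notMem {p : E3} (hp : p ∉ K.vertices) : K.baryGrad p = 0 := by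
  have h := K.inner_baryGrad p 0 (K.baryGrad p)
  rw [K.bary_of_notMem hp, K.bary_of_notMem hp, sub_zero, sub_zero] at h
  exact inner_self_eq_zero.1 h

theorem edgeField_swap (p q x : E3) : K.edgeField q p x = - K.edgeField p q x := by
  rw [edgeField, edgeField, neg_sub]

theorem edgeFieldCurl_swap (p q : E3) : K.edgeFieldCurl q p = - K.edgeFieldCurl p q := by
  rw [edgeFieldCurl, edgeFieldCurl, cross_anticomm, smul_neg]

theorem edgeField_eq_zero {p q : E3} (h : ¬ (p ∈ K.vertices ∧ q ∈ K.vertices ∧ p ≠ q)) (x : E3) :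
    K.edgeField p q x = 0 := by
  rw [edgeField]
  by_cases hp : p ∈ K.vertices
  · by_cases hq : q ∈ K.vertices
    · obtain rfl : p = q := by tauto
      exact sub_self _
    · rw [K.bary_of_notMem hq, K.baryGrad_of_notMem hq]; simp
  · rw [K.bary_of_notMem hp, K.baryGrad_of_notMem hp]; simp

theorem edgeFieldCurl_eq_zero {p q : E3} (h : ¬ (p ∈ K.vertices ∧ q ∈ K.vertices ∧ p ≠ q)) :
    K.edgeFieldCurl p q = 0 := by
  rw [edgeFieldCurl]
  by_cases hp : p ∈ K.vertices
  · by_cases hq : q ∈ K.vertices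
    · obtain rfl : p = q := by tauto
      rw [cross_self, smul_zero]
    · rw [K.baryGrad_of_notMem hq, cross_zero_right, smul_zero]
  · rw [K.baryGrad_of_notMem hp, cross_zero_left, smul_zero]

theorem norm_edgeField_le {x : E3} (hx : x ∈ K.carrier) (p q : E3) :
    K.diam * ‖K.edgeField p q x‖ ≤ 2 * K.shapeRegularity := by
  have h1 : ‖K.edgeField p q x‖ ≤ ‖K.baryGrad q‖ + ‖K.baryGrad p‖ := by
    refine (norm_sub_le _ _).trans (add_le_add ?_ ?_) <;> rw [norm_smul, Real.norm_eq_abs,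
      abs_of_nonneg (K.bary_nonneg hx _)] <;>
    exact mul_le_of_le_one_left (norm_nonneg _) (K.bary_le_one hx _)
  have h2 := K.diam_mul_baryGrad_le p
  have h3 := K.diam_mul_baryGrad_le q
  nlinarith [K.diam_pos]

/-- With a third vertex s, the gradients of λ_p and λ_q are biorthogonal to p - s and q - s. Hence
∇λ_p × ∇λ_q has inner product 1 with (p - s) × (q - s), whose norm is at most the squared diameter.
-/
theorem edgeFieldCurl_lower {p q : E3} (hp : p ∈ K.vertices) (hq : q ∈ K.vertices) (hpq : p ≠ q) :
    2 ≤ K.diam ^ 2 * ‖K.edgeFieldCurl p q‖ := by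
  classical
  obtain ⟨s, hs, hs'⟩ := K.exists_ne_vertex {p, q} (by rw [Finset.card_pair hpq]; norm_num)
  simp only [Finset.mem_insert, Finset.mem_singleton, not_or] at hs'
  have h := inner_cross_cross (K.baryGrad p) (K.baryGrad q) (p - s) (q - s)
  rw [K.inner_baryGrad, K.inner_baryGrad, K.inner_baryGrad, K.inner_baryGrad, K.bary_self hp,
    K.bary_self hq, K.bary_ne hs (Ne.symm hs'.1), K.bary_ne hs (Ne.symm hs'.2), K.bary_ne hq hpq,
    K.bary_ne hp hpq.symm] at h
  have h1 := real_inner_le_norm (cross (K.baryGrad p) (K.baryGrad q)) (cross (p - s) (q - s))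
  have h2 := norm_cross_le (p - s) (q - s)
  have h3 := K.dist_le_diam (K.vertex_mem hp) (K.vertex_mem hs)
  have h4 := K.dist_le_diam (K.vertex_mem hq) (K.vertex_mem hs)
  have h5 : ‖cross (p - s) (q - s)‖ ≤ K.diam ^ 2 := by
    refine h2.trans ?_
    rw [sq]
    exact mul_le_mul h3 h4 (norm_nonneg _) K.diam_pos.le
  rw [edgeFieldCurl, norm_smul, Real.norm_eq_abs, abs_of_pos (by norm_num : (0 : ℝ) < 2)]
  have h6 := mul_le_mul_of_nonneg_left h5 (norm_nonneg (cross (K.baryGrad p) (K.baryGrad q)))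
  linarith

/-- This pointwise bound works because the curl of a nonzero edge field is a nonzero constant. It is
the source of the smallness of fine edge functions. -/
theorem norm_edgeField_le_curl {p q : E3} (hp : p ∈ K.vertices) (hq : q ∈ K.vertices)
    (hpq : p ≠ q) {x : E3} (hx : x ∈ K.carrier) :
    ‖K.edgeField p q x‖ ≤ K.shapeRegularity * K.diam * ‖K.edgeFieldCurl p q‖ := by
  have h1 := K.norm_edgeField_le hx p q
  have h2 := K.edgeFieldCurl_lower hp hq hpq
  have hd := K.diam_pos
  have h3 := mul_le_mul_of_nonneg_left h2 K.shapeRegularity_pos.le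
  have h4 : K.diam * ‖K.edgeField p q x‖
      ≤ K.diam * (K.shapeRegularity * K.diam * ‖K.edgeFieldCurl p q‖) := by
    calc K.diam * ‖K.edgeField p q x‖ ≤ K.shapeRegularity * 2 := by linarith
      _ ≤ _ := h3
      _ = _ := by ring
  exact le_of_mul_le_mul_left h4 hd

theorem bary_le_edgeField {p q : E3} (hp : p ∈ K.vertices) (hpq : p ≠ q) (x : E3) :
    K.bary q x ≤ K.diam * ‖K.edgeField p q x‖ := by
  classical
  obtain ⟨s, hs, hs'⟩ := K.exists_ne_vertex {p, q} (by rw [Finset.card_pair hpq]; norm_num)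
  simp only [Finset.mem_insert, Finset.mem_singleton, not_or] at hs'
  rw [← K.edge_field_inner hp hs hpq (Ne.symm hs'.1) (Ne.symm hs'.2) x, mul_comm]
  exact (real_inner_le_norm _ _).trans
    (mul_le_mul_of_nonneg_left (K.dist_le_diam (K.vertex_mem hs) (K.vertex_mem hp)) (norm_nonneg _))

theorem continuous_edgeField (p q : E3) : Continuous (K.edgeField p q) :=
  ((K.continuous_bary p).smul continuous_const).sub ((K.continuous_bary q).smul continuous_const)

theorem contDiff_edgeField (p q : E3) : ContDiff ℝ ∞ (K.edgeField p q) :=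
  ((K.contDiff_bary p).smul contDiff_const).sub ((K.contDiff_bary q).smul contDiff_const)

theorem fderiv_edgeField (p q x v : E3) : fderiv ℝ (K.edgeField p q) x v
    = inner ℝ (K.baryGrad p) v • K.baryGrad q - inner ℝ (K.baryGrad q) v • K.baryGrad p := by
  have h : ∀ p q : E3, HasFDerivAt (fun y => K.bary p y • K.baryGrad q) _ x := fun p q =>
    (K.hasGradientAt_bary p x).hasFDerivAt.smul_const (K.baryGrad q)
  have := ((h p q).sub (h q p)).fderiv
  rw [show K.edgeField p q = (fun y => K.bary p y • K.baryGrad q) -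
    fun y => K.bary q y • K.baryGrad p from rfl, this]
  simp

theorem divergence_edgeField (p q x : E3) : divergence (K.edgeField p q) x = 0 := by
  simp only [divergence, fderiv_edgeField, inner_stdVec, Fin.sum_univ_three, PiLp.sub_apply,
    PiLp.smul_apply, smul_eq_mul]
  ring

theorem interior_ae_eq : interior K.carrier =ᵐ[volume] K.carrier := by
  refine interior_subset.eventuallyLE.antisymm ?_
  rw [ae_le_set]
  refine measure_mono_null (fun x hx => ?_) K.volume_frontier
  exact ⟨subset_closure hx.1, hx.2⟩

theorem integral_edgeField_lower {p q : E3} (hp : p ∈ K.vertices) (hq : q ∈ K.vertices)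
    (hpq : p ≠ q) : volume.real K.carrier
      ≤ 32 * K.diam ^ 2 * ∫ x in interior K.carrier, ‖K.edgeField p q x‖ ^ 2 := by
  have hd := K.diam_pos
  have hcont : Continuous fun x => ‖K.edgeField p q x‖ ^ 2 :=
    (K.continuous_edgeField p q).norm.pow 2
  -- S is K shrunk by 1/2, so it has 1/8 of the volume, and the field has norm at least 1/(2h) on
  -- it. The constant is 32 = 8 · 4.
  set S : Set E3 := {x ∈ K.carrier | 1 / 2 ≤ K.bary q x} with hS
  have hvol : volume.real S = (1 / 8) * volume.real K.carrier := by
    rw [hS, K.volume_real_bary_ge hq (by norm_num) (by norm_num)]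
    norm_num
  have hSm : MeasurableSet S :=
    K.measurableSet_carrier.inter ((K.continuous_bary q).measurable measurableSet_Ici)
  have hint : IntegrableOn (fun x => ‖K.edgeField p q x‖ ^ 2) K.carrier :=
    hcont.continuousOn.integrableOn_compact K.isCompact_carrier
  have h1 : ∫ x in S, (1 / (2 * K.diam)) ^ 2 ≤ ∫ x in S, ‖K.edgeField p q x‖ ^ 2 := by
    refine setIntegral_mono_on ?_ (hint.mono_set (Set.sep_subset _ _)) hSm fun x hx => ?_
    · exact integrableOn_const (((measure_mono (Set.sep_subset _ _)).trans_lt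
        K.volume_carrier_lt_top).ne)
    · have h2 := K.bary_le_edgeField hp hpq x
      have h3 : 1 / 2 ≤ K.bary q x := hx.2
      have h4 : 1 / (2 * K.diam) ≤ ‖K.edgeField p q x‖ := by
        rw [div_le_iff₀ (by positivity)]
        linarith
      exact pow_le_pow_left₀ (by positivity) h4 2
  have h2 : ∫ x in S, ‖K.edgeField p q x‖ ^ 2 ≤ ∫ x in K.carrier, ‖K.edgeField p q x‖ ^ 2 :=
    setIntegral_mono_set hint (.of_forall fun x => by positivity)
      (Set.sep_subset _ _).eventuallyLE
  rw [setIntegral_const, hvol, smul_eq_mul] at h1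
  rw [setIntegral_congr_set K.interior_ae_eq]
  have h3 : volume.real K.carrier
      = 32 * K.diam ^ 2 * (1 / 8 * volume.real K.carrier * (1 / (2 * K.diam)) ^ 2) := by
    field_simp
    ring
  rw [h3]
  exact mul_le_mul_of_nonneg_left (h1.trans h2) (by positivity)

end Tetrahedron

/-! ### At most one basis function of a class on each element -/

section LocalStructure

variable {Ω : Set E3} {T : Set Tetrahedron} {ρ : ℝ}

/-- On the element `K`, the field `u` is a multiple of an edge basis field, and `w` is its curl. -/
def IsLocalEdgeField (ρ : ℝ) (K : Tetrahedron) (u w : E3 → E3) : Prop :=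
  (∀ x ∈ interior K.carrier, u x = 0 ∧ w x = 0) ∨
    (K.shapeRegularity ≤ ρ ∧ ∃ p ∈ K.vertices, ∃ q ∈ K.vertices, p ≠ q ∧
      ∃ c : ℝ, ∀ x ∈ interior K.carrier,
        u x = c • K.edgeField p q x ∧ w x = c • K.edgeFieldCurl p q)

/-- On the element `K`, the function `f` is a multiple of a barycentric coordinate, and `w` is its
gradient. -/
def IsLocalTent (ρ : ℝ) (K : Tetrahedron) (f : E3 → ℝ) (w : E3 → E3) : Prop :=
  (∀ x ∈ interior K.carrier, f x = 0 ∧ w x = 0) ∨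
    (K.shapeRegularity ≤ ρ ∧ ∃ p ∈ K.vertices, ∃ c : ℝ, ∀ x ∈ interior K.carrier,
        f x = c * K.bary p x ∧ w x = c • K.baryGrad p)

theorem exists_curl_of_mem_edgeSpace (hΩ : IsOpen Ω) (hm : IsMesh Ω T) (hc : Conforming T)
    {E : Set (Sym2 E3)} (hsep : ∀ K ∈ T, ∀ e ∈ K.edges, ∀ e' ∈ K.edges, e ∈ E → e' ∈ E → e = e')
    (hreg : ∀ K ∈ T, ∀ e ∈ K.edges, e ∈ E → K.shapeRegularity ≤ ρ) {u : E3 → E3}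
    (hu : u ∈ edgeSpace T E) : ∃ w, HasCurl Ω u w ∧ ∀ K ∈ T, IsLocalEdgeField ρ K u w := by
  have main : ∃ w, HasCurl Ω u w ∧ ∀ K ∈ T,
      (∀ p ∈ K.vertices, ∀ q ∈ K.vertices, p ≠ q → s(p, q) ∈ E → ∃ c : ℝ,
        ∀ x ∈ interior K.carrier, u x = c • K.edgeField p q x ∧ w x = c • K.edgeFieldCurl p q) ∧
      ((∀ e ∈ K.edges, e ∉ E) → ∀ x ∈ interior K.carrier, u x = 0 ∧ w x = 0) := by
    -- The invariant fixes the edge before it asks for a coefficient, so coefficients of summands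
    -- simply add. The disjunction in `IsLocalEdgeField` would not be stable under sums.
    refine Submodule.span_induction (p := fun u _ => ∃ w, HasCurl Ω u w ∧ ∀ K ∈ T,
      (∀ p ∈ K.vertices, ∀ q ∈ K.vertices, p ≠ q → s(p, q) ∈ E → ∃ c : ℝ,
        ∀ x ∈ interior K.carrier, u x = c • K.edgeField p q x ∧ w x = c • K.edgeFieldCurl p q) ∧
      ((∀ e ∈ K.edges, e ∉ E) → ∀ x ∈ interior K.carrier, u x = 0 ∧ w x = 0))
      ?_ ?_ ?_ ?_ hu
    · rintro _ ⟨p', q', he, rfl⟩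
      refine ⟨_, hasCurl_edgeBasis hΩ hm hc p' q', fun K hK => ?_⟩
      have hval : ∀ x ∈ interior K.carrier, edgeBasis T p' q' x = K.edgeField p' q' x ∧
          edgeCurl T p' q' x = K.edgeFieldCurl p' q' := fun x hx =>
        ⟨edgeBasis_eq hm hK hx p' q', by
          rw [edgeCurl, tentGrad_eq hm hK hx, tentGrad_eq hm hK hx, Tetrahedron.edgeFieldCurl]⟩
      by_cases hmem : p' ∈ K.vertices ∧ q' ∈ K.vertices ∧ p' ≠ q'
      · have he' : s(p', q') ∈ K.edges := ⟨p', hmem.1, q', hmem.2.1, hmem.2.2, rfl⟩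
        refine ⟨fun p hp q hq hpq hpqE => ?_, fun h => absurd he (h _ he')⟩
        have := hsep K hK _ he' _ ⟨p, hp, q, hq, hpq, rfl⟩ he hpqE
        rcases Sym2.eq_iff.1 this with ⟨rfl, rfl⟩ | ⟨rfl, rfl⟩
        · exact ⟨1, fun x hx => by simpa using hval x hx⟩
        · refine ⟨-1, fun x hx => ?_⟩
          rw [(hval x hx).1, (hval x hx).2, K.edgeField_swap, K.edgeFieldCurl_swap]
          simp
      · have hzero : ∀ x ∈ interior K.carrier, edgeBasis T p' q' x = 0 ∧ edgeCurl T p' q' x = 0 :=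
          fun x hx => by
            rw [(hval x hx).1, (hval x hx).2]
            exact ⟨K.edgeField_eq_zero hmem x, K.edgeFieldCurl_eq_zero hmem⟩
        exact ⟨fun p _ q _ _ _ => ⟨0, fun x hx => by simpa using hzero x hx⟩, fun _ => hzero⟩
    · exact ⟨0, HasCurl.zero Ω, fun K _ => ⟨fun p _ q _ _ _ => ⟨0, fun x _ => by simp⟩,
        fun _ x _ => by simp⟩⟩
    · rintro u₁ u₂ _ _ ⟨w₁, hw₁, h₁⟩ ⟨w₂, hw₂, h₂⟩
      refine ⟨w₁ + w₂, hw₁.add hw₂, fun K hK => ⟨fun p hp q hq hpq hE => ?_, fun h x hx => ?_⟩⟩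
      · obtain ⟨c₁, hc₁⟩ := (h₁ K hK).1 p hp q hq hpq hE
        obtain ⟨c₂, hc₂⟩ := (h₂ K hK).1 p hp q hq hpq hE
        refine ⟨c₁ + c₂, fun x hx => ?_⟩
        simp only [Pi.add_apply, hc₁ x hx, hc₂ x hx, add_smul, and_self]
      · simp only [Pi.add_apply, (h₁ K hK).2 h x hx, (h₂ K hK).2 h x hx, add_zero, and_self]
    · rintro c u₁ _ ⟨w₁, hw₁, h₁⟩
      refine ⟨c • w₁, hw₁.smul c, fun K hK => ⟨fun p hp q hq hpq hE => ?_, fun h x hx => ?_⟩⟩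
      · obtain ⟨c₁, hc₁⟩ := (h₁ K hK).1 p hp q hq hpq hE
        refine ⟨c * c₁, fun x hx => ?_⟩
        simp only [Pi.smul_apply, hc₁ x hx, mul_smul, and_self]
      · simp only [Pi.smul_apply, (h₁ K hK).2 h x hx, smul_zero, and_self]
  obtain ⟨w, hw, hloc⟩ := main
  refine ⟨w, hw, fun K hK => ?_⟩
  by_cases h : ∀ e ∈ K.edges, e ∉ E
  · exact Or.inl ((hloc K hK).2 h)
  · push Not at h
    obtain ⟨e, he, heE⟩ := h
    refine Or.inr ⟨hreg K hK e he heE, ?_⟩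
    obtain ⟨p, hp, q, hq, hpq, rfl⟩ := he
    exact ⟨p, hp, q, hq, hpq, (hloc K hK).1 p hp q hq hpq heE⟩

theorem exists_gradient_of_mem_vertexSpace (hΩ : IsOpen Ω) (hm : IsMesh Ω T) (hc : Conforming T)
    {N : Set E3} (hsep : ∀ K ∈ T, ∀ p ∈ K.vertices, ∀ q ∈ K.vertices, p ∈ N → q ∈ N → p = q)
    (hreg : ∀ K ∈ T, ∀ p ∈ K.vertices, p ∈ N → K.shapeRegularity ≤ ρ) {f : E3 → ℝ}
    (hf : f ∈ vertexSpace T N) : ∃ w, HasGradient Ω f w ∧ ∀ K ∈ T, IsLocalTent ρ K f w := by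
  have main : ∃ w, HasGradient Ω f w ∧ ∀ K ∈ T,
      (∀ p ∈ K.vertices, p ∈ N → ∃ c : ℝ,
        ∀ x ∈ interior K.carrier, f x = c * K.bary p x ∧ w x = c • K.baryGrad p) ∧
      ((∀ p ∈ K.vertices, p ∉ N) → ∀ x ∈ interior K.carrier, f x = 0 ∧ w x = 0) := by
    refine Submodule.span_induction (p := fun f _ => ∃ w, HasGradient Ω f w ∧ ∀ K ∈ T,
      (∀ p ∈ K.vertices, p ∈ N → ∃ c : ℝ,
        ∀ x ∈ interior K.carrier, f x = c * K.bary p x ∧ w x = c • K.baryGrad p) ∧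
      ((∀ p ∈ K.vertices, p ∉ N) → ∀ x ∈ interior K.carrier, f x = 0 ∧ w x = 0))
      ?_ ?_ ?_ ?_ hf
    · rintro _ ⟨p', hp', rfl⟩
      refine ⟨_, hasGradient_tent hΩ hm hc p', fun K hK => ?_⟩
      have hval : ∀ x ∈ interior K.carrier, tent T p' x = K.bary p' x ∧
          tentGrad T p' x = K.baryGrad p' := fun x hx =>
        ⟨tent_eq hc hK (interior_subset hx) p', tentGrad_eq hm hK hx p'⟩
      by_cases hmem : p' ∈ K.vertices
      · refine ⟨fun p hp hpN => ?_, fun h => absurd hp' (h _ hmem)⟩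
        obtain rfl := hsep K hK _ hmem _ hp hp' hpN
        exact ⟨1, fun x hx => by simpa using hval x hx⟩
      · have hzero : ∀ x ∈ interior K.carrier, tent T p' x = 0 ∧ tentGrad T p' x = 0 :=
          fun x hx => by
            rw [(hval x hx).1, (hval x hx).2]
            exact ⟨K.bary_of_notMem hmem x, K.baryGrad_of_notMem hmem⟩
        exact ⟨fun p _ _ => ⟨0, fun x hx => by simpa using hzero x hx⟩, fun _ => hzero⟩
    · exact ⟨0, HasGradient.zero Ω, fun K _ => ⟨fun p _ _ => ⟨0, fun x _ => by simp⟩,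
        fun _ x _ => by simp⟩⟩
    · rintro u₁ u₂ _ _ ⟨w₁, hw₁, h₁⟩ ⟨w₂, hw₂, h₂⟩
      refine ⟨w₁ + w₂, hw₁.add hw₂, fun K hK => ⟨fun p hp hN => ?_, fun h x hx => ?_⟩⟩
      · obtain ⟨c₁, hc₁⟩ := (h₁ K hK).1 p hp hN
        obtain ⟨c₂, hc₂⟩ := (h₂ K hK).1 p hp hN
        refine ⟨c₁ + c₂, fun x hx => ?_⟩
        simp only [Pi.add_apply, hc₁ x hx, hc₂ x hx, add_smul, add_mul, and_self]
      · simp only [Pi.add_apply, (h₁ K hK).2 h x hx, (h₂ K hK).2 h x hx, add_zero, and_self]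
    · rintro c u₁ _ ⟨w₁, hw₁, h₁⟩
      refine ⟨c • w₁, hw₁.smul c, fun K hK => ⟨fun p hp hN => ?_, fun h x hx => ?_⟩⟩
      · obtain ⟨c₁, hc₁⟩ := (h₁ K hK).1 p hp hN
        refine ⟨c * c₁, fun x hx => ?_⟩
        simp only [Pi.smul_apply, hc₁ x hx, mul_smul, smul_eq_mul, mul_assoc, and_self]
      · simp only [Pi.smul_apply, (h₁ K hK).2 h x hx, smul_zero, and_self]
  obtain ⟨w, hw, hloc⟩ := main
  refine ⟨w, hw, fun K hK => ?_⟩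
  by_cases h : ∀ p ∈ K.vertices, p ∉ N
  · exact Or.inl ((hloc K hK).2 h)
  · push Not at h
    obtain ⟨p, hp, hpN⟩ := h
    exact Or.inr ⟨hreg K hK p hp hpN, p, hp, (hloc K hK).1 p hp hpN⟩

end LocalStructure

namespace IsRefinementHierarchy

variable {Ω Γ : Set E3} {L : ℕ} {θ κ ρ : ℝ} {M Mhat : ℕ → Set Tetrahedron}

theorem exists_curl (H : IsRefinementHierarchy Ω Γ L θ κ M Mhat)
    (hρ : ∀ l ≤ L, ∀ K ∈ M l, K.shapeRegularity ≤ ρ) {P : ℕ} {ℰ : ℕ → Fin P → Set (Sym2 E3)}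
    (hE : IsEdgeColoring Γ L M Mhat ℰ) {l : ℕ} (hl : l ≤ L) {i : Fin P} {u : E3 → E3}
    (hu : u ∈ edgeSpace (Mhat l) (ℰ l i)) :
    ∃ w, HasCurl Ω u w ∧ ∀ K ∈ Mhat l, IsLocalEdgeField ρ K u w := by
  -- Each element of `Mhat l` that has an edge of the class lies in the support of a basis function,
  -- hence in the zone, hence in `M l`. Only there are separation of colours and shape regularity
  -- available, and they are needed nowhere else.
  have key : ∀ K ∈ Mhat l, ∀ e ∈ K.edges, e ∈ ℰ l i →
      K ∈ M l ∧ interior K.carrier ⊆ refinementZone M L l := by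
    rintro K hK _ ⟨p, hp, q, hq, hpq, rfl⟩ he
    have hz : s(p, q) ∈ zoneEdges Γ L M Mhat l := by
      rw [← hE.iUnion_eq l hl]
      exact Set.mem_iUnion.2 ⟨i, he⟩
    exact H.mem_of_interior_subset_closure hl hK
      ((interior_subset_tsupport_edgeBasis (H.hat_mesh l hl) hK hp hq hpq).trans (hz.2.2 p q rfl))
  refine exists_curl_of_mem_edgeSpace H.isOpen (H.hat_mesh l hl) (H.hat_conforming l hl) ?_ ?_ hu
  · intro K hK e he e' he' heE heE'
    obtain ⟨h1, h2⟩ := key K hK e he heE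
    by_contra hne
    exact hE.separates l hl K h1 h2 e he e' he' hne i ⟨heE, heE'⟩
  · exact fun K hK e he heE => hρ l hl K (key K hK e he heE).1

theorem exists_gradient (H : IsRefinementHierarchy Ω Γ L θ κ M Mhat)
    (hρ : ∀ l ≤ L, ∀ K ∈ M l, K.shapeRegularity ≤ ρ) {P : ℕ} {𝒩 : ℕ → Fin P → Set E3}
    (hN : IsVertexColoring Γ L M Mhat 𝒩) {l : ℕ} (hl : l ≤ L) {i : Fin P} {f : E3 → ℝ}
    (hf : f ∈ vertexSpace (Mhat l) (𝒩 l i)) :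
    ∃ w, HasGradient Ω f w ∧ ∀ K ∈ Mhat l, IsLocalTent ρ K f w := by
  have key : ∀ K ∈ Mhat l, ∀ p ∈ K.vertices, p ∈ 𝒩 l i →
      K ∈ M l ∧ interior K.carrier ⊆ refinementZone M L l := by
    intro K hK p hp hpN
    have hz : p ∈ zoneVertices Γ L M Mhat l := by
      rw [← hN.iUnion_eq l hl]
      exact Set.mem_iUnion.2 ⟨i, hpN⟩
    exact H.mem_of_interior_subset_closure hl hK
      ((interior_subset_tsupport_tent (H.hat_conforming l hl) hK hp).trans hz.2)
  refine exists_gradient_of_mem_vertexSpace H.isOpen (H.hat_mesh l hl) (H.hat_conforming l hl)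
    ?_ ?_ hf
  · intro K hK p hp q hq hpN hqN
    obtain ⟨h1, h2⟩ := key K hK p hp hpN
    by_contra hne
    exact hN.separates l hl K h1 h2 p hp q hq hne i ⟨hpN, hqN⟩
  · exact fun K hK p hp hpN => hρ l hl K (key K hK p hp hpN).1

end IsRefinementHierarchy

/-! ### Cutoff functions of tetrahedra -/

theorem exists_bound_deriv_smoothTransition :
    ∃ C : ℝ, 0 ≤ C ∧ ∀ s, |deriv Real.smoothTransition s| ≤ C := by
  have hcont : Continuous (deriv Real.smoothTransition) :=
    (Real.smoothTransition.contDiff (n := 1)).continuous_deriv le_rfl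
  have hsupp : HasCompactSupport (deriv Real.smoothTransition) := by
    refine HasCompactSupport.intro (isCompact_Icc (a := (0 : ℝ)) (b := 1)) fun s hs => ?_
    rw [Set.mem_Icc, not_and_or, not_le, not_le] at hs
    rcases hs with hs | hs
    · have : Real.smoothTransition =ᶠ[nhds s] fun _ => 0 := by
        filter_upwards [Iio_mem_nhds hs] with r hr
        exact Real.smoothTransition.zero_of_nonpos (le_of_lt hr)
      rw [this.deriv_eq, deriv_const]
    · have : Real.smoothTransition =ᶠ[nhds s] fun _ => 1 := by
        filter_upwards [Ioi_mem_nhds hs] with r hr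
        exact Real.smoothTransition.one_of_one_le (le_of_lt hr)
      rw [this.deriv_eq, deriv_const]
  obtain ⟨C, hC⟩ := hsupp.exists_bound_of_continuous hcont
  exact ⟨C, (norm_nonneg _).trans (hC 0), hC⟩

/-- A bound for the derivative of the smooth step function. -/
noncomputable def stepBound : ℝ := exists_bound_deriv_smoothTransition.choose

theorem stepBound_nonneg : 0 ≤ stepBound := exists_bound_deriv_smoothTransition.choose_spec.1

theorem abs_deriv_smoothTransition_le (s : ℝ) : |deriv Real.smoothTransition s| ≤ stepBound :=
  exists_bound_deriv_smoothTransition.choose_spec.2 s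

namespace Tetrahedron

variable (K : Tetrahedron) {t : ℝ}

/-- A smooth function that is one where all barycentric coordinates are at least `2 t` and vanishes
where one of them is at most `t`. -/
noncomputable def cutoff (t : ℝ) (x : E3) : ℝ :=
  ∏ p ∈ K.vertices, Real.smoothTransition (K.bary p x / t - 1)

theorem contDiff_cutoff (t : ℝ) : ContDiff ℝ ∞ (K.cutoff t) :=
  contDiff_prod fun p _ => (Real.smoothTransition.contDiff (n := ⊤)).comp
    (((K.contDiff_bary p).div_const t).sub contDiff_const)

theorem cutoff_nonneg (t : ℝ) (x : E3) : 0 ≤ K.cutoff t x :=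
  Finset.prod_nonneg fun _ _ => Real.smoothTransition.nonneg _

theorem cutoff_le_one (t : ℝ) (x : E3) : K.cutoff t x ≤ 1 :=
  Finset.prod_le_one (fun _ _ => Real.smoothTransition.nonneg _)
    fun _ _ => Real.smoothTransition.le_one _

theorem cutoff_eq_one (ht : 0 < t) {x : E3} (hx : ∀ p ∈ K.vertices, 2 * t ≤ K.bary p x) :
    K.cutoff t x = 1 := by
  refine Finset.prod_eq_one fun p hp => Real.smoothTransition.one_of_one_le ?_
  have : 2 ≤ K.bary p x / t := (le_div_iff₀ ht).2 (hx p hp)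
  linarith

theorem tsupport_cutoff (ht : 0 < t) : tsupport (K.cutoff t) ⊆ interior K.carrier := by
  have hsub : tsupport (K.cutoff t) ⊆ {x | ∀ p ∈ K.vertices, t ≤ K.bary p x} := by
    refine closure_minimal (fun x hx p hp => ?_) ?_
    · by_contra! hlt
      refine hx (Finset.prod_eq_zero hp (Real.smoothTransition.zero_of_nonpos ?_))
      have : K.bary p x / t ≤ 1 := (div_le_one ht).2 hlt.le
      linarith
    · simp only [Set.ofPred_forall]
      exact isClosed_biInter fun p _ => isClosed_le continuous_const (K.continuous_bary p)
  intro x hx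
  exact K.mem_interior_iff.2 fun p hp => ht.trans_le (hsub hx p hp)

theorem cutoff_eq_zero (ht : 0 < t) {x : E3} (hx : x ∉ interior K.carrier) : K.cutoff t x = 0 :=
  image_eq_zero_of_notMem_tsupport fun h => hx (K.tsupport_cutoff ht h)

theorem hasCompactSupport_cutoff (ht : 0 < t) : HasCompactSupport (K.cutoff t) :=
  K.isCompact_carrier.of_isClosed_subset (isClosed_tsupport _)
    ((K.tsupport_cutoff ht).trans interior_subset)

/-- The gradient of the cutoff function. -/
noncomputable def cutoffGrad (t : ℝ) (x : E3) : E3 := gradient (K.cutoff t) x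

theorem hasFDerivAt_cutoff (t : ℝ) (x : E3) :
    HasFDerivAt (K.cutoff t) (InnerProductSpace.toDual ℝ E3 (K.cutoffGrad t x)) x :=
  ((K.contDiff_cutoff t).differentiable (by simp) x).hasGradientAt.hasFDerivAt

theorem cutoffGrad_eq_zero_of_notMem (ht : 0 < t) {x : E3} (hx : x ∉ interior K.carrier) :
    K.cutoffGrad t x = 0 := by
  have h0 : fderiv ℝ (K.cutoff t) x = 0 := image_eq_zero_of_notMem_tsupport fun h =>
    hx (K.tsupport_cutoff ht (tsupport_fderiv_subset ℝ h))
  rw [cutoffGrad, gradient, h0, map_zero]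

theorem cutoffGrad_eq_zero (ht : 0 < t) {x : E3} (hx : x ∉ K.strip (2 * t) ∩ interior K.carrier) :
    K.cutoffGrad t x = 0 := by
  by_cases hint : x ∈ interior K.carrier
  · have h1 : K.cutoff t x = 1 := by
      refine K.cutoff_eq_one ht fun p hp => ?_
      by_contra! hlt
      exact hx ⟨⟨interior_subset hint, p, hp, hlt⟩, hint⟩
    -- Where the cutoff equals 1 it is maximal, so its gradient vanishes there, including where some
    -- coordinate is exactly 2t.
    have hmax : IsLocalMax (K.cutoff t) x := .of_forall fun y => by
      rw [h1]; exact K.cutoff_le_one t y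
    rw [cutoffGrad, gradient, hmax.fderiv_eq_zero, map_zero]
  · exact K.cutoffGrad_eq_zero_of_notMem ht hint

/-- Product rule: each of the four factors has slope at most `stepBound` / t times the gradient of a
coordinate, and the other factors are at most 1. For t = δ/h the bound becomes a multiple of ρ/δ,
free of h. -/
theorem norm_cutoffGrad_le (ht : 0 < t) (x : E3) :
    ‖K.cutoffGrad t x‖ ≤ 4 * stepBound * K.shapeRegularity / (t * K.diam) := by
  classical
  have hf : ∀ p ∈ K.vertices, HasFDerivAt (fun x => Real.smoothTransition (K.bary p x / t - 1))
      (deriv Real.smoothTransition (K.bary p x / t - 1) •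
        (t⁻¹ • InnerProductSpace.toDual ℝ E3 (K.baryGrad p))) x := by
    intro p _
    have h1 : HasFDerivAt (fun x => K.bary p x / t - 1)
        (t⁻¹ • InnerProductSpace.toDual ℝ E3 (K.baryGrad p)) x := by
      simpa only [div_eq_mul_inv, mul_comm] using
        (((K.hasGradientAt_bary p x).hasFDerivAt.const_mul t⁻¹).sub_const 1)
    have h2 : HasDerivAt Real.smoothTransition _ (K.bary p x / t - 1) :=
      ((Real.smoothTransition.contDiff (n := 1)).differentiable (by simp) _).hasDerivAt
    exact h2.comp_hasFDerivAt x h1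
  have hprod := HasFDerivAt.finsetProd hf
  have heq := hprod.unique (K.hasFDerivAt_cutoff t x)
  have hd := K.diam_pos
  have hnorm : ‖K.cutoffGrad t x‖ = ‖InnerProductSpace.toDual ℝ E3 (K.cutoffGrad t x)‖ :=
    (LinearIsometryEquiv.norm_map _ _).symm
  rw [hnorm, ← heq]
  have hterm : ∀ p ∈ K.vertices, ‖(∏ q ∈ K.vertices.erase p,
      Real.smoothTransition (K.bary q x / t - 1)) •
      (deriv Real.smoothTransition (K.bary p x / t - 1) •
        (t⁻¹ • InnerProductSpace.toDual ℝ E3 (K.baryGrad p)))‖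
      ≤ stepBound * K.shapeRegularity / (t * K.diam) := by
    intro p _
    rw [norm_smul, norm_smul, norm_smul, LinearIsometryEquiv.norm_map, Real.norm_eq_abs,
      Real.norm_eq_abs, Real.norm_eq_abs, abs_of_pos (inv_pos.2 ht),
      abs_of_nonneg (Finset.prod_nonneg fun _ _ => Real.smoothTransition.nonneg _)]
    have h1 : ∏ q ∈ K.vertices.erase p, Real.smoothTransition (K.bary q x / t - 1) ≤ 1 :=
      Finset.prod_le_one (fun _ _ => Real.smoothTransition.nonneg _)
        fun _ _ => Real.smoothTransition.le_one _
    have h2 : ‖K.baryGrad p‖ ≤ K.shapeRegularity / K.diam := by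
      rw [le_div_iff₀ hd, mul_comm]
      exact K.diam_mul_baryGrad_le p
    calc _ ≤ 1 * (stepBound * (t⁻¹ * (K.shapeRegularity / K.diam))) := by
          refine mul_le_mul h1 ?_ (by positivity) zero_le_one
          refine mul_le_mul (abs_deriv_smoothTransition_le _) ?_ (by positivity) stepBound_nonneg
          exact mul_le_mul_of_nonneg_left h2 (by positivity)
      _ = _ := by field_simp
  refine (norm_sum_le _ _).trans ((Finset.sum_le_sum hterm).trans ?_)
  rw [Finset.sum_const, K.card_vertices, nsmul_eq_mul]
  push_cast
  rw [← mul_div_assoc, ← mul_assoc]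

variable {Ω : Set E3} {a : E3 → E3}

theorem isTestField_cutoff (ht : 0 < t) (hK : interior K.carrier ⊆ Ω) (ha : ContDiff ℝ ∞ a) :
    IsTestField Ω fun x => K.cutoff t x • a x :=
  ⟨(K.contDiff_cutoff t).smul ha, (K.hasCompactSupport_cutoff ht).smul_right,
    (closure_mono (Function.support_smul_subset_left (K.cutoff t) a)).trans
      ((K.tsupport_cutoff ht).trans hK)⟩

theorem fderiv_cutoff_smul (ha : ContDiff ℝ ∞ a) (x v : E3) :
    fderiv ℝ (fun x => K.cutoff t x • a x) x v
      = K.cutoff t x • fderiv ℝ a x v + inner ℝ (K.cutoffGrad t x) v • a x := by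
  have h := (K.hasFDerivAt_cutoff t x).smul (ha.differentiable (by simp) x).hasFDerivAt
  have h' := congrArg (fun L : E3 →L[ℝ] E3 => L v) h.fderiv
  refine h'.trans ?_
  simp

theorem curl_cutoff_smul_const (t : ℝ) (c x : E3) :
    curl (fun x => K.cutoff t x • c) x = cross (K.cutoffGrad t x) c := by
  have h := fun v => K.fderiv_cutoff_smul (t := t) (a := fun _ => c) contDiff_const x v
  simp only [curl, cross, h, inner_stdVec]
  simp

theorem divergence_cutoff_smul (ha : ContDiff ℝ ∞ a) (x : E3) :
    divergence (fun x => K.cutoff t x • a x) x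
      = K.cutoff t x * divergence a x + inner ℝ (K.cutoffGrad t x) (a x) := by
  rw [inner_eq_sum (K.cutoffGrad t x) (a x)]
  simp only [divergence, K.fderiv_cutoff_smul ha, inner_stdVec, Fin.sum_univ_three,
    PiLp.add_apply, PiLp.smul_apply, smul_eq_mul]
  ring

end Tetrahedron

/-! ### Estimates near the boundary of an element -/

theorem abs_integral_inner_le {F : Type*} [NormedAddCommGroup F] [InnerProductSpace ℝ F]
    {X : Type*} [MeasurableSpace X] {μ : Measure X} {f g : X → F} (hf : MemLp f 2 μ)
    (hg : MemLp g 2 μ) :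
    |∫ x, inner ℝ (f x) (g x) ∂μ| ≤ √(∫ x, ‖f x‖ ^ 2 ∂μ) * √(∫ x, ‖g x‖ ^ 2 ∂μ) := by
  have key : ∀ {f g : X → F} (hf : MemLp f 2 μ) (hg : MemLp g 2 μ),
      inner ℝ hf.toLp hg.toLp = ∫ x, inner ℝ (f x) (g x) ∂μ := by
    intro f g hf hg
    rw [L2.inner_def]
    apply integral_congr_ae
    filter_upwards [hf.coeFn_toLp, hg.coeFn_toLp] with x h1 h2
    rw [h1, h2]
  have hn : ∀ {f : X → F} (hf : MemLp f 2 μ), ‖hf.toLp‖ = √(∫ x, ‖f x‖ ^ 2 ∂μ) := by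
    intro f hf
    rw [norm_eq_sqrt_real_inner, key hf hf]
    simp only [real_inner_self_eq_norm_sq]
  rw [← key hf hg, ← hn hf, ← hn hg]
  exact abs_real_inner_le_norm _ _

/-- The `L²` norm on the interior of an element. -/
noncomputable def Tetrahedron.norm₂ (K : Tetrahedron) (u : E3 → E3) : ℝ :=
  √(∫ x in interior K.carrier, ‖u x‖ ^ 2)

section Strip

variable {Ω : Set E3} {a z : E3 → E3} {B D t : ℝ} (K : Tetrahedron)

theorem memLp_interior (hK : interior K.carrier ⊆ Ω) (hz : MemLp z 2 (volume.restrict Ω)) :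
    MemLp z 2 (volume.restrict (interior K.carrier)) :=
  hz.mono_measure (Measure.restrict_mono hK le_rfl)

theorem integral_strip_le (ht : 0 ≤ t) (hK : interior K.carrier ⊆ Ω)
    (hz : MemLp z 2 (volume.restrict Ω)) :
    ∫ x in K.strip (2 * t) ∩ interior K.carrier, ‖z x‖
      ≤ √(24 * t * volume.real K.carrier) * K.norm₂ z := by
  set S := K.strip (2 * t) ∩ interior K.carrier with hS
  have hSm : MeasurableSet S := (K.measurableSet_strip _).inter isOpen_interior.measurableSet
  have hzi := memLp_interior K hK hz
  have hzS : MemLp z 2 (volume.restrict S) :=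
    hzi.mono_measure (Measure.restrict_mono Set.inter_subset_right le_rfl)
  have hSvol : volume.real S ≤ 24 * t * volume.real K.carrier := by
    have h1 := K.volume_real_strip (s := 2 * t) (by positivity)
    have h2 : volume.real S ≤ volume.real (K.strip (2 * t)) :=
      measureReal_mono Set.inter_subset_left
        (((measure_mono (Set.sep_subset _ _)).trans_lt K.volume_carrier_lt_top).ne)
    linarith
  have hfin : IsFiniteMeasure (volume.restrict S) :=
    ⟨by
      rw [Measure.restrict_apply_univ]
      exact (measure_mono (Set.inter_subset_right.trans interior_subset)).trans_lt
        K.volume_carrier_lt_top⟩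
  have h := abs_integral_inner_le (μ := volume.restrict S) (memLp_const (1 : ℝ)) hzS.norm
  simp only [norm_one, one_pow, integral_const, norm_norm, smul_eq_mul, mul_one] at h
  have e : ∫ x in S, ‖z x‖ = ∫ x in S, inner ℝ (1 : ℝ) ‖z x‖ := by
    congr 1; ext x; simp
  rw [e]
  refine (le_abs_self _).trans (h.trans (mul_le_mul ?_ ?_ (Real.sqrt_nonneg _)
    (Real.sqrt_nonneg _)))
  · apply Real.sqrt_le_sqrt
    simpa [measureReal_def] using hSvol
  · apply Real.sqrt_le_sqrt
    exact setIntegral_mono_set (hzi.integrable_norm_pow two_ne_zero)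
      (.of_forall fun x => by positivity)
      Set.inter_subset_right.eventuallyLE

/-- A cutoff argument: integrals over an element of fields whose products with the cutoff
function can be integrated by parts are controlled near the boundary of the element. -/
theorem abs_integral_le_of_cutoff (ht : 0 < t) (hΩ : IsOpen Ω) (hK : interior K.carrier ⊆ Ω)
    (ha : Continuous a) (hB : ∀ x ∈ K.carrier, ‖a x‖ ≤ B)
    (hz : MemLp z 2 (volume.restrict Ω)) {y : E3 → ℝ} (hD : 0 ≤ D)
    (hy : ∫ x in Ω, inner ℝ (z x) (K.cutoff t x • a x) = ∫ x in Ω, y x)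
    (hyb : ∀ᵐ x ∂(volume.restrict Ω), |y x| ≤
      D * B * (K.strip (2 * t) ∩ interior K.carrier).indicator (fun x => ‖z x‖) x) :
    |∫ x in interior K.carrier, inner ℝ (a x) (z x)|
      ≤ (D + 1) * B * (√(24 * t * volume.real K.carrier) * K.norm₂ z) := by
  set S := K.strip (2 * t) ∩ interior K.carrier with hS
  have hB0 : 0 ≤ B := by
    obtain ⟨x, hx⟩ := K.nonempty_interior
    exact (norm_nonneg _).trans (hB x (interior_subset hx))
  have hSm : MeasurableSet S := (K.measurableSet_strip _).inter isOpen_interior.measurableSet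
  have hzi := memLp_interior K hK hz
  have hfinK : IsFiniteMeasure (volume.restrict (interior K.carrier)) :=
    ⟨by
      rw [Measure.restrict_apply_univ]
      exact (measure_mono interior_subset).trans_lt K.volume_carrier_lt_top⟩
  have hzint : IntegrableOn (fun x => ‖z x‖) (interior K.carrier) :=
    (hzi.integrable one_le_two).norm
  have hzS : IntegrableOn (fun x => ‖z x‖) S := hzint.mono_set Set.inter_subset_right
  have hbound := integral_strip_le K ht.le hK hz
  have hai : MemLp a 2 (volume.restrict (interior K.carrier)) :=
    MemLp.of_bound ha.aestronglyMeasurable B ((ae_restrict_iff' isOpen_interior.measurableSet).2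
      (.of_forall fun x hx => hB x (interior_subset hx)))
  have hηai : MemLp (fun x => K.cutoff t x • a x) 2 (volume.restrict (interior K.carrier)) :=
    MemLp.of_bound ((K.contDiff_cutoff t).continuous.smul ha).aestronglyMeasurable B
      ((ae_restrict_iff' isOpen_interior.measurableSet).2 (.of_forall fun x hx => by
        rw [norm_smul, Real.norm_eq_abs, abs_of_nonneg (K.cutoff_nonneg t x)]
        exact (mul_le_of_le_one_left (norm_nonneg _) (K.cutoff_le_one t x)).trans
          (hB x (interior_subset hx))))
  have i₁ := integrable_inner_of_memLp hzi hηai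
  have i₂ := integrable_inner_of_memLp hai hzi
  have e₁ : ∫ x in interior K.carrier, inner ℝ (z x) (K.cutoff t x • a x) = ∫ x in Ω, y x := by
    rw [← hy]
    refine (setIntegral_eq_of_subset_of_forall_sdiff_eq_zero hΩ.measurableSet hK ?_).symm
    intro x hx
    rw [K.cutoff_eq_zero ht hx.2, zero_smul, inner_zero_right]
  have b₁ : |∫ x in Ω, y x| ≤ D * B * ∫ x in S, ‖z x‖ := by
    rw [← Real.norm_eq_abs]
    have hi : Integrable (S.indicator fun x => ‖z x‖) (volume.restrict Ω) :=
      ((integrable_indicator_iff hSm).2 hzS).restrict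
    -- The part with the cutoff: integration by parts has replaced its integrand by y, which lives
    -- in the strip.
    refine (norm_integral_le_of_norm_le (hi.const_mul (D * B)) hyb).trans ?_
    rw [integral_const_mul, setIntegral_indicator hSm,
      Set.inter_eq_right.2 (Set.inter_subset_right.trans hK)]
  -- The remaining part has the weight 1 - η, which vanishes off the strip. It accounts for the 1 in
  -- D + 1.
  have b₂ : |∫ x in interior K.carrier,
      (inner ℝ (a x) (z x) - inner ℝ (z x) (K.cutoff t x • a x))| ≤ B * ∫ x in S, ‖z x‖ := by
    rw [← Real.norm_eq_abs]
    have hi : Integrable (S.indicator fun x => ‖z x‖) (volume.restrict (interior K.carrier)) :=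
      ((integrable_indicator_iff hSm).2 hzS).restrict
    refine (norm_integral_le_of_norm_le (hi.const_mul B) ?_).trans ?_
    · refine (ae_restrict_iff' isOpen_interior.measurableSet).2 (.of_forall fun x hx => ?_)
      have e : inner ℝ (a x) (z x) - inner ℝ (z x) (K.cutoff t x • a x)
          = (1 - K.cutoff t x) * inner ℝ (a x) (z x) := by
        rw [real_inner_smul_right, real_inner_comm (a x) (z x)]; ring
      rw [e, norm_mul, Real.norm_eq_abs, Real.norm_eq_abs,
        abs_of_nonneg (sub_nonneg.2 (K.cutoff_le_one t x))]
      by_cases hxS : x ∈ S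
      · rw [Set.indicator_of_mem hxS]
        have h1 := abs_real_inner_le_norm (a x) (z x)
        have h2 := mul_le_mul_of_nonneg_right (hB x (interior_subset hx)) (norm_nonneg (z x))
        have h3 := K.cutoff_nonneg t x
        refine (mul_le_of_le_one_left (abs_nonneg _) (by linarith)).trans (h1.trans h2)
      · rw [Set.indicator_of_notMem hxS, K.cutoff_eq_one ht]
        · simp
        · intro p hp
          by_contra! hlt
          exact hxS ⟨⟨interior_subset hx, p, hp, hlt⟩, hx⟩
    · rw [integral_const_mul, setIntegral_indicator hSm, Set.inter_eq_right.2
        Set.inter_subset_right]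
  rw [integral_sub i₂ i₁, e₁] at b₂
  have h3 : |∫ x in interior K.carrier, inner ℝ (a x) (z x)| ≤ (D + 1) * B * ∫ x in S, ‖z x‖ := by
    rw [abs_le] at *
    constructor <;> nlinarith
  exact h3.trans (mul_le_mul_of_nonneg_left hbound (by positivity))

end Strip

/-! ### Pairing a smooth field on one coarse element with a fine curl or gradient -/

section Local

variable {Ω : Set E3} {ρ δ A B : ℝ} {K : Tetrahedron}

/-- Testing the weak curl with ηc leaves v · (∇η × c). The cutoff width t = δ/h is chosen so that
|∇η|, of order ρ/δ, is compensated by |v| ≤ Aδ|w|. -/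
theorem abs_integral_const_curl_le (hΩ : IsOpen Ω) (hK : interior K.carrier ⊆ Ω) (hδ : 0 < δ)
    (hA : 0 ≤ A) (hρ : K.shapeRegularity ≤ ρ) {v w : E3 → E3} (hvw : IsWeakCurl Ω v w)
    (hle : ∀ᵐ x ∂(volume.restrict Ω), ‖v x‖ ≤ A * δ * ‖w x‖) (c : E3) :
    |∫ x in interior K.carrier, inner ℝ c (w x)| ≤ (4 * stepBound * ρ * A + 1) * ‖c‖ *
      (√(24 * (δ / K.diam) * volume.real K.carrier) * K.norm₂ w) := by
  have hd := K.diam_pos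
  have ht : 0 < δ / K.diam := div_pos hδ hd
  have hρ0 : 0 ≤ ρ := K.shapeRegularity_pos.le.trans hρ
  have hs := stepBound_nonneg
  refine abs_integral_le_of_cutoff K (a := fun _ => c) ht hΩ hK continuous_const (fun _ _ => le_rfl)
    hvw.1 (by positivity)
    (y := fun x => inner ℝ (v x) (curl (fun x => K.cutoff (δ / K.diam) x • c) x)) ?_ ?_
  · exact (hvw.2 _ (K.isTestField_cutoff ht hK contDiff_const)).symm
  · filter_upwards [hle] with x hx
    rw [K.curl_cutoff_smul_const]
    by_cases hxS : x ∈ K.strip (2 * (δ / K.diam)) ∩ interior K.carrier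
    · rw [Set.indicator_of_mem hxS]
      have h1 := K.norm_cutoffGrad_le ht x
      rw [div_mul_cancel₀ _ hd.ne'] at h1
      have h2 : ‖K.cutoffGrad (δ / K.diam) x‖ ≤ 4 * stepBound * ρ / δ := by
        refine h1.trans ?_
        gcongr
      calc |inner ℝ (v x) (cross (K.cutoffGrad (δ / K.diam) x) c)|
          ≤ ‖v x‖ * (‖K.cutoffGrad (δ / K.diam) x‖ * ‖c‖) :=
            (abs_real_inner_le_norm _ _).trans
              (mul_le_mul_of_nonneg_left (norm_cross_le _ _) (norm_nonneg _))
        _ ≤ (A * δ * ‖w x‖) * (4 * stepBound * ρ / δ * ‖c‖) := by gcongr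
        _ = _ := by field_simp
    · rw [Set.indicator_of_notMem hxS, K.cutoffGrad_eq_zero ht hxS, cross_zero_left]
      simp

/-- Since a is divergence free, testing the weak gradient with ηa leaves only f∇η·a, and |f| ≤ δ|v|
compensates the factor 1/δ in |∇η|. -/
theorem abs_integral_divFree_gradient_le (hΩ : IsOpen Ω) (hK : interior K.carrier ⊆ Ω)
    (hδ : 0 < δ) (hρ : K.shapeRegularity ≤ ρ) {f : E3 → ℝ} {v : E3 → E3}
    (hfv : IsWeakGradient Ω f v) (hle : ∀ᵐ x ∂(volume.restrict Ω), |f x| ≤ δ * ‖v x‖)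
    {a : E3 → E3} (ha : ContDiff ℝ ∞ a) (hdiv : ∀ x, divergence a x = 0)
    (hB : ∀ x ∈ K.carrier, ‖a x‖ ≤ B) :
    |∫ x in interior K.carrier, inner ℝ (a x) (v x)| ≤ (4 * stepBound * ρ + 1) * B *
      (√(24 * (δ / K.diam) * volume.real K.carrier) * K.norm₂ v) := by
  have hd := K.diam_pos
  have ht : 0 < δ / K.diam := div_pos hδ hd
  have hρ0 : 0 ≤ ρ := K.shapeRegularity_pos.le.trans hρ
  have hs := stepBound_nonneg
  refine abs_integral_le_of_cutoff K ht hΩ hK ha.continuous hB hfv.1 (by positivity)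
    (y := fun x => -(f x * divergence (fun x => K.cutoff (δ / K.diam) x • a x) x)) ?_ ?_
  · rw [integral_neg, hfv.2 _ (K.isTestField_cutoff ht hK ha), neg_neg]
  · filter_upwards [hle] with x hx
    rw [K.divergence_cutoff_smul ha, hdiv, mul_zero, zero_add]
    by_cases hxS : x ∈ K.strip (2 * (δ / K.diam)) ∩ interior K.carrier
    · rw [Set.indicator_of_mem hxS]
      have h1 := K.norm_cutoffGrad_le ht x
      rw [div_mul_cancel₀ _ hd.ne'] at h1
      have h2 : ‖K.cutoffGrad (δ / K.diam) x‖ ≤ 4 * stepBound * ρ / δ := by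
        refine h1.trans ?_
        gcongr
      have h3 := hB x hxS.1.1
      rw [abs_neg, abs_mul]
      calc |f x| * |inner ℝ (K.cutoffGrad (δ / K.diam) x) (a x)|
          ≤ (δ * ‖v x‖) * (4 * stepBound * ρ / δ * B) := by
            refine mul_le_mul hx ((abs_real_inner_le_norm _ _).trans ?_) (abs_nonneg _)
              (by positivity)
            exact mul_le_mul h2 h3 (norm_nonneg _) (by positivity)
        _ = _ := by field_simp
    · rw [Set.indicator_of_notMem hxS, K.cutoffGrad_eq_zero ht hxS]
      simp

end Local

/-- The field `u` vanishes on `K`, or it is there a smooth divergence free field whose maximum is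
controlled by its mean square, `K` being shape regular. -/
def IsLocalDivFree (ρ A : ℝ) (K : Tetrahedron) (u : E3 → E3) : Prop :=
  (∀ᵐ x ∂(volume.restrict (interior K.carrier)), u x = 0) ∨
    (K.shapeRegularity ≤ ρ ∧ ∃ a : E3 → E3, ContDiff ℝ ∞ a ∧ (∀ x, divergence a x = 0) ∧
      (∀ᵐ x ∂(volume.restrict (interior K.carrier)), u x = a x) ∧
      ∃ B, (∀ x ∈ K.carrier, ‖a x‖ ≤ B) ∧ B * √(volume.real K.carrier) ≤ A * K.norm₂ u)

section LocalFields

variable {ρ A : ℝ} {K : Tetrahedron} {u w : E3 → E3}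

theorem Tetrahedron.norm₂_congr (h : ∀ᵐ x ∂(volume.restrict (interior K.carrier)), u x = w x) :
    K.norm₂ u = K.norm₂ w := by
  rw [Tetrahedron.norm₂, Tetrahedron.norm₂]
  congr 1
  apply integral_congr_ae
  filter_upwards [h] with x hx
  rw [hx]

theorem Tetrahedron.volume_real_interior (K : Tetrahedron) :
    volume.real (interior K.carrier) = volume.real K.carrier :=
  measureReal_congr K.interior_ae_eq

theorem Tetrahedron.norm₂_const (K : Tetrahedron) (c : E3) :
    K.norm₂ (fun _ => c) = ‖c‖ * √(volume.real K.carrier) := by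
  rw [Tetrahedron.norm₂, setIntegral_const, K.volume_real_interior, smul_eq_mul, mul_comm,
    Real.sqrt_mul (by positivity), Real.sqrt_sq (norm_nonneg c)]

theorem divergence_const (c x : E3) : divergence (fun _ => c) x = 0 := by
  simp [divergence]

theorem isLocalDivFree_of_const (hρ : K.shapeRegularity ≤ ρ) (hA : 1 ≤ A) {c : E3}
    (h : ∀ᵐ x ∂(volume.restrict (interior K.carrier)), u x = c) : IsLocalDivFree ρ A K u := by
  refine Or.inr ⟨hρ, fun _ => c, contDiff_const, divergence_const c, h, ‖c‖, fun _ _ => le_rfl, ?_⟩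
  rw [Tetrahedron.norm₂_congr h, K.norm₂_const]
  exact le_mul_of_one_le_left (by positivity) hA

theorem ae_interior {P : E3 → Prop} (h : ∀ x ∈ interior K.carrier, P x) :
    ∀ᵐ x ∂(volume.restrict (interior K.carrier)), P x :=
  (ae_restrict_iff' isOpen_interior.measurableSet).2 (.of_forall h)

theorem IsLocalEdgeField.isLocalDivFree (h : IsLocalEdgeField ρ K u w) (hA : 12 * ρ ≤ A) :
    IsLocalDivFree ρ A K u := by
  rcases h with h | ⟨hρ, p, hp, q, hq, hpq, c, h⟩
  · exact Or.inl (ae_interior fun x hx => (h x hx).1)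
  have hd := K.diam_pos
  have hρ0 : 0 ≤ ρ := K.shapeRegularity_pos.le.trans hρ
  have hae := ae_interior fun x hx => (h x hx).1
  refine Or.inr ⟨hρ, fun x => c • K.edgeField p q x, (K.contDiff_edgeField p q).const_smul c,
    fun x => ?_, hae, |c| * (2 * ρ / K.diam), fun x hx => ?_, ?_⟩
  · have hdiff := (K.contDiff_edgeField p q).differentiable (by simp) x
    have hfd : fderiv ℝ (fun x => c • K.edgeField p q x) x = c • fderiv ℝ (K.edgeField p q) x :=
      fderiv_fun_const_smul hdiff c
    have h0 := K.divergence_edgeField p q x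
    rw [divergence] at h0 ⊢
    simp only [hfd, smul_apply, PiLp.smul_apply, smul_eq_mul, ← Finset.mul_sum, h0, mul_zero]
  · rw [norm_smul, Real.norm_eq_abs]
    refine mul_le_mul_of_nonneg_left ?_ (abs_nonneg c)
    rw [le_div_iff₀ hd, mul_comm]
    exact (K.norm_edgeField_le hx p q).trans (by linarith)
  · have hlow := Real.sqrt_le_sqrt (K.integral_edgeField_lower hp hq hpq)
    -- √32 ≤ 6; together with the maximum 2ρ/h of the edge field this gives the inverse estimate
    -- with constant 12ρ.
    have h32 : √(32 * K.diam ^ 2 * ∫ x in interior K.carrier, ‖K.edgeField p q x‖ ^ 2)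
        ≤ 6 * K.diam * K.norm₂ (K.edgeField p q) := by
      rw [Tetrahedron.norm₂, Real.sqrt_le_left (by positivity), mul_pow, mul_pow,
        Real.sq_sqrt (integral_nonneg fun x => by positivity)]
      refine mul_le_mul_of_nonneg_right ?_ (integral_nonneg fun x => by positivity)
      nlinarith [sq_nonneg K.diam]
    have hnorm : K.norm₂ u = |c| * K.norm₂ (K.edgeField p q) := by
      rw [Tetrahedron.norm₂_congr hae, Tetrahedron.norm₂, Tetrahedron.norm₂]
      simp only [norm_smul, mul_pow, integral_const_mul]
      rw [Real.sqrt_mul (by positivity), Real.sqrt_sq (norm_nonneg c), Real.norm_eq_abs]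
    rw [hnorm]
    have hN : 0 ≤ K.norm₂ (K.edgeField p q) := Real.sqrt_nonneg _
    calc |c| * (2 * ρ / K.diam) * √(volume.real K.carrier)
        ≤ |c| * (2 * ρ / K.diam) * (6 * K.diam * K.norm₂ (K.edgeField p q)) :=
          mul_le_mul_of_nonneg_left (hlow.trans h32) (by positivity)
      _ = 12 * ρ * (|c| * K.norm₂ (K.edgeField p q)) := by field_simp; ring
      _ ≤ A * (|c| * K.norm₂ (K.edgeField p q)) :=
          mul_le_mul_of_nonneg_right hA (by positivity)

theorem IsLocalTent.isLocalDivFree {f : E3 → ℝ} (h : IsLocalTent ρ K f w) (hA : 1 ≤ A)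
    (hu : ∀ᵐ x ∂(volume.restrict (interior K.carrier)), u x = w x) :
    IsLocalDivFree ρ A K u := by
  rcases h with h | ⟨hρ, p, hp, c, h⟩
  · refine Or.inl ?_
    filter_upwards [hu, ae_interior fun x hx => (h x hx).2] with x h1 h2
    rw [h1, h2]
  · apply isLocalDivFree_of_const hρ hA (c := c • K.baryGrad p)
    filter_upwards [hu, ae_interior fun x hx => (h x hx).2] with x h1 h2
    rw [h1, h2]

theorem IsLocalEdgeField.norm_le {δ : ℝ} (h : IsLocalEdgeField ρ K u w) (hδ : K.diam ≤ δ) {x : E3}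
    (hx : x ∈ interior K.carrier) (hρR : ρ ≤ A) : ‖u x‖ ≤ A * δ * ‖w x‖ := by
  rcases h with h | ⟨hρ, p, hp, q, hq, hpq, c, h⟩
  · rw [(h x hx).1, (h x hx).2]; simp
  · rw [(h x hx).1, (h x hx).2, norm_smul, norm_smul]
    have hd := K.diam_pos
    have hs := K.shapeRegularity_pos
    have h1 := K.norm_edgeField_le_curl hp hq hpq (interior_subset hx)
    have h2 : K.shapeRegularity * K.diam ≤ A * δ :=
      mul_le_mul (hρ.trans hρR) hδ hd.le (by linarith)
    calc ‖c‖ * ‖K.edgeField p q x‖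
        ≤ ‖c‖ * (A * δ * ‖K.edgeFieldCurl p q‖) :=
          mul_le_mul_of_nonneg_left
            (h1.trans (mul_le_mul_of_nonneg_right h2 (norm_nonneg _))) (norm_nonneg _)
      _ = _ := by ring

theorem IsLocalTent.abs_le {f : E3 → ℝ} {δ : ℝ} (h : IsLocalTent ρ K f w) (hδ : K.diam ≤ δ) {x : E3}
    (hx : x ∈ interior K.carrier) : |f x| ≤ δ * ‖w x‖ := by
  rcases h with h | ⟨hρ, p, hp, c, h⟩
  · rw [(h x hx).1, (h x hx).2]; simp
  · rw [(h x hx).1, (h x hx).2, norm_smul, abs_mul, Real.norm_eq_abs,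
      abs_of_nonneg (K.bary_nonneg (interior_subset hx) p)]
    have h1 := K.bary_le_one (interior_subset hx) p
    have h2 := K.baryGrad_lower hp
    have h3 : K.diam * ‖K.baryGrad p‖ ≤ δ * ‖K.baryGrad p‖ :=
      mul_le_mul_of_nonneg_right hδ (norm_nonneg _)
    calc |c| * K.bary p x ≤ |c| * (δ * ‖K.baryGrad p‖) :=
          mul_le_mul_of_nonneg_left (by linarith) (abs_nonneg c)
      _ = _ := by ring

end LocalFields

section LocalProducts

variable {Ω : Set E3} {ρ δ A s : ℝ} {K : Tetrahedron}

/-- √24 ≤ 5. The square root of the strip width is what becomes the decay rate. -/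
theorem sqrt_strip_le (hs : 0 ≤ s) (h : δ / K.diam ≤ s ^ 2) :
    √(24 * (δ / K.diam) * volume.real K.carrier) ≤ 5 * s * √(volume.real K.carrier) := by
  rw [Real.sqrt_le_left (by positivity), mul_pow, mul_pow,
    Real.sq_sqrt measureReal_nonneg]
  refine mul_le_mul_of_nonneg_right ?_ measureReal_nonneg
  nlinarith [sq_nonneg s]

theorem IsLocalEdgeField.abs_integral_curl_le (hΩ : IsOpen Ω) (hK : interior K.carrier ⊆ Ω)
    (hδ : 0 < δ) (hA : 0 ≤ A) (hρ0 : 0 ≤ ρ) (hs : 0 ≤ s) (hsδ : δ / K.diam ≤ s ^ 2) {v w : E3 → E3}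
    (hvw : IsWeakCurl Ω v w) (hle : ∀ᵐ x ∂(volume.restrict Ω), ‖v x‖ ≤ A * δ * ‖w x‖)
    {u wu : E3 → E3} (hu : IsLocalEdgeField ρ K u wu) :
    |∫ x in interior K.carrier, inner ℝ (wu x) (w x)|
      ≤ (4 * stepBound * ρ * A + 1) * (5 * s) * K.norm₂ wu * K.norm₂ w := by
  have hst := stepBound_nonneg
  have hN : 0 ≤ K.norm₂ wu := Real.sqrt_nonneg _
  have hN' : 0 ≤ K.norm₂ w := Real.sqrt_nonneg _
  rcases hu with h | ⟨hρ, p, hp, q, hq, hpq, c, h⟩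
  · have : ∫ x in interior K.carrier, inner ℝ (wu x) (w x) = 0 := by
      refine integral_eq_zero_of_ae ?_
      filter_upwards [ae_interior fun x hx => (h x hx).2] with x hx
      rw [hx, inner_zero_left, Pi.zero_apply]
    rw [this, abs_zero]
    positivity
  · have hae := ae_interior fun x hx => (h x hx).2
    have h1 := abs_integral_const_curl_le hΩ hK hδ hA hρ hvw hle (c • K.edgeFieldCurl p q)
    have e : ∫ x in interior K.carrier, inner ℝ (wu x) (w x)
        = ∫ x in interior K.carrier, inner ℝ (c • K.edgeFieldCurl p q) (w x) := by
      apply integral_congr_ae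
      filter_upwards [hae] with x hx
      rw [hx]
    -- For a constant curl, |c||K|^{1/2} equals the L² norm, so no inverse estimate is needed here.
    rw [e, Tetrahedron.norm₂_congr hae, K.norm₂_const]
    refine h1.trans ?_
    have h2 := mul_le_mul_of_nonneg_right (sqrt_strip_le (K := K) hs hsδ) hN'
    calc _ ≤ (4 * stepBound * ρ * A + 1) * ‖c • K.edgeFieldCurl p q‖ *
          (5 * s * √(volume.real K.carrier) * K.norm₂ w) :=
          mul_le_mul_of_nonneg_left h2 (by positivity)
      _ = _ := by ring

theorem IsLocalDivFree.abs_integral_gradient_le (hΩ : IsOpen Ω) (hK : interior K.carrier ⊆ Ω)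
    (hδ : 0 < δ) (hA : 0 ≤ A) (hρ0 : 0 ≤ ρ) (hs : 0 ≤ s) (hsδ : δ / K.diam ≤ s ^ 2)
    {f : E3 → ℝ} {v : E3 → E3}
    (hfv : IsWeakGradient Ω f v) (hle : ∀ᵐ x ∂(volume.restrict Ω), |f x| ≤ δ * ‖v x‖)
    {u : E3 → E3} (hu : IsLocalDivFree ρ A K u) :
    |∫ x in interior K.carrier, inner ℝ (u x) (v x)|
      ≤ (4 * stepBound * ρ + 1) * A * (5 * s) * K.norm₂ u * K.norm₂ v := by
  have hst := stepBound_nonneg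
  have hN : 0 ≤ K.norm₂ u := Real.sqrt_nonneg _
  have hN' : 0 ≤ K.norm₂ v := Real.sqrt_nonneg _
  rcases hu with h | ⟨hρ, a, ha, hdiv, hae, B, hB, hBA⟩
  · have : ∫ x in interior K.carrier, inner ℝ (u x) (v x) = 0 := by
      refine integral_eq_zero_of_ae ?_
      filter_upwards [h] with x hx
      rw [hx, inner_zero_left, Pi.zero_apply]
    rw [this, abs_zero]
    positivity
  · have h1 := abs_integral_divFree_gradient_le hΩ hK hδ hρ hfv hle ha hdiv hB
    have hB0 : 0 ≤ B := by
      obtain ⟨x, hx⟩ := K.nonempty_interior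
      exact (norm_nonneg _).trans (hB x (interior_subset hx))
    have e : ∫ x in interior K.carrier, inner ℝ (u x) (v x)
        = ∫ x in interior K.carrier, inner ℝ (a x) (v x) := by
      apply integral_congr_ae
      filter_upwards [hae] with x hx
      rw [hx]
    rw [e]
    refine h1.trans ?_
    have h2 := mul_le_mul_of_nonneg_right (sqrt_strip_le (K := K) hs hsδ) hN'
    calc _ ≤ (4 * stepBound * ρ + 1) * B * (5 * s * √(volume.real K.carrier) * K.norm₂ v) :=
          mul_le_mul_of_nonneg_left h2 (by positivity)
      _ = (4 * stepBound * ρ + 1) * (5 * s) * K.norm₂ v * (B * √(volume.real K.carrier)) := by ring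
      _ ≤ (4 * stepBound * ρ + 1) * (5 * s) * K.norm₂ v * (A * K.norm₂ u) :=
          mul_le_mul_of_nonneg_left hBA (by positivity)
      _ = _ := by ring

end LocalProducts

/-! ### Summation over the elements of the coarse mesh -/

section Summation

variable {Ω : Set E3} {T : Set Tetrahedron}

theorem IsMesh.setIntegral_eq_sum (hm : IsMesh Ω T)
    (hreg : interior (closure Ω) = Ω) {F : E3 → ℝ} (hF : IntegrableOn F Ω) :
    ∫ x in Ω, F x = ∑ K ∈ hm.finite.toFinset, ∫ x in interior K.carrier, F x := by
  have hsub : ∀ K ∈ hm.finite.toFinset, interior K.carrier ⊆ Ω := fun K hK =>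
    hm.interior_subset_domain hreg (hm.finite.mem_toFinset.1 hK)
  rw [← integral_biUnion_finset _ (fun K _ => isOpen_interior.measurableSet) ?_
    fun K hK => hF.mono_set (hsub K hK)]
  · apply setIntegral_congr_set
    refine Filter.EventuallyLE.antisymm ?_ (Set.iUnion₂_subset hsub).eventuallyLE
    filter_upwards [hm.ae_mem_interior] with x hx hxΩ
    obtain ⟨K, hK, hxK⟩ := hx hxΩ
    exact Set.mem_biUnion (hm.finite.mem_toFinset.2 hK) hxK
  · intro K hK K' hK' hne
    exact hm.disjoint K (hm.finite.mem_toFinset.1 hK) K' (hm.finite.mem_toFinset.1 hK') hne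

theorem IsMesh.sum_norm₂_sq (hm : IsMesh Ω T)
    (hreg : interior (closure Ω) = Ω) {u : E3 → E3} (hu : MemLp u 2 (volume.restrict Ω)) :
    ∑ K ∈ hm.finite.toFinset, K.norm₂ u ^ 2 = ∫ x in Ω, ‖u x‖ ^ 2 := by
  rw [hm.setIntegral_eq_sum hreg (hu.integrable_norm_pow two_ne_zero)]
  exact Finset.sum_congr rfl fun K _ =>
    Real.sq_sqrt (integral_nonneg fun x => by positivity)

theorem IsMesh.abs_integral_le (hm : IsMesh Ω T)
    (hreg : interior (closure Ω) = Ω) {u v : E3 → E3} (hu : MemLp u 2 (volume.restrict Ω))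
    (hv : MemLp v 2 (volume.restrict Ω)) {Q : ℝ} (hQ : 0 ≤ Q)
    (h : ∀ K ∈ T, |∫ x in interior K.carrier, inner ℝ (u x) (v x)|
      ≤ Q * K.norm₂ u * K.norm₂ v) :
    |∫ x in Ω, inner ℝ (u x) (v x)| ≤ Q * √(∫ x in Ω, ‖u x‖ ^ 2) * √(∫ x in Ω, ‖v x‖ ^ 2) := by
  rw [hm.setIntegral_eq_sum hreg (integrable_inner_of_memLp hu hv),
    ← hm.sum_norm₂_sq hreg hu, ← hm.sum_norm₂_sq hreg hv]
  refine (Finset.abs_sum_le_sum_abs _ _).trans ?_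
  refine (Finset.sum_le_sum fun K hK => h K (hm.finite.mem_toFinset.1 hK)).trans ?_
  simp only [mul_assoc, ← Finset.mul_sum]
  exact mul_le_mul_of_nonneg_left (Real.sum_mul_le_sqrt_mul_sqrt _ _ _) hQ

end Summation

/-! ### The strengthened Cauchy–Schwarz inequality -/

theorem energyForm_comm (Ω : Set E3) (u v : E3 → E3) : energyForm Ω u v = energyForm Ω v u := by
  simp only [energyForm, real_inner_comm]

/-- The `L²` norm on the domain. -/
noncomputable def normL2 (Ω : Set E3) (u : E3 → E3) : ℝ := √(∫ x in Ω, ‖u x‖ ^ 2)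

theorem normL2_nonneg (Ω : Set E3) (u : E3 → E3) : 0 ≤ normL2 Ω u := Real.sqrt_nonneg _

namespace HasCurl

variable {Ω : Set E3} {u w : E3 → E3}

theorem energyNorm_eq (hΩ : IsOpen Ω) (h : HasCurl Ω u w) :
    energyNorm Ω u = √((∫ x in Ω, ‖w x‖ ^ 2) + ∫ x in Ω, ‖u x‖ ^ 2) := by
  rw [energyNorm, h.energyForm_eq hΩ h]
  simp only [real_inner_self_eq_norm_sq]

theorem normL2_le (hΩ : IsOpen Ω) (h : HasCurl Ω u w) : normL2 Ω u ≤ energyNorm Ω u := by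
  rw [h.energyNorm_eq hΩ]
  exact Real.sqrt_le_sqrt (le_add_of_nonneg_left (integral_nonneg fun x => by positivity))

theorem normL2_curl_le (hΩ : IsOpen Ω) (h : HasCurl Ω u w) : normL2 Ω w ≤ energyNorm Ω u := by
  rw [h.energyNorm_eq hΩ]
  exact Real.sqrt_le_sqrt (le_add_of_nonneg_right (integral_nonneg fun x => by positivity))

end HasCurl

theorem normL2_le_mul {Ω : Set E3} {u w : E3 → E3} {B : ℝ} (hB : 0 ≤ B)
    (hw : MemLp w 2 (volume.restrict Ω))
    (h : ∀ᵐ x ∂(volume.restrict Ω), ‖u x‖ ≤ B * ‖w x‖) : normL2 Ω u ≤ B * normL2 Ω w := by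
  have h1 : ∫ x in Ω, ‖u x‖ ^ 2 ≤ ∫ x in Ω, B ^ 2 * ‖w x‖ ^ 2 := by
    refine integral_mono_of_nonneg (.of_forall fun x => by positivity)
      ((hw.integrable_norm_pow two_ne_zero).const_mul _) ?_
    filter_upwards [h] with x hx
    rw [← mul_pow]
    exact pow_le_pow_left₀ (norm_nonneg _) hx 2
  rw [integral_const_mul] at h1
  refine (Real.sqrt_le_sqrt h1).trans ?_
  rw [Real.sqrt_mul (by positivity), Real.sqrt_sq hB, normL2]

namespace IsRefinementHierarchy

variable {Ω Γ : Set E3} {L : ℕ} {θ κ R : ℝ} {M Mhat : ℕ → Set Tetrahedron}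
  {PN PE : ℕ} {𝒩 : ℕ → Fin PN → Set E3} {ℰ : ℕ → Fin PE → Set (Sym2 E3)}

theorem ae_mem_interior_hat (H : IsRefinementHierarchy Ω Γ L θ κ M Mhat) {l : ℕ} (hl : l ≤ L) :
    ∀ᵐ x ∂(volume.restrict Ω), ∃ K ∈ Mhat l, x ∈ interior K.carrier :=
  (H.hat_mesh l hl).ae_restrict_mem_interior H.isOpen

theorem interior_subset_domain (H : IsRefinementHierarchy Ω Γ L θ κ M Mhat) {l : ℕ} (hl : l ≤ L)
    {K : Tetrahedron} (hK : K ∈ Mhat l) : interior K.carrier ⊆ Ω :=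
  (H.hat_mesh l hl).interior_subset_domain H.regular hK

/-- What is needed from the coarser function: divergence freeness with an inverse estimate, for
pairing with gradients, and an elementwise constant curl or none at all, for pairing with curls. A
given weak gradient agrees with the elementwise one only almost everywhere. -/
theorem component_coarse (H : IsRefinementHierarchy Ω Γ L θ κ M Mhat)
    (hR : ∀ l ≤ L, ∀ K ∈ M l, K.shapeRegularity ≤ R) (hR1 : 1 ≤ R)
    (hN : IsVertexColoring Γ L M Mhat 𝒩) (hE : IsEdgeColoring Γ L M Mhat ℰ) {l : ℕ} (hl : l ≤ L)
    {u : E3 → E3} (hu : IsComponent Ω Mhat 𝒩 ℰ l u) :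
    ∃ w, HasCurl Ω u w ∧ (∀ K ∈ Mhat l, IsLocalDivFree R (12 * R) K u) ∧
      ((∀ K ∈ Mhat l, IsLocalEdgeField R K u w) ∨ w = 0) := by
  rcases hu with ⟨i, hu⟩ | ⟨i, f, hf, hfu⟩
  · obtain ⟨w, hw, hloc⟩ := H.exists_curl hR hE hl hu
    exact ⟨w, hw, fun K hK => (hloc K hK).isLocalDivFree le_rfl, Or.inl hloc⟩
  · obtain ⟨g, hg, hloc⟩ := H.exists_gradient hR hN hl hf
    refine ⟨0, hfu.hasCurl, fun K hK => (hloc K hK).isLocalDivFree (by linarith) ?_, Or.inr rfl⟩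
    exact ae_restrict_of_ae_restrict_of_subset (H.interior_subset_domain hl hK)
      (hfu.ae_eq H.isOpen hg.isWeakGradient)

/-- What is needed from the finer function: it, or its potential, is pointwise smaller than its
derivative by the factor h, and h ≤ κθ^m on `Mhat m`. -/
theorem component_fine (H : IsRefinementHierarchy Ω Γ L θ κ M Mhat)
    (hR : ∀ l ≤ L, ∀ K ∈ M l, K.shapeRegularity ≤ R)
    (hN : IsVertexColoring Γ L M Mhat 𝒩) (hE : IsEdgeColoring Γ L M Mhat ℰ) {m : ℕ} (hm : m ≤ L)
    {v : E3 → E3} (hv : IsComponent Ω Mhat 𝒩 ℰ m v) :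
    (∃ w, HasCurl Ω v w ∧ ∀ᵐ x ∂(volume.restrict Ω), ‖v x‖ ≤ R * (κ * θ ^ m) * ‖w x‖) ∨
      (HasCurl Ω v 0 ∧ ∃ f, IsWeakGradient Ω f v ∧
        ∀ᵐ x ∂(volume.restrict Ω), |f x| ≤ κ * θ ^ m * ‖v x‖) := by
  rcases hv with ⟨i, hv⟩ | ⟨i, f, hf, hfv⟩
  · obtain ⟨w, hw, hloc⟩ := H.exists_curl hR hE hm hv
    refine Or.inl ⟨w, hw, ?_⟩
    filter_upwards [H.ae_mem_interior_hat hm] with x ⟨K, hK, hx⟩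
    exact (hloc K hK).norm_le (H.quasiUniform m hm K hK).2 hx le_rfl
  · obtain ⟨g, hg, hloc⟩ := H.exists_gradient hR hN hm hf
    refine Or.inr ⟨hfv.hasCurl, f, hfv, ?_⟩
    filter_upwards [H.ae_mem_interior_hat hm, hfv.ae_eq H.isOpen hg.isWeakGradient]
      with x ⟨K, hK, hx⟩ hxg
    rw [hxg]
    exact (hloc K hK).abs_le (H.quasiUniform m hm K hK).2 hx

/-- The lower bound h ≥ κ⁻¹θ^l on the coarse mesh enters here. The ratio carries κ², and its square
root explains the single κ and the exponent (m - l)/2 of the theorem. -/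
theorem mesh_ratio_le (H : IsRefinementHierarchy Ω Γ L θ κ M Mhat) {l m : ℕ}
    (hl : l ≤ L) {K : Tetrahedron} (hK : K ∈ Mhat l) :
    κ * θ ^ m / K.diam ≤ (κ * θ ^ (((m : ℝ) - l) / 2)) ^ 2 := by
  have hκ := H.κ_pos
  have hθ := H.θ_pos
  have h1 := (H.quasiUniform l hl K hK).1
  have e : (θ ^ (((m : ℝ) - l) / 2)) ^ 2 * θ ^ l = θ ^ m := by
    rw [← Real.rpow_natCast (θ ^ _) 2, ← Real.rpow_mul hθ.le, ← Real.rpow_natCast θ l,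
      ← Real.rpow_add hθ, ← Real.rpow_natCast θ m]
    congr 1
    push_cast
    ring
  rw [div_le_iff₀ K.diam_pos, ← e]
  have h2 : (κ * θ ^ (((m : ℝ) - l) / 2)) ^ 2 * (κ⁻¹ * θ ^ l)
      = κ * ((θ ^ (((m : ℝ) - l) / 2)) ^ 2 * θ ^ l) := by
    field_simp
  rw [← h2]
  exact mul_le_mul_of_nonneg_left h1 (by positivity)

theorem pow_le_rate (H : IsRefinementHierarchy Ω Γ L θ κ M Mhat) (l m : ℕ) :
    θ ^ m ≤ θ ^ (((m : ℝ) - l) / 2) := by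
  rw [← Real.rpow_natCast θ m]
  refine Real.rpow_le_rpow_of_exponent_ge H.θ_pos H.θ_lt_one.le ?_
  have h1 : (0 : ℝ) ≤ m := Nat.cast_nonneg m
  have h2 : (0 : ℝ) ≤ l := Nat.cast_nonneg l
  linarith

theorem energyForm_le (H : IsRefinementHierarchy Ω Γ L θ κ M Mhat)
    (hR : ∀ l ≤ L, ∀ K ∈ M l, K.shapeRegularity ≤ R) (hR1 : 1 ≤ R)
    (hN : IsVertexColoring Γ L M Mhat 𝒩) (hE : IsEdgeColoring Γ L M Mhat ℰ) {l m : ℕ}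
    (hlm : l ≤ m) (hm : m ≤ L) {u v : E3 → E3} (hu : IsComponent Ω Mhat 𝒩 ℰ l u)
    (hv : IsComponent Ω Mhat 𝒩 ℰ m v) :
    energyForm Ω u v ≤ (5 * (4 * stepBound * R * R + 1) + 60 * R * (4 * stepBound * R + 1) + R) *
      κ * θ ^ (((m : ℝ) - l) / 2) * energyNorm Ω u * energyNorm Ω v := by
  have hl := hlm.trans hm
  have hst := stepBound_nonneg
  have hκ := H.κ_pos
  have hθ := H.θ_pos
  have hR0 : 0 ≤ R := zero_le_one.trans hR1
  set s := κ * θ ^ (((m : ℝ) - l) / 2) with hs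
  have hs0 : 0 ≤ s := by positivity
  have hδ : 0 < κ * θ ^ m := by positivity
  -- Used for the zero order term only: the full power θ^m is more than is required.
  have hδs : κ * θ ^ m ≤ s := mul_le_mul_of_nonneg_left (H.pow_le_rate l m) hκ.le
  have hratio := fun K (hK : K ∈ Mhat l) => H.mesh_ratio_le (m := m) hl hK
  have hsub := fun K (hK : K ∈ Mhat l) => H.interior_subset_domain hl hK
  have hmesh := H.hat_mesh l hl
  obtain ⟨w, hw, hdf, hedge⟩ := H.component_coarse hR hR1 hN hE hl hu
  have hu₁ := hw.normL2_le H.isOpen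
  have hu₂ := hw.normL2_curl_le H.isOpen
  have nu := normL2_nonneg Ω u
  have nw := normL2_nonneg Ω w
  have nv := normL2_nonneg Ω v
  have nU : 0 ≤ energyNorm Ω u := Real.sqrt_nonneg _
  have nV : 0 ≤ energyNorm Ω v := Real.sqrt_nonneg _
  rw [mul_assoc _ κ]
  rcases H.component_fine hR hN hE hm hv with ⟨z, hz, hvz⟩ | ⟨hz, f, hfv, hf⟩
  · have nz := normL2_nonneg Ω z
    have hv₂ := hz.normL2_curl_le H.isOpen
    have b₁ : |∫ x in Ω, inner ℝ (w x) (z x)|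
        ≤ (4 * stepBound * R * R + 1) * (5 * s) * normL2 Ω w * normL2 Ω z := by
      rcases hedge with hedge | rfl
      · exact hmesh.abs_integral_le H.regular hw.isWeakCurl.1 hz.isWeakCurl.1 (by positivity)
          fun K hK => (hedge K hK).abs_integral_curl_le H.isOpen (hsub K hK) hδ hR0 hR0 hs0
            (hratio K hK) hz.isWeakCurl hvz
      · simp only [Pi.zero_apply, inner_zero_left, integral_zero, abs_zero]
        positivity
    have b₂ : |∫ x in Ω, inner ℝ (u x) (v x)| ≤ R * s * normL2 Ω u * normL2 Ω z := by
      have h1 : normL2 Ω v ≤ R * s * normL2 Ω z :=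
        (normL2_le_mul (by positivity) hz.isWeakCurl.1 hvz).trans
          (mul_le_mul_of_nonneg_right (mul_le_mul_of_nonneg_left hδs hR0) nz)
      calc _ ≤ normL2 Ω u * normL2 Ω v := abs_integral_inner_le hw.memLp hz.memLp
        _ ≤ normL2 Ω u * (R * s * normL2 Ω z) := mul_le_mul_of_nonneg_left h1 nu
        _ = _ := by ring
    rw [hw.energyForm_eq H.isOpen hz]
    have c₁ : normL2 Ω w * normL2 Ω z ≤ energyNorm Ω u * energyNorm Ω v :=
      mul_le_mul hu₂ hv₂ nz nU
    have c₂ : normL2 Ω u * normL2 Ω z ≤ energyNorm Ω u * energyNorm Ω v :=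
      mul_le_mul hu₁ hv₂ nz nU
    calc _ ≤ (4 * stepBound * R * R + 1) * (5 * s) * normL2 Ω w * normL2 Ω z
          + R * s * normL2 Ω u * normL2 Ω z :=
          add_le_add ((le_abs_self _).trans b₁) ((le_abs_self _).trans b₂)
      _ = (4 * stepBound * R * R + 1) * (5 * s) * (normL2 Ω w * normL2 Ω z)
          + R * s * (normL2 Ω u * normL2 Ω z) := by ring
      -- The constant of the theorem adds up the curl-curl term, the zero order term (coefficient R)
      -- and the gradient case (60R = 12R · 5). The last one is not needed in this case and is added
      -- as a nonnegative surplus.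
      _ ≤ (4 * stepBound * R * R + 1) * (5 * s) * (energyNorm Ω u * energyNorm Ω v)
          + R * s * (energyNorm Ω u * energyNorm Ω v)
          + 60 * R * (4 * stepBound * R + 1) * s * (energyNorm Ω u * energyNorm Ω v) := by
          have : 0 ≤ 60 * R * (4 * stepBound * R + 1) * s * (energyNorm Ω u * energyNorm Ω v) := by
            positivity
          refine le_add_of_le_of_nonneg (add_le_add ?_ ?_) this
          · exact mul_le_mul_of_nonneg_left c₁ (by positivity)
          · exact mul_le_mul_of_nonneg_left c₂ (by positivity)
      _ = _ := by ring
  · have hv₁ := hz.normL2_le H.isOpen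
    have b : |∫ x in Ω, inner ℝ (u x) (v x)|
        ≤ (4 * stepBound * R + 1) * (12 * R) * (5 * s) * normL2 Ω u * normL2 Ω v :=
      hmesh.abs_integral_le H.regular hw.memLp hz.memLp (by positivity)
        fun K hK => (hdf K hK).abs_integral_gradient_le H.isOpen (hsub K hK) hδ (by positivity) hR0
          hs0 (hratio K hK) hfv hf
    rw [hw.energyForm_eq H.isOpen hz]
    simp only [Pi.zero_apply, inner_zero_right, integral_zero, zero_add]
    have c₁ : normL2 Ω u * normL2 Ω v ≤ energyNorm Ω u * energyNorm Ω v :=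
      mul_le_mul hu₁ hv₁ nv nU
    calc _ ≤ (4 * stepBound * R + 1) * (12 * R) * (5 * s) * normL2 Ω u * normL2 Ω v :=
          (le_abs_self _).trans b
      _ = 60 * R * (4 * stepBound * R + 1) * s * (normL2 Ω u * normL2 Ω v) := by ring
      _ ≤ 60 * R * (4 * stepBound * R + 1) * s * (energyNorm Ω u * energyNorm Ω v)
          + (5 * (4 * stepBound * R * R + 1) + R) * s * (energyNorm Ω u * energyNorm Ω v) := by
          have : 0 ≤ (5 * (4 * stepBound * R * R + 1) + R) * s *
              (energyNorm Ω u * energyNorm Ω v) := by positivity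
          exact le_add_of_le_of_nonneg (mul_le_mul_of_nonneg_left c₁ (by positivity)) this
      _ = _ := by ring

end IsRefinementHierarchy

end LocalMG

theorem mainTheorem6 (ρ : ℝ) :
    ∃ C : ℝ, 0 < C ∧
      ∀ (Ω Γ : Set LocalMG.E3) (L : ℕ) (θ κ : ℝ) (M Mhat : ℕ → Set LocalMG.Tetrahedron),
        LocalMG.IsRefinementHierarchy Ω Γ L θ κ M Mhat →
        (∀ l ≤ L, ∀ K ∈ M l, K.shapeRegularity ≤ ρ) →
        ∀ (PN PE : ℕ) (𝒩 : ℕ → Fin PN → Set LocalMG.E3)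
          (ℰ : ℕ → Fin PE → Set (Sym2 LocalMG.E3)),
          LocalMG.IsVertexColoring Γ L M Mhat 𝒩 →
          LocalMG.IsEdgeColoring Γ L M Mhat ℰ →
          ∀ l ≤ L, ∀ m ≤ L, ∀ u v : LocalMG.E3 → LocalMG.E3,
            LocalMG.IsComponent Ω Mhat 𝒩 ℰ l u →
            LocalMG.IsComponent Ω Mhat 𝒩 ℰ m v →
            LocalMG.energyForm Ω u v ≤
              C * κ * θ ^ (|(l : ℝ) - (m : ℝ)| / 2) *
                LocalMG.energyNorm Ω u * LocalMG.energyNorm Ω v := by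
  have hst := LocalMG.stepBound_nonneg
  -- ρ is an arbitrary real, so it is replaced by a bound that is at least 1. This makes the
  -- constant positive and lets 12R serve as inverse constant for constant fields too.
  have hR1 : 1 ≤ |ρ| + 1 := le_add_of_nonneg_left (abs_nonneg ρ)
  have hR0 : 0 ≤ |ρ| + 1 := zero_le_one.trans hR1
  refine ⟨5 * (4 * LocalMG.stepBound * (|ρ| + 1) * (|ρ| + 1) + 1)
    + 60 * (|ρ| + 1) * (4 * LocalMG.stepBound * (|ρ| + 1) + 1) + (|ρ| + 1), by positivity, ?_⟩
  intro Ω Γ L θ κ M Mhat H hρ PN PE 𝒩 ℰ hN hE l hl m hm u v hu hv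
  have hR : ∀ l ≤ L, ∀ K ∈ M l, K.shapeRegularity ≤ |ρ| + 1 := fun l hl K hK =>
    (hρ l hl K hK).trans ((le_abs_self ρ).trans (le_add_of_nonneg_right zero_le_one))
  rcases le_total l m with hlm | hml
  · have hlm' : (l : ℝ) ≤ m := Nat.cast_le.2 hlm
    rw [abs_sub_comm, abs_of_nonneg (sub_nonneg.2 hlm')]
    exact H.energyForm_le hR hR1 hN hE hlm hm hu hv
  · have hml' : (m : ℝ) ≤ l := Nat.cast_le.2 hml
    rw [abs_of_nonneg (sub_nonneg.2 hml'), LocalMG.energyForm_comm, mul_right_comm]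
    exact H.energyForm_le hR hR1 hN hE hml hl hv hu
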